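/- Let $N\ge 2$, $1\le i\le N-1$, $k\ge 1$, and let $q,t\in\mathbb C^\times$ be such that $t^2$ is a primitive $k$-th root of unity and $q$ is generic, i.e. $q^{2j}\ne 1$ for all $j\ne 0$. Put $p=qt^{-1}$ and let $C(q,t)$ be the $(N-1)\times(N-1)$ matrix $C_{ab}(q,t)=(p+p^{-1})\delta_{ab}-I_{ab}$, where $I$ is the incidence matrix of the Dynkin diagram of $\mathfrak{sl}_N$. The deformed Heisenberg algebra $\mathcal H$ is generated over $\mathbb C$ by $a_j[m]$ ($1\le j\le N-1$, $m\in\mathbb Z$) and central invertible elements $q^{2y_j[0]}$, with $[a_a[m],a_b[n]]=\frac1m(q^m-q^{-m})(t^m-t^{-m})C_{ab}(q^m,t^m)\delta_{m+n,0}$ (the right side being $0$ for $m=0$). For $m\neq0$ define $y_j[m]$ by $a_j[m]=\sum_l C_{lj}(q^m,t^m)y_l[m]$, and put $q^{2a_j[0]}=\prod_l (q^{2y_l[0]})^{C_{lj}(1,1)}$. Let $\widehat{\mathcal H}$ be the completion of $\mathcal H$ for the topology in which the left ideals generated by the monomials in the $a_j[m]$, $m>0$, of total degree at least $n$ ($n=0,1,2,\dots$)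 form a basis of neighbourhoods of $0$. Normal ordering $:\ :$ puts the modes with $m<0$ to the left of those with $m>0$. Set $$A_j(z)=p^{-2}q^{2a_j[0]}:\exp\Big(\sum_{m\ne0}a_j[m]z^{-m}\Big):,\qquad Y_j(z)=p^{-j(N-j)}q^{2y_j[0]}:\exp\Big(\sum_{m\neq0}y_j[m]z^{-m}\Big):,$$ $\Lambda_1(z)=Y_1(z)$ and $\Lambda_j(z)=:\Lambda_{j-1}(z)A_{j-1}(zp^{-j+1})^{-1}:$ for $2\le j\le N$. The weights $\lambda$ of the fundamental representation $V(\omega_i)$ correspond to the sequences $1\le l_1<\dots<l_i\le N$; for such $\lambda$ put $$Y_\lambda(z)=:\Lambda_{l_1}(zp^{-i+1})\Lambda_{l_2}(zp^{-i+3})\cdots\Lambda_{l_i}(zp^{i-1}):,\qquad T_i(z)=\sum_{\lambda\in P(V(\omega_i))}Y_\lambda(z)=\sum_{n\in\mathbb Z}T_i[n]z^{-n}.$$ The deformed algebra $\mathcal W_{q,t}[\mathfrak{sl}_N]$ is the closed subalgebra of $\widehat{\mathcal H}$ topologically generated by all modes $T_j[n]$, $1\le j\le N-1$, $n\in\mathbb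 Z$. Let $$f_{ii}(x)=\exp\Big(-\sum_{m>0}(q^m-q^{-m})(t^m-t^{-m})\,\big(C(q^m,t^m)^{-1}\big)_{ii}\,\frac{x^m}{m}\Big).$$ Then all the series above, and all coefficients of the series $\prod_{m<n}f_{ii}(z_n/z_m)\,T_i(z_1)\cdots T_i(z_k)$ expanded in powers of $z_n/z_m$ ($m<n$), are well defined in $\widehat{\mathcal H}$. After applying any continuous linear functional on $\widehat{\mathcal H}$ to its component of any given total degree, this last series converges for $|z_1|\gg\dots\gg|z_k|>0$ to a rational function of $z_1,\dots,z_k$, and in the sense of this analytic continuation the limit $$\Psi_i^{(k)}(z)=\lim_{z_m\to zt^{2(k-m)}}\Big(\prod_{m<n}f_{ii}\big(\tfrac{z_n}{z_m}\big)\Big)T_i(z_1)\cdots T_i(z_k)$$ exists and is a uniquely determined series $\Psi_i^{(k)}(z)=\sum_{d\in\mathbb Z}\Psi_i^{(k)}[d]z^{-d}$ with coefficients in $\widehat{\mathcal H}$. It satisfies $$\Psi_i^{(k)}(z)=\sum_{\lambda\in P(V(\omega_i))}:Y_\lambda(zt^{2(k-1)})\,Y_\lambda(zt^{2(k-2)})\cdots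 Y_\lambda(z):,$$ and every coefficient $\Psi_i^{(k)}[d]$ is a central element of $\mathcal W_{q,t}[\mathfrak{sl}_N]$: it belongs to $\mathcal W_{q,t}[\mathfrak{sl}_N]$ and commutes with all of it (indeed with all of $\widehat{\mathcal H}$). -/

import Mathlib

open Filter Topology UniformSpace

noncomputable section

namespace DeformedW

/-! ### The deformed Heisenberg algebra of `sl_N` -/

/-- Incidence matrix of the Dynkin diagram of `sl_N` (rows and columns `0, …, N - 2`). -/
def incidence (N : ℕ) (i j : Fin (N - 1)) : ℤ :=
  if i.val + 1 = j.val ∨ j.val + 1 = i.val then 1 else 0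

/-- Cartan matrix of `sl_N`. -/
def cartan (N : ℕ) (i j : Fin (N - 1)) : ℤ :=
  (if i = j then 2 else 0) - incidence N i j

/-- Deformed Cartan matrix `C(q,t)` of `sl_N`; as `sl_N` is simply laced, `B(q,t) = C(q,t)`. -/
def defCartan (N : ℕ) (q t : ℂ) : Matrix (Fin (N - 1)) (Fin (N - 1)) ℂ :=
  Matrix.of fun i j => (if i = j then q * t⁻¹ + q⁻¹ * t else 0) - (incidence N i j : ℂ)

/-- Generators: `a i m` is the oscillator `a_i[m]`, and `K i`, `Kinv i` stand for
`q^{2 y_i[0]}` and `q^{-2 y_i[0]}`. -/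
inductive Gen (N : ℕ) : Type
  | a (i : Fin (N - 1)) (m : ℤ) : Gen N
  | K (i : Fin (N - 1)) : Gen N
  | Kinv (i : Fin (N - 1)) : Gen N

/-- The scalar `[a_i[m], a_j[n]]`. At `m = 0` it is `0`. -/
def bracket (N : ℕ) (q t : ℂ) (i j : Fin (N - 1)) (m n : ℤ) : ℂ :=
  if m + n = 0 then
    (m : ℂ)⁻¹ * (q ^ m - q ^ (-m)) * (t ^ m - t ^ (-m)) * defCartan N (q ^ m) (t ^ m) i j
  else 0

/-- Defining relations of the deformed Heisenberg algebra. -/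
inductive Rel (N : ℕ) (q t : ℂ) : FreeAlgebra ℂ (Gen N) → FreeAlgebra ℂ (Gen N) → Prop
  | comm (i j : Fin (N - 1)) (m n : ℤ) :
      Rel N q t
        (FreeAlgebra.ι ℂ (Gen.a i m) * FreeAlgebra.ι ℂ (Gen.a j n))
        (FreeAlgebra.ι ℂ (Gen.a j n) * FreeAlgebra.ι ℂ (Gen.a i m) +
          algebraMap ℂ (FreeAlgebra ℂ (Gen N)) (bracket N q t i j m n))
  | central (i : Fin (N - 1)) (x : Gen N) :
      Rel N q t
        (FreeAlgebra.ι ℂ (Gen.K i) * FreeAlgebra.ι ℂ x)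
        (FreeAlgebra.ι ℂ x * FreeAlgebra.ι ℂ (Gen.K i))
  | inv (i : Fin (N - 1)) :
      Rel N q t (FreeAlgebra.ι ℂ (Gen.K i) * FreeAlgebra.ι ℂ (Gen.Kinv i)) 1

/-- The deformed Heisenberg algebra `H_{q,t}[sl_N]`, with `q^{± 2 y_i[0]}` adjoined. -/
def Heis (N : ℕ) (q t : ℂ) : Type := RingQuot (Rel N q t)

instance (N : ℕ) (q t : ℂ) : Ring (Heis N q t) := inferInstanceAs (Ring (RingQuot (Rel N q t)))

instance (N : ℕ) (q t : ℂ) : Algebra ℂ (Heis N q t) :=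
  inferInstanceAs (Algebra ℂ (RingQuot (Rel N q t)))

/-- The image of a generator in the Heisenberg algebra. -/
def gen (N : ℕ) (q t : ℂ) (x : Gen N) : Heis N q t :=
  RingQuot.mkAlgHom ℂ (Rel N q t) (FreeAlgebra.ι ℂ x)

variable {N : ℕ} {q t : ℂ}

theorem gen_comm (i j : Fin (N - 1)) (m n : ℤ) :
    gen N q t (.a i m) * gen N q t (.a j n) =
      gen N q t (.a j n) * gen N q t (.a i m) +
        algebraMap ℂ (Heis N q t) (bracket N q t i j m n) := by
  have h := RingQuot.mkAlgHom_rel ℂ (Rel.comm (q := q) (t := t) i j m n)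
  rw [map_mul, map_add, map_mul, AlgHom.commutes] at h
  exact h

theorem gen_K_comm (i : Fin (N - 1)) (x : Gen N) :
    gen N q t (.K i) * gen N q t x = gen N q t x * gen N q t (.K i) := by
  have h := RingQuot.mkAlgHom_rel ℂ (Rel.central (q := q) (t := t) i x)
  rw [map_mul, map_mul] at h
  exact h

theorem gen_K_mul_Kinv (i : Fin (N - 1)) :
    gen N q t (.K i) * gen N q t (.Kinv i) = 1 := by
  have h := RingQuot.mkAlgHom_rel ℂ (Rel.inv (q := q) (t := t) i)
  rw [map_mul, map_one] at h
  exact h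

/-- `q^{2 y_i[0]}` as an invertible element. -/
def zeroUnit (N : ℕ) (q t : ℂ) (i : Fin (N - 1)) : (Heis N q t)ˣ where
  val := gen N q t (.K i)
  inv := gen N q t (.Kinv i)
  val_inv := gen_K_mul_Kinv i
  inv_val := by rw [← gen_K_comm]; exact gen_K_mul_Kinv i

theorem heis_induction {P : Heis N q t → Prop} (hgen : ∀ x, P (gen N q t x))
    (hscal : ∀ c : ℂ, P (algebraMap ℂ (Heis N q t) c))
    (hadd : ∀ x y, P x → P y → P (x + y)) (hmul : ∀ x y, P x → P y → P (x * y))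
    (x : Heis N q t) : P x := by
  obtain ⟨y, rfl⟩ := RingQuot.mkAlgHom_surjective ℂ (Rel N q t) x
  induction y using FreeAlgebra.induction with
  | grade0 c => rw [AlgHom.commutes]; exact hscal c
  | grade1 x => exact hgen x
  | mul a b ha hb => rw [map_mul]; exact hmul _ _ ha hb
  | add a b ha hb => rw [map_add]; exact hadd _ _ ha hb

theorem gen_Kinv_comm (i : Fin (N - 1)) (y : Heis N q t) :
    y * gen N q t (.Kinv i) = gen N q t (.Kinv i) * y := by
  have hK : ∀ y : Heis N q t, Commute (gen N q t (.K i)) y := fun y =>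
    heis_induction (P := fun y => Commute (gen N q t (.K i)) y) (fun x => gen_K_comm i x)
      (fun c => (Algebra.commutes c _).symm) (fun _ _ h h' => h.add_right h')
      (fun _ _ h h' => h.mul_right h') y
  exact (Commute.units_inv_left (u := zeroUnit N q t i) (hK y)).symm

/-! ### The completion -/

/-- The monomial `a_{i_1}[m_1] ⋯ a_{i_r}[m_r]`. -/
def mono (N : ℕ) (q t : ℂ) (L : List (Fin (N - 1) × ℕ)) : Heis N q t :=
  (L.map fun x => gen N q t (.a x.1 x.2)).prod

/-- Monomials in the annihilation operators `a_i[m]`, `m > 0`, of total degree at least `n`. -/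
def posMonos (N : ℕ) (q t : ℂ) (n : ℕ) : Set (Heis N q t) :=
  {x | ∃ L : List (Fin (N - 1) × ℕ), (∀ y ∈ L, 0 < y.2) ∧ n ≤ (L.map Prod.snd).sum ∧
    x = mono N q t L}

/-- The left ideal generated by the monomials in the annihilation operators of total degree at
least `n`. -/
def posIdeal (N : ℕ) (q t : ℂ) (n : ℕ) : Ideal (Heis N q t) :=
  Ideal.span (posMonos N q t n)

theorem posIdeal_anti {m n : ℕ} (h : m ≤ n) : posIdeal N q t n ≤ posIdeal N q t m :=
  Ideal.span_mono fun _ ⟨L, h1, h2, h3⟩ => ⟨L, h1, h.trans h2, h3⟩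

theorem mono_commutator (j : Fin (N - 1)) (s : ℕ) (L : List (Fin (N - 1) × ℕ))
    (hL : ∀ y ∈ L, 0 < y.2) (n : ℕ) (hn : n + s ≤ (L.map Prod.snd).sum) :
    mono N q t L * gen N q t (.a j (-s)) - gen N q t (.a j (-s)) * mono N q t L ∈
      Submodule.span ℂ (posMonos N q t n) := by
  induction L generalizing n with
  | nil => simp [mono]
  | cons y L ih =>
    have hL' : ∀ y ∈ L, 0 < y.2 := fun z hz => hL z (List.mem_cons_of_mem _ hz)
    have hmono : mono N q t (y :: L) = gen N q t (.a y.1 y.2) * mono N q t L := by simp [mono]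
    simp only [List.map_cons, List.sum_cons] at hn
    have key : mono N q t (y :: L) * gen N q t (.a j (-s))
          - gen N q t (.a j (-s)) * mono N q t (y :: L)
        = gen N q t (.a y.1 y.2) * (mono N q t L * gen N q t (.a j (-s))
            - gen N q t (.a j (-s)) * mono N q t L)
          + bracket N q t y.1 j y.2 (-s) • mono N q t L := by
      rw [hmono, Algebra.smul_def]
      have h := gen_comm (q := q) (t := t) y.1 j y.2 (-s)
      have h2 : algebraMap ℂ (Heis N q t) (bracket N q t y.1 j y.2 (-s)) =
        gen N q t (.a y.1 y.2) * gen N q t (.a j (-s))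
          - gen N q t (.a j (-s)) * gen N q t (.a y.1 y.2) := by rw [h]; abel
      rw [h2]; noncomm_ring
    rw [key]
    refine Submodule.add_mem _ ?_ ?_
    · by_cases hs : s ≤ (L.map Prod.snd).sum
      · have h1 := ih hL' ((L.map Prod.snd).sum - s) (by omega)
        refine Submodule.span_induction (p := fun x _ => gen N q t (.a y.1 y.2) * x ∈
          Submodule.span ℂ (posMonos N q t n)) ?_ ?_ ?_ ?_ h1
        · rintro _ ⟨M, hM1, hM2, rfl⟩
          refine Submodule.subset_span ⟨y :: M, ?_, ?_, ?_⟩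
          · intro z hz
            rcases List.mem_cons.1 hz with rfl | hz
            · exact hL _ (List.mem_cons_self ..)
            · exact hM1 z hz
          · simp only [List.map_cons, List.sum_cons]; omega
          · simp [mono]
        · simp
        · intro a b _ _ ha hb
          rw [mul_add]; exact Submodule.add_mem _ ha hb
        · intro c a _ ha
          rw [mul_smul_comm]; exact Submodule.smul_mem _ _ ha
      · have h0 : mono N q t L * gen N q t (.a j (-s))
            - gen N q t (.a j (-s)) * mono N q t L = 0 := by
          push Not at hs
          clear key ih hn hmono hL
          induction L with
          | nil => simp [mono]
          | cons z M ihM =>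
            simp only [List.map_cons, List.sum_cons] at hs
            have hz := gen_comm (q := q) (t := t) z.1 j z.2 (-s)
            have hb : bracket N q t z.1 j z.2 (-s) = 0 := by
              unfold bracket; rw [if_neg]; omega
            rw [hb, map_zero, add_zero] at hz
            have hM := ihM (fun w hw => hL' w (List.mem_cons_of_mem _ hw)) (by omega)
            have hm : mono N q t (z :: M) = gen N q t (.a z.1 z.2) * mono N q t M := by
              simp [mono]
            rw [sub_eq_zero] at hM ⊢
            rw [hm, mul_assoc, hM, ← mul_assoc, hz, mul_assoc]
        rw [h0, mul_zero]; exact Submodule.zero_mem _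
    · by_cases hys : (y.2 : ℤ) + (-s) = 0
      · refine Submodule.smul_mem _ _ (Submodule.subset_span ⟨L, hL', by omega, rfl⟩)
      · rw [bracket, if_neg hys, zero_smul]; exact Submodule.zero_mem _

theorem span_le_posIdeal (n : ℕ) {x : Heis N q t}
    (hx : x ∈ Submodule.span ℂ (posMonos N q t n)) : x ∈ posIdeal N q t n := by
  refine Submodule.span_induction (p := fun x _ => x ∈ posIdeal N q t n) ?_ ?_ ?_ ?_ hx
  · exact fun x hx => Ideal.subset_span hx
  · exact Ideal.zero_mem _
  · exact fun _ _ _ _ ha hb => Ideal.add_mem _ ha hb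
  · intro c a _ ha
    rw [Algebra.smul_def]; exact Ideal.mul_mem_left _ _ ha

theorem posIdeal_mul_of {m n : ℕ} {x : Heis N q t}
    (h : ∀ y ∈ posMonos N q t m, y * x ∈ posIdeal N q t n) :
    ∀ y ∈ posIdeal N q t m, y * x ∈ posIdeal N q t n := by
  intro y hy
  refine Submodule.span_induction (p := fun y _ => y * x ∈ posIdeal N q t n) h ?_ ?_ ?_ hy
  · simp
  · intro a b _ _ ha hb
    rw [add_mul]; exact Ideal.add_mem _ ha hb
  · intro c a _ ha
    rw [smul_eq_mul, mul_assoc]; exact Ideal.mul_mem_left _ _ ha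

/-- Right multiplication is continuous for the topology defined by the left ideals `posIdeal`. -/
theorem posIdeal_mul_right (x : Heis N q t) :
    ∀ n, ∃ m, ∀ y ∈ posIdeal N q t m, y * x ∈ posIdeal N q t n := by
  refine heis_induction (P := fun x => ∀ n, ∃ m, ∀ y ∈ posIdeal N q t m,
    y * x ∈ posIdeal N q t n) ?_ ?_ ?_ ?_ x
  · rintro (⟨j, m⟩ | i | i) n
    · rcases le_or_gt m 0 with hm | hm
      · obtain ⟨s, rfl⟩ : ∃ s : ℕ, m = -s := ⟨m.natAbs, by omega⟩
        refine ⟨n + s, posIdeal_mul_of ?_⟩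
        rintro _ ⟨L, hL1, hL2, rfl⟩
        have h1 := span_le_posIdeal n (mono_commutator (q := q) (t := t) j s L hL1 n hL2)
        have h2 : gen N q t (.a j (-s)) * mono N q t L ∈ posIdeal N q t n :=
          Ideal.mul_mem_left _ _ (Ideal.subset_span ⟨L, hL1, by omega, rfl⟩)
        simpa using Ideal.add_mem _ h1 h2
      · obtain ⟨s, rfl⟩ : ∃ s : ℕ, m = s := ⟨m.natAbs, by omega⟩
        refine ⟨n, posIdeal_mul_of ?_⟩
        rintro _ ⟨L, hL1, hL2, rfl⟩
        refine Ideal.subset_span ⟨L ++ [(j, s)], ?_, ?_, ?_⟩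
        · intro y hy
          rcases List.mem_append.1 hy with hy | hy
          · exact hL1 y hy
          · rw [List.mem_singleton.1 hy]; simpa using hm
        · simp only [List.map_append, List.sum_append]; omega
        · simp [mono]
    · refine ⟨n, fun y hy => ?_⟩
      have hK : y * gen N q t (.K i) = gen N q t (.K i) * y :=
        (heis_induction (P := fun y => Commute (gen N q t (.K i)) y) (fun x => gen_K_comm i x)
          (fun c => (Algebra.commutes c _).symm) (fun _ _ h h' => h.add_right h')
          (fun _ _ h h' => h.mul_right h') y).symm
      rw [hK]; exact Ideal.mul_mem_left _ _ hy
    · refine ⟨n, fun y hy => ?_⟩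
      rw [gen_Kinv_comm]; exact Ideal.mul_mem_left _ _ hy
  · intro c n
    refine ⟨n, fun y hy => ?_⟩
    rw [← Algebra.commutes]; exact Ideal.mul_mem_left _ _ hy
  · intro x y hx hy n
    obtain ⟨m1, h1⟩ := hx n
    obtain ⟨m2, h2⟩ := hy n
    refine ⟨max m1 m2, fun z hz => ?_⟩
    rw [mul_add]
    exact Ideal.add_mem _ (h1 z (posIdeal_anti (le_max_left _ _) hz))
      (h2 z (posIdeal_anti (le_max_right _ _) hz))
  · intro x y hx hy n
    obtain ⟨m1, h1⟩ := hy n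
    obtain ⟨m2, h2⟩ := hx m1
    refine ⟨m2, fun z hz => ?_⟩
    rw [← mul_assoc]; exact h1 _ (h2 z hz)

theorem posIdeal_basis (N : ℕ) (q t : ℂ) :
    RingSubgroupsBasis fun n : ℕ => (posIdeal N q t n).toAddSubgroup where
  inter i j := ⟨max i j, fun _ hx =>
    ⟨posIdeal_anti (le_max_left i j) hx, posIdeal_anti (le_max_right i j) hx⟩⟩
  mul i := ⟨i, by rintro _ ⟨x, _, y, hy, rfl⟩; exact Ideal.mul_mem_left _ _ hy⟩
  leftMul x i := ⟨i, fun _ hy => Ideal.mul_mem_left _ _ hy⟩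
  rightMul x i := posIdeal_mul_right x i

/-- The topology on the Heisenberg algebra with the left ideals `posIdeal n` as a basis of
neighbourhoods of `0`. -/
instance (N : ℕ) (q t : ℂ) : TopologicalSpace (Heis N q t) := (posIdeal_basis N q t).topology

instance (N : ℕ) (q t : ℂ) : IsTopologicalRing (Heis N q t) :=
  (posIdeal_basis N q t).toRingFilterBasis.isTopologicalRing

instance (N : ℕ) (q t : ℂ) : UniformSpace (Heis N q t) :=
  IsTopologicalAddGroup.rightUniformSpace (Heis N q t)

instance (N : ℕ) (q t : ℂ) : IsUniformAddGroup (Heis N q t) :=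
  isUniformAddGroup_of_addCommGroup

instance (N : ℕ) (q t : ℂ) : UniformContinuousConstSMul ℂ (Heis N q t) where
  uniformContinuous_const_smul c := by
    have h : ((c • ·) : Heis N q t → Heis N q t) =
        (AddMonoidHom.mulLeft (algebraMap ℂ (Heis N q t) c)) := by
      funext x; simp [Algebra.smul_def]
    rw [h]
    exact uniformContinuous_addMonoidHom_of_continuous
      (continuous_const.mul continuous_id)

/-- The completed deformed Heisenberg algebra: infinite sums are allowed as long as they are
finite modulo each of the left ideals `posIdeal n`. -/
abbrev CHeis (N : ℕ) (q t : ℂ) : Type := Completion (Heis N q t)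

/-! ### Vertex operators -/

/-- The coefficient of `x ^ b` in `exp (∑_{m > 0} u m x ^ m)`. -/
def expCoeff {A : Type*} [Ring A] [Algebra ℂ A] (u : ℕ → A) (b : ℕ) : A :=
  ∑ r ∈ Finset.range (b + 1),
    ((r.factorial : ℂ))⁻¹ •
      PowerSeries.coeff b ((PowerSeries.mk fun m => if m = 0 then 0 else u m) ^ r)

/-- The normally ordered vertex operator
`coeff * q^{2 ∑_j zero j * y_j[0]} :exp (∑_{m ≠ 0} ∑_j osc m j * a_j[m] z^{-m}):`
(the value `osc 0` plays no role). -/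
@[ext]
structure VertexOp (N : ℕ) where
  coeff : ℂ
  zero : Fin (N - 1) → ℤ
  osc : ℤ → Fin (N - 1) → ℂ

namespace VertexOp

/-- The normally ordered product. -/
instance : Mul (VertexOp N) := ⟨fun U V => ⟨U.coeff * V.coeff, U.zero + V.zero, U.osc + V.osc⟩⟩

instance : One (VertexOp N) := ⟨⟨1, 0, 0⟩⟩

instance : CommMonoid (VertexOp N) where
  mul_assoc U V W := VertexOp.ext (mul_assoc _ _ _) (add_assoc _ _ _) (add_assoc _ _ _)
  one_mul U := VertexOp.ext (one_mul _) (zero_add _) (zero_add _)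
  mul_one U := VertexOp.ext (mul_one _) (add_zero _) (add_zero _)
  mul_comm U V := VertexOp.ext (mul_comm _ _) (add_comm _ _) (add_comm _ _)

/-- The inverse for the normally ordered product. -/
instance : Inv (VertexOp N) := ⟨fun U => ⟨U.coeff⁻¹, -U.zero, -U.osc⟩⟩

/-- The substitution `z ↦ z c`. -/
def shift (c : ℂ) (U : VertexOp N) : VertexOp N :=
  ⟨U.coeff, U.zero, fun m j => c ^ (-m) * U.osc m j⟩

/-- The zero mode part of a vertex operator. -/
def zeroPart (q t : ℂ) (U : VertexOp N) : Heis N q t :=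
  U.coeff • (List.ofFn fun j => ((zeroUnit N q t j ^ U.zero j : (Heis N q t)ˣ) : Heis N q t)).prod

/-- Coefficient of `z ^ a` in `exp (∑_{m > 0} ∑_j osc (-m) j * a_j[-m] z ^ m)`. -/
def creation (q t : ℂ) (U : VertexOp N) (a : ℕ) : Heis N q t :=
  expCoeff (fun m => ∑ j, U.osc (-(m : ℤ)) j • gen N q t (.a j (-(m : ℤ)))) a

/-- Coefficient of `z ^ (-b)` in `exp (∑_{m > 0} ∑_j osc m j * a_j[m] z ^ (-m))`. -/
def annihilation (q t : ℂ) (U : VertexOp N) (b : ℕ) : Heis N q t :=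
  expCoeff (fun m => ∑ j, U.osc (m : ℤ) j • gen N q t (.a j (m : ℤ))) b

/-- The terms of the coefficient of `z ^ (-n)` of a vertex operator. -/
def modeTerm (q t : ℂ) (U : VertexOp N) (n : ℤ)
    (x : {x : ℕ × ℕ // (x.2 : ℤ) - (x.1 : ℤ) = n}) : CHeis N q t :=
  ((U.zeroPart q t * U.creation q t x.1.1 * U.annihilation q t x.1.2 : Heis N q t) : CHeis N q t)

/-- The coefficient of `z ^ (-n)` of a vertex operator. -/
def mode (q t : ℂ) (U : VertexOp N) (n : ℤ) : CHeis N q t :=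
  ∑' x, U.modeTerm q t n x

end VertexOp

/-- `A_i(z) = t^2 q^{-2} q^{2 a_i[0]} :exp (∑_{m ≠ 0} a_i[m] z^{-m}):`, where
`a_i[0] = ∑_j C_{ji} y_j[0]`. -/
def vertexA (N : ℕ) (q t : ℂ) (i : Fin (N - 1)) : VertexOp N where
  coeff := (t * q⁻¹) ^ 2
  zero := fun j => cartan N j i
  osc := fun _ j => if j = i then 1 else 0

/-- `Y_i(z) = (t q^{-1})^{2(ρ,ω_i)} q^{2 y_i[0]} :exp (∑_{m ≠ 0} y_i[m] z^{-m}):`, where the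
`y_j[m]` are determined by `a_i[m] = ∑_j C_{ji}(q^m,t^m) y_j[m]`. For the `i`-th fundamental
weight, `1 ≤ i ≤ N - 1`, one has `2(ρ,ω_i) = i (N - i)`. -/
def vertexY (N : ℕ) (q t : ℂ) (i : Fin (N - 1)) : VertexOp N where
  coeff := (t * q⁻¹) ^ ((i.val + 1) * (N - (i.val + 1)))
  zero := fun j => if j = i then 1 else 0
  osc := fun m j => ((defCartan N (q ^ m) (t ^ m)).transpose)⁻¹ i j

/-- `Λ_{j+1}(z)`: `Λ_1(z) = Y_1(z)` and `Λ_{j+1}(z) = :Λ_j(z) A_j(z p^{-j})^{-1}:` for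
`1 ≤ j ≤ N - 1`, with `p = q t^{-1}` (the value for `j ≥ N` plays no role). -/
def vertexLambda (N : ℕ) (q t : ℂ) : ℕ → VertexOp N
  | 0 => if h : 0 < N - 1 then vertexY N q t ⟨0, h⟩ else 1
  | j + 1 => if h : j < N - 1 then
      vertexLambda N q t j * ((vertexA N q t ⟨j, h⟩).shift ((q * t⁻¹) ^ (-(j + 1 : ℤ))))⁻¹
    else 1

/-- The weights of `V(ω_r)`: the weight `ε_{l_1} + ⋯ + ε_{l_r}` is the strictly increasing
sequence `l_1 < ⋯ < l_r`, indexed from `0`. -/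
def weights (N r : ℕ) : Finset (Fin r → Fin N) :=
  Finset.univ.filter fun l => ∀ a b, a < b → l a < l b

/-- `Y_λ(z) = :Λ_{l_1}(z p^{-r+1}) Λ_{l_2}(z p^{-r+3}) ⋯ Λ_{l_r}(z p^{r-1}):`. -/
def vertexWeight (N : ℕ) (q t : ℂ) {r : ℕ} (l : Fin r → Fin N) : VertexOp N :=
  ∏ a : Fin r, (vertexLambda N q t (l a)).shift ((q * t⁻¹) ^ (-(r : ℤ) + 2 * (a.val : ℤ) + 1))

/-- The mode `T_i[n]` of the generating field `T_i(z)` (here `i` counts from `0`). -/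
def genT (N : ℕ) (q t : ℂ) (i : Fin (N - 1)) (n : ℤ) : CHeis N q t :=
  ∑ l ∈ weights N (i.val + 1), (vertexWeight N q t l).mode q t n

/-- The deformed `W`-algebra of `sl_N`: the closed subalgebra of the completed Heisenberg
algebra topologically generated by the modes of the fields `T_1(z), …, T_{N-1}(z)`. -/
def WAlg (N : ℕ) (q t : ℂ) : Subalgebra ℂ (CHeis N q t) :=
  (Algebra.adjoin ℂ {x | ∃ (i : Fin (N - 1)) (n : ℤ), x = genT N q t i n}).topologicalClosure

/-! ### The corrected products and their limit -/

/-- Coefficients of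
`f_{ii}(x) = exp (-∑_{m > 0} (q^m - q^{-m}) (t^m - t^{-m}) M_{ii}(q^m,t^m) x^m / m)`, where
`M(q,t) = C(q,t)⁻¹`. -/
def fCoeff (N : ℕ) (q t : ℂ) (i : Fin (N - 1)) (r : ℕ) : ℂ :=
  expCoeff (fun m => -((q ^ m - (q ^ m)⁻¹) * (t ^ m - (t ^ m)⁻¹) *
    (defCartan N (q ^ m) (t ^ m))⁻¹ i i / (m : ℂ))) r

/-- In the expansion of `∏_{m < n} f_{ii}(z_n / z_m) T_i(z_1) ⋯ T_i(z_k)` in powers of the ratios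
`z_n / z_m`, `m < n`, the contribution to the coefficient of `z_1^{-n_1} ⋯ z_k^{-n_k}` of the
terms `(z_n / z_m)^{e (m, n)}` of the factors `f_{ii}(z_n / z_m)`. -/
def correctedTerm (N : ℕ) (q t : ℂ) (i : Fin (N - 1)) (k : ℕ) (n : Fin k → ℤ)
    (e : {x : Fin k × Fin k // x.1 < x.2} → ℕ) : CHeis N q t :=
  (∏ x, fCoeff N q t i (e x)) •
    (List.ofFn fun j : Fin k => genT N q t i
      (n j + ∑ x, (if x.1.2 = j then (e x : ℤ) else 0)
        - ∑ x, (if x.1.1 = j then (e x : ℤ) else 0))).prod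

/-- The coefficient of `z_1^{-n_1} ⋯ z_k^{-n_k}` in `∏_{m < n} f_{ii}(z_n / z_m) T_i(z_1) ⋯ T_i(z_k)`. -/
def correctedCoeff (N : ℕ) (q t : ℂ) (i : Fin (N - 1)) (k : ℕ) (n : Fin k → ℤ) : CHeis N q t :=
  ∑' e, correctedTerm N q t i k n e

/-- The series `∑_n g n z_1^{-n_1} ⋯ z_k^{-n_k}` converges for `|z_1| ≫ ⋯ ≫ |z_k| > 0`, its sum
continues to a rational function of `z_1, …, z_k`, and this rational function tends to `c` as
`(z_1, …, z_k)` tends to `w` off the zero set of its denominator. -/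
def HasContinuedLimit {k : ℕ} (g : (Fin k → ℤ) → ℂ) (w : Fin k → ℂ) (c : ℂ) : Prop :=
  ∃ P Q : MvPolynomial (Fin k) ℂ,
    (∃ δ : ℝ, 0 < δ ∧ ∀ z : Fin k → ℂ, (∀ m, z m ≠ 0) →
      (∀ m n, m < n → ‖z n‖ < δ * ‖z m‖) →
        MvPolynomial.eval z Q ≠ 0 ∧
        HasSum (fun n : Fin k → ℤ => g n * ∏ m, z m ^ (-n m))
          (MvPolynomial.eval z P / MvPolynomial.eval z Q)) ∧
    Tendsto (fun z => MvPolynomial.eval z P / MvPolynomial.eval z Q)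
      (𝓝[{z | MvPolynomial.eval z Q ≠ 0}] w) (𝓝 c)

/-- `∑_d Ψ[d] z^{-d}` is the limit of `∏_{m < n} f_{ii}(z_n / z_m) T_i(z_1) ⋯ T_i(z_k)` as
`z_m → z t^{2(k-m)}`, `m = 1, …, k`, for each `z ≠ 0`. The products are understood by analytic
continuation of their matrix elements, that is, after applying a continuous linear functional to
the homogeneous component of each total degree `d`. -/
def IsRegularizedLimit (N : ℕ) (q t : ℂ) (i : Fin (N - 1)) (k : ℕ) (Ψ : ℤ → CHeis N q t) : Prop :=
  ∀ (φ : CHeis N q t →L[ℂ] ℂ) (d : ℤ) (z : ℂ), z ≠ 0 →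
    HasContinuedLimit
      (fun n : Fin k → ℤ => if ∑ m, n m = d then φ (correctedCoeff N q t i k n) else 0)
      (fun m => z * t ^ (2 * (k - (m.val + 1))))
      (φ (Ψ d) * z ^ (-d))

/-- `:Y_λ(z t^{2(k-1)}) Y_λ(z t^{2(k-2)}) ⋯ Y_λ(z):`. -/
def vertexPower (N : ℕ) (q t : ℂ) (k : ℕ) {r : ℕ} (l : Fin r → Fin N) : VertexOp N :=
  ∏ m : Fin k, (vertexWeight N q t l).shift (t ^ (2 * (k - (m.val + 1))))

end DeformedW

end

noncomputable section

namespace DeformedW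

/-! ### Exponentials of power series with commuting coefficients -/

section Exponential

variable {A : Type*} [Ring A]

/-- The Euler operator `X d/dX`. -/
def euler (F : PowerSeries A) : PowerSeries A :=
  PowerSeries.mk fun n => (n : A) * PowerSeries.coeff n F

@[simp]
theorem coeff_euler (F : PowerSeries A) (n : ℕ) :
    PowerSeries.coeff n (euler F) = (n : A) * PowerSeries.coeff n F := PowerSeries.coeff_mk _ _

theorem euler_add (F G : PowerSeries A) : euler (F + G) = euler F + euler G := by
  ext n; simp [mul_add]

theorem euler_sub (F G : PowerSeries A) : euler (F - G) = euler F - euler G := by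
  ext n; simp [mul_sub]

theorem euler_mul (F G : PowerSeries A) : euler (F * G) = euler F * G + F * euler G := by
  ext n
  simp only [coeff_euler, map_add, PowerSeries.coeff_mul, Finset.mul_sum]
  rw [← Finset.sum_add_distrib]
  refine Finset.sum_congr rfl fun x hx => ?_
  rw [← Finset.HasAntidiagonal.mem_antidiagonal.1 hx,
    ← mul_assoc (PowerSeries.coeff x.1 F) (x.2 : A),
    ← (Nat.cast_commute x.2 (PowerSeries.coeff x.1 F)).eq]
  push_cast
  noncomm_ring

theorem euler_C (a : A) : euler (PowerSeries.C a) = 0 := by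
  ext n
  rw [coeff_euler, PowerSeries.coeff_C]
  split_ifs with h <;> simp [h]

theorem commute_powerSeries {F G : PowerSeries A}
    (h : ∀ i j, Commute (PowerSeries.coeff i F) (PowerSeries.coeff j G)) : Commute F G := by
  ext n
  rw [PowerSeries.coeff_mul, PowerSeries.coeff_mul, ← Finset.Nat.sum_antidiagonal_swap]
  exact Finset.sum_congr rfl fun x _ => h _ _

theorem commute_C {a : A} {F : PowerSeries A}
    (h : ∀ j, Commute a (PowerSeries.coeff j F)) : Commute (PowerSeries.C a) F := by
  refine commute_powerSeries fun i j => ?_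
  rw [PowerSeries.coeff_C]
  split_ifs
  · exact h j
  · exact Commute.zero_left _

theorem euler_pow {F : PowerSeries A} (h : Commute F (euler F)) (n : ℕ) :
    euler (F ^ (n + 1)) = ((n + 1 : ℕ) : PowerSeries A) * (euler F * F ^ n) := by
  induction n with
  | zero => simp
  | succ n ih =>
    rw [pow_succ', euler_mul, ih, ← mul_assoc F, ← (Nat.cast_commute (n + 1) F).eq,
      mul_assoc, ← mul_assoc F, h.eq, mul_assoc, ← pow_succ']
    push_cast
    noncomm_ring

theorem coeff_monomial_mul (m n : ℕ) (a : A) (F : PowerSeries A) :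
    PowerSeries.coeff n (PowerSeries.monomial m a * F) =
      if m ≤ n then a * PowerSeries.coeff (n - m) F else 0 := by
  rw [PowerSeries.coeff_mul]
  simp only [PowerSeries.coeff_monomial, ite_mul, zero_mul]
  split_ifs with h
  · rw [Finset.sum_eq_single (m, n - m)]
    · simp
    · intro x hx hne
      have := Finset.HasAntidiagonal.mem_antidiagonal.1 hx
      rw [if_neg]
      rintro h1
      exact hne (Prod.ext h1 (by simp; omega))
    · intro h'
      exact absurd (Finset.HasAntidiagonal.mem_antidiagonal.2 (by simp; omega)) h'
  · refine Finset.sum_eq_zero fun x hx => if_neg ?_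
    have := Finset.HasAntidiagonal.mem_antidiagonal.1 hx
    omega

theorem coeff_zero_euler (F : PowerSeries A) : PowerSeries.coeff 0 (euler F) = 0 := by simp

theorem commute_coeff_pow {x : A} {F : PowerSeries A}
    (h : ∀ m, Commute x (PowerSeries.coeff m F)) (r b : ℕ) :
    Commute x (PowerSeries.coeff b (F ^ r)) := by
  have h1 : PowerSeries.C x * F ^ r = F ^ r * PowerSeries.C x := ((commute_C h).pow_right r).eq
  have h2 := congrArg (PowerSeries.coeff b) h1
  rwa [PowerSeries.coeff_C_mul, PowerSeries.coeff_mul_C] at h2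

/-- The power series `∑_{m > 0} u m X ^ m`. -/
def posSeries (u : ℕ → A) : PowerSeries A := PowerSeries.mk fun m => if m = 0 then 0 else u m

@[simp]
theorem coeff_posSeries (u : ℕ → A) (m : ℕ) :
    PowerSeries.coeff m (posSeries u) = if m = 0 then 0 else u m := PowerSeries.coeff_mk _ _

theorem coeff_posSeries_pow_eq_zero (u : ℕ → A) {b r : ℕ} (h : b < r) :
    PowerSeries.coeff b (posSeries u ^ r) = 0 := by
  induction r generalizing b with
  | zero => omega
  | succ r ih =>
    rw [pow_succ', PowerSeries.coeff_mul]
    refine Finset.sum_eq_zero fun x hx => ?_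
    have := Finset.HasAntidiagonal.mem_antidiagonal.1 hx
    rcases Nat.eq_zero_or_pos x.1 with h0 | h0
    · rw [h0, coeff_posSeries, if_pos rfl, zero_mul]
    · rw [ih (by omega), mul_zero]

theorem posSeries_add (u v : ℕ → A) : posSeries (u + v) = posSeries u + posSeries v := by
  ext m; simp only [coeff_posSeries, map_add, Pi.add_apply]; split_ifs <;> simp

variable [Algebra ℂ A]

/-- A power series over a `ℂ`-algebra is determined by its constant term and a linear
differential equation. -/
theorem eq_of_euler_eq {w F G : PowerSeries A} (hw : PowerSeries.coeff 0 w = 0)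
    (hF : euler F = w * F) (hG : euler G = w * G)
    (h0 : PowerSeries.coeff 0 F = PowerSeries.coeff 0 G) : F = G := by
  ext n
  induction n using Nat.strong_induction_on with
  | _ n ih =>
    rcases Nat.eq_zero_or_pos n with rfl | hn
    · exact h0
    have h1 : (n : A) * PowerSeries.coeff n F = (n : A) * PowerSeries.coeff n G := by
      rw [← coeff_euler, ← coeff_euler, hF, hG, PowerSeries.coeff_mul, PowerSeries.coeff_mul]
      refine Finset.sum_congr rfl fun x hx => ?_
      rcases Nat.eq_zero_or_pos x.1 with h | h
      · rw [h, hw, zero_mul, zero_mul]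
      · rw [ih x.2 (by have := Finset.HasAntidiagonal.mem_antidiagonal.1 hx; omega)]
    have h2 : ((n : ℂ)⁻¹ • ((n : A) * PowerSeries.coeff n F)) =
        (n : ℂ)⁻¹ • ((n : A) * PowerSeries.coeff n G) := by rw [h1]
    have h3 : ∀ x : A, ((n : ℂ)⁻¹ • ((n : A) * x)) = x := fun x => by
      rw [← nsmul_eq_mul, ← Nat.cast_smul_eq_nsmul ℂ, smul_smul,
        inv_mul_cancel₀ (by exact_mod_cast hn.ne'), one_smul]
    rwa [h3, h3] at h2

/-- The power series `exp (∑_{m > 0} u m X ^ m)`. -/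
def expSeries (u : ℕ → A) : PowerSeries A := PowerSeries.mk (expCoeff u)

@[simp]
theorem coeff_expSeries (u : ℕ → A) (m : ℕ) :
    PowerSeries.coeff m (expSeries u) = expCoeff u m := PowerSeries.coeff_mk _ _

theorem expCoeff_def (u : ℕ → A) (b : ℕ) : expCoeff u b = ∑ r ∈ Finset.range (b + 1),
    ((r.factorial : ℂ))⁻¹ • PowerSeries.coeff b (posSeries u ^ r) := rfl

@[simp]
theorem expCoeff_zero (u : ℕ → A) : expCoeff u 0 = 1 := by simp [expCoeff]

theorem expCoeff_eq_sum_range (u : ℕ → A) {b B : ℕ} (h : b < B) :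
    expCoeff u b = ∑ r ∈ Finset.range B,
      ((r.factorial : ℂ))⁻¹ • PowerSeries.coeff b (posSeries u ^ r) := by
  rw [expCoeff_def]
  refine Finset.sum_subset (Finset.range_mono h) fun r _ hr => ?_
  rw [coeff_posSeries_pow_eq_zero u (by simpa using hr), smul_zero]

theorem commute_expCoeff {x : A} {u : ℕ → A} (h : ∀ m, 0 < m → Commute x (u m)) (b : ℕ) :
    Commute x (expCoeff u b) := by
  rw [expCoeff_def]
  refine Commute.sum_right _ _ _ fun r _ => Commute.smul_right ?_ _
  refine commute_coeff_pow (fun m => ?_) r b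
  rw [coeff_posSeries]
  split_ifs with h0
  · exact Commute.zero_right _
  · exact h m (Nat.pos_of_ne_zero h0)

theorem euler_expSeries {u : ℕ → A} (h : ∀ m n, 0 < m → 0 < n → Commute (u m) (u n)) :
    euler (expSeries u) = euler (posSeries u) * expSeries u := by
  have hc : Commute (posSeries u) (euler (posSeries u)) := by
    refine commute_powerSeries fun i j => ?_
    rw [coeff_euler, coeff_posSeries, coeff_posSeries]
    split_ifs with h1 h2
    · exact Commute.zero_left _
    · exact Commute.zero_left _
    · simp
    · exact ((Nat.cast_commute j (u i)).symm).mul_right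
        (h i j (Nat.pos_of_ne_zero h1) (by omega))
  ext b
  rw [coeff_euler, coeff_expSeries, expCoeff_eq_sum_range u (Nat.lt_succ_of_lt b.lt_succ_self),
    Finset.mul_sum, Finset.sum_range_succ']
  have h0 : (b : A) * (((Nat.factorial 0 : ℕ) : ℂ)⁻¹ •
      PowerSeries.coeff b (posSeries u ^ 0)) = 0 := by
    rw [pow_zero, PowerSeries.coeff_one]
    split_ifs with h <;> simp [h]
  rw [h0, add_zero, PowerSeries.coeff_mul]
  have h1 : ∀ r, (b : A) * (((Nat.factorial (r + 1) : ℕ) : ℂ)⁻¹ •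
      PowerSeries.coeff b (posSeries u ^ (r + 1))) =
      ((Nat.factorial r : ℕ) : ℂ)⁻¹ • PowerSeries.coeff b (euler (posSeries u) * posSeries u ^ r) := by
    intro r
    rw [mul_smul_comm, ← coeff_euler, euler_pow hc, ← nsmul_eq_mul, map_nsmul,
      ← Nat.cast_smul_eq_nsmul ℂ, smul_smul, Nat.factorial_succ]
    congr 1
    have : ((r + 1 : ℕ) : ℂ) ≠ 0 := by exact_mod_cast r.succ_ne_zero
    push_cast at this ⊢
    rw [mul_inv, mul_comm, ← mul_assoc, mul_inv_cancel₀ this, one_mul]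
  simp_rw [h1, PowerSeries.coeff_mul, Finset.smul_sum]
  rw [Finset.sum_comm]
  refine Finset.sum_congr rfl fun x hx => ?_
  rw [coeff_expSeries, expCoeff_eq_sum_range u (B := b + 1)
    (by have := Finset.HasAntidiagonal.mem_antidiagonal.1 hx; omega), Finset.mul_sum]
  simp_rw [mul_smul_comm]

theorem expSeries_add {u v : ℕ → A} (huu : ∀ m n, 0 < m → 0 < n → Commute (u m) (u n))
    (hvv : ∀ m n, 0 < m → 0 < n → Commute (v m) (v n))
    (huv : ∀ m n, 0 < m → 0 < n → Commute (u m) (v n)) :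
    expSeries (u + v) = expSeries u * expSeries v := by
  refine eq_of_euler_eq (w := euler (posSeries (u + v))) (coeff_zero_euler _)
    (euler_expSeries fun m n hm hn => ?_) ?_ (by simp [PowerSeries.coeff_mul])
  · exact ((huu m n hm hn).add_right (huv m n hm hn)).add_left
      ((huv n m hn hm).symm.add_right (hvv m n hm hn))
  · have hc : Commute (expSeries u) (euler (posSeries v)) := by
      refine commute_powerSeries fun i j => ?_
      rw [coeff_expSeries, coeff_euler, coeff_posSeries]
      split_ifs with h0
      · simp
      · exact (Nat.cast_commute j _).symm.mul_right (commute_expCoeff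
          (fun m hm => (huv m j hm (Nat.pos_of_ne_zero h0)).symm) i).symm
    rw [euler_mul, euler_expSeries huu, euler_expSeries hvv, posSeries_add, euler_add, ← mul_assoc,
      hc.eq]
    noncomm_ring

/-- Adding a commutator: if `x` has scalar commutator `γ` with `u m` and commutes with the other
`u n`, then `[x, exp (∑ u n X ^ n)] = γ X ^ m exp (∑ u n X ^ n)`. -/
theorem C_mul_expSeries {u : ℕ → A} (huu : ∀ m n, 0 < m → 0 < n → Commute (u m) (u n))
    {x : A} {m : ℕ} {γ : ℂ}
    (hx : ∀ n, 0 < n → x * u n = u n * x + algebraMap ℂ A (if n = m then γ else 0)) (hm : 0 < m) :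
    PowerSeries.C x * expSeries u = expSeries u * PowerSeries.C x +
      PowerSeries.monomial m (algebraMap ℂ A γ) * expSeries u := by
  rw [← sub_eq_zero, ← sub_sub]
  set M := PowerSeries.monomial m (algebraMap ℂ A γ) with hM
  have hMc : ∀ F : PowerSeries A, M * F = F * M := fun F => by
    refine commute_powerSeries fun i j => ?_
    rw [hM, PowerSeries.coeff_monomial]
    split_ifs
    · exact Algebra.commutes _ _
    · exact Commute.zero_left _
  have hME : euler M = (m : PowerSeries A) * M := by
    ext n
    rw [coeff_euler, ← nsmul_eq_mul m, map_nsmul, hM, PowerSeries.coeff_monomial]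
    split_ifs with h
    · rw [h, nsmul_eq_mul]
    · simp
  have h1 : PowerSeries.C x * euler (posSeries u) = euler (posSeries u) * PowerSeries.C x +
      euler M := by
    ext n
    rw [map_add, PowerSeries.coeff_C_mul, PowerSeries.coeff_mul_C, coeff_euler, coeff_euler,
      coeff_posSeries, hM, PowerSeries.coeff_monomial]
    by_cases h : n = 0
    · simp [h]
    rw [if_neg h, ← mul_assoc, ← (Nat.cast_commute n x).eq, mul_assoc, hx n (by omega)]
    split_ifs with h'
    · noncomm_ring
    · simp [mul_assoc]
  refine eq_of_euler_eq (w := euler (posSeries u)) (coeff_zero_euler _) ?_ ?_ ?_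
  · rw [euler_sub, euler_sub, euler_mul, euler_mul, euler_mul, euler_C, euler_expSeries huu,
      ← mul_assoc, h1, hMc (_ * _), hMc (expSeries u)]
    have : euler M * expSeries u = expSeries u * euler M := by
      rw [hME, mul_assoc, hMc, ← mul_assoc, (Nat.cast_commute m (expSeries u)).eq, mul_assoc]
    rw [this]
    have h3 := this
    simp only [zero_mul, mul_zero, add_zero, zero_add, mul_sub, add_mul, this]
    noncomm_ring
  · rw [mul_zero]; ext; simp
  · have hM0 : PowerSeries.coeff 0 M = 0 := by
      rw [hM, PowerSeries.coeff_monomial, if_neg hm.ne]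
    rw [PowerSeries.coeff_zero_eq_constantCoeff] at hM0 ⊢
    have h1 : PowerSeries.constantCoeff (expSeries u) = 1 := by
      rw [← PowerSeries.coeff_zero_eq_constantCoeff, coeff_expSeries, expCoeff_zero]
    simp [hM0, h1]

/-- The formal version of `e^x e^y = e^{[x,y]} e^y e^x` for scalar commutators. -/
theorem expCoeff_mul_expCoeff {u v : ℕ → A} {γ : ℕ → ℂ}
    (huu : ∀ m n, 0 < m → 0 < n → Commute (u m) (u n))
    (hvv : ∀ m n, 0 < m → 0 < n → Commute (v m) (v n))
    (huv : ∀ m n, 0 < m → 0 < n →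
      u m * v n = v n * u m + algebraMap ℂ A (if n = m then γ m else 0)) (a b : ℕ) :
    expCoeff u b * expCoeff v a = ∑ s ∈ Finset.range (min a b + 1),
      expCoeff γ s • (expCoeff v (a - s) * expCoeff u (b - s)) := by
  let u' : ℕ → PowerSeries A := fun m => PowerSeries.C (u m)
  let γ' : ℕ → PowerSeries A := fun m => PowerSeries.monomial m (algebraMap ℂ A (γ m))
  let V : PowerSeries (PowerSeries A) := PowerSeries.C (expSeries v)
  have hγc : ∀ m (F : PowerSeries A), Commute (γ' m) F := fun m F => by
    refine commute_powerSeries fun i j => ?_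
    rw [PowerSeries.coeff_monomial]
    split_ifs
    · exact Algebra.commutes _ _
    · exact Commute.zero_left _
  have hGc : ∀ m (F : PowerSeries A), Commute (expCoeff γ' m) F := fun m F =>
    (commute_expCoeff (fun n _ => (hγc n F).symm) m).symm
  have hu' : ∀ m n, 0 < m → 0 < n → Commute (u' m) (u' n) := fun m n hm hn => by
    change _ * _ = _ * _
    simp only [u', ← map_mul, (huu m n hm hn).eq]
  have key : expSeries u' * V = expSeries γ' * V * expSeries u' := by
    refine eq_of_euler_eq (w := euler (posSeries u')) (coeff_zero_euler _) ?_ ?_ ?_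
    · rw [euler_mul, euler_C, mul_zero, add_zero, euler_expSeries hu', mul_assoc]
    · have h1 : euler (posSeries u') * V = V * euler (posSeries u') + euler (posSeries γ') * V := by
        ext n : 1
        simp only [V, map_add, PowerSeries.coeff_C_mul, PowerSeries.coeff_mul_C, coeff_euler,
          coeff_posSeries]
        split_ifs with h
        · simp
        · have := C_mul_expSeries hvv (x := u n) (m := n) (γ := γ n)
            (fun r hr => by
              have := huv n r (Nat.pos_of_ne_zero h) hr
              rw [this]) (Nat.pos_of_ne_zero h)
          simp only [u', γ', mul_assoc, this, mul_add]
          rw [← mul_assoc (expSeries v), ← (Nat.cast_commute n (expSeries v)).eq, mul_assoc]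
      have hG : euler (expSeries γ') = euler (posSeries γ') * expSeries γ' :=
        euler_expSeries fun m n _ _ => hγc m _
      have hc1 : ∀ F : PowerSeries (PowerSeries A), F * expSeries γ' = expSeries γ' * F :=
        fun F => (commute_powerSeries fun i j => by
          rw [coeff_expSeries]; exact (hGc j _).symm : Commute F _).eq
      rw [euler_mul, euler_mul, euler_C, mul_zero, add_zero, hG, euler_expSeries hu']
      rw [mul_assoc (expSeries γ') V, ← mul_assoc V, eq_sub_of_add_eq h1.symm]
      simp only [← mul_assoc, hc1 (euler (posSeries u')), hc1 (euler (posSeries γ'))]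
      noncomm_ring
    · simp [V, PowerSeries.coeff_mul]
  have hmapu : ∀ n, expCoeff u' n = PowerSeries.C (expCoeff u n) := fun n => by
    have hp : ∀ r, posSeries u' ^ r = PowerSeries.map (PowerSeries.C (R := A)) (posSeries u ^ r) := by
      intro r
      rw [map_pow]
      congr 1
      ext m : 1
      rw [PowerSeries.coeff_map, coeff_posSeries, coeff_posSeries]
      split_ifs <;> simp [u']
    rw [expCoeff_def, expCoeff_def, map_sum]
    refine Finset.sum_congr rfl fun r _ => ?_
    rw [hp, PowerSeries.coeff_map]
    ext j
    rw [PowerSeries.coeff_smul, PowerSeries.coeff_C, PowerSeries.coeff_C]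
    split_ifs <;> simp
  have hmapγ : ∀ n, expCoeff γ' n = PowerSeries.monomial n (algebraMap ℂ A (expCoeff γ n)) := by
    intro n
    have hp : ∀ r n, PowerSeries.coeff n (posSeries γ' ^ r) =
        PowerSeries.monomial n (algebraMap ℂ A (PowerSeries.coeff n (posSeries γ ^ r))) := by
      intro r
      induction r with
      | zero =>
        intro n
        rw [pow_zero, pow_zero, PowerSeries.coeff_one, PowerSeries.coeff_one]
        split_ifs with h
        · rw [h, RingHom.map_one, PowerSeries.monomial_zero_eq_C_apply, RingHom.map_one]
        · simp
      | succ r ih =>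
        intro n
        rw [pow_succ', pow_succ', PowerSeries.coeff_mul, PowerSeries.coeff_mul, map_sum, map_sum]
        refine Finset.sum_congr rfl fun x hx => ?_
        rw [ih, coeff_posSeries, coeff_posSeries, map_mul, ← Finset.HasAntidiagonal.mem_antidiagonal.1 hx,
          ← PowerSeries.monomial_mul_monomial]
        split_ifs with h <;> simp [γ']
    rw [expCoeff_def, expCoeff_def, map_sum, map_sum]
    refine Finset.sum_congr rfl fun r _ => ?_
    rw [hp]
    ext j
    rw [PowerSeries.coeff_smul, PowerSeries.coeff_monomial, PowerSeries.coeff_monomial]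
    split_ifs <;> simp [Algebra.smul_def]
  have h2 := congrArg (fun F => PowerSeries.coeff a (PowerSeries.coeff b F)) key
  simp only [V, PowerSeries.coeff_mul_C, coeff_expSeries, hmapu, PowerSeries.coeff_C_mul] at h2
  rw [h2, PowerSeries.coeff_mul, Finset.Nat.sum_antidiagonal_eq_sum_range_succ
    (fun i j => PowerSeries.coeff i (expSeries γ' * PowerSeries.C (expSeries v)) *
      PowerSeries.coeff j (expSeries u')) b, map_sum]
  simp only [PowerSeries.coeff_mul_C, coeff_expSeries, hmapu, hmapγ,
    coeff_monomial_mul]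
  simp only [ite_mul, zero_mul]
  rw [Finset.sum_ite, Finset.sum_const_zero, add_zero]
  refine Finset.sum_congr ?_ fun s _ => by rw [Algebra.smul_def, mul_assoc]
  ext s
  simp only [Finset.mem_filter, Finset.mem_range]
  omega

end Exponential

/-! ### Normal ordering of products of several factors -/

/-- Pairs `m < n` of elements of `Fin k`. -/
abbrev Pairs (k : ℕ) : Type := {x : Fin k × Fin k // x.1 < x.2}

/-- The pairs in `Fin (k + 1)` are the pairs `(0, j + 1)` and the shifted pairs in `Fin k`. -/
def pairsSucc (k : ℕ) : Fin k ⊕ Pairs k ≃ Pairs (k + 1) :=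
  Equiv.ofBijective
    (Sum.elim (fun j => ⟨(0, j.succ), Fin.succ_pos j⟩)
      fun x => ⟨(x.1.1.succ, x.1.2.succ), Fin.succ_lt_succ_iff.2 x.2⟩) (by
    constructor
    · rintro (j | x) (j' | x') h
      · simpa using h
      · exact absurd (congrArg (fun y => y.1.1) h) (Fin.succ_ne_zero _).symm
      · exact absurd (congrArg (fun y => y.1.1) h) (Fin.succ_ne_zero _)
      · have h1 := congrArg (fun y => y.1.1) h
        have h2 := congrArg (fun y => y.1.2) h
        simp only [Sum.elim_inr, Fin.succ_inj] at h1 h2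
        exact congrArg Sum.inr (Subtype.ext (Prod.ext h1 h2))
    · rintro ⟨⟨m, n⟩, h⟩
      obtain ⟨n, rfl⟩ := Fin.exists_succ_eq.2 (Fin.ne_zero_of_lt h)
      induction m using Fin.cases with
      | zero => exact ⟨Sum.inl n, rfl⟩
      | succ m => exact ⟨Sum.inr ⟨(m, n), Fin.succ_lt_succ_iff.1 h⟩, rfl⟩)

theorem pairsSucc_inl {k : ℕ} (j : Fin k) : (pairsSucc k (Sum.inl j)).1 = (0, j.succ) := rfl

theorem pairsSucc_inr {k : ℕ} (x : Pairs k) :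
    (pairsSucc k (Sum.inr x)).1 = (x.1.1.succ, x.1.2.succ) := rfl

@[to_additive]
theorem prod_pairs_succ {M : Type*} [CommMonoid M] {k : ℕ} (f : Pairs (k + 1) → M) :
    ∏ x, f x = (∏ j, f (pairsSucc k (Sum.inl j))) * ∏ x, f (pairsSucc k (Sum.inr x)) := by
  rw [← Fintype.prod_sum_type fun y => f (pairsSucc k y)]
  exact (Fintype.prod_equiv (pairsSucc k) _ _ fun _ => rfl).symm

/-- The exponent of `z_j` in `∏_{m < n} z_n ^ {e (m, n)}`. -/
def inflow {k : ℕ} (e : Pairs k → ℕ) (j : Fin k) : ℤ :=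
  ∑ x, if x.1.2 = j then (e x : ℤ) else 0

/-- The exponent of `z_j` in `∏_{m < n} z_m ^ {e (m, n)}`. -/
def outflow {k : ℕ} (e : Pairs k → ℕ) (j : Fin k) : ℤ :=
  ∑ x, if x.1.1 = j then (e x : ℤ) else 0

theorem inflow_zero {k : ℕ} (e : Pairs (k + 1) → ℕ) : inflow e 0 = 0 := by
  rw [inflow, sum_pairs_succ]
  simp [pairsSucc_inl, pairsSucc_inr]

theorem inflow_succ {k : ℕ} (e : Pairs (k + 1) → ℕ) (j : Fin k) :
    inflow e j.succ = e (pairsSucc k (Sum.inl j)) +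
      inflow (fun x => e (pairsSucc k (Sum.inr x))) j := by
  rw [inflow, sum_pairs_succ, inflow]
  simp [pairsSucc_inl, pairsSucc_inr]

theorem outflow_zero {k : ℕ} (e : Pairs (k + 1) → ℕ) :
    outflow e 0 = ∑ j, (e (pairsSucc k (Sum.inl j)) : ℤ) := by
  rw [outflow, sum_pairs_succ]
  simp [pairsSucc_inl, pairsSucc_inr]

theorem outflow_succ {k : ℕ} (e : Pairs (k + 1) → ℕ) (j : Fin k) :
    outflow e j.succ = outflow (fun x => e (pairsSucc k (Sum.inr x))) j := by
  rw [outflow, sum_pairs_succ, outflow]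
  simp [pairsSucc_inl, pairsSucc_inr, (Fin.succ_ne_zero _).symm]

section NormalOrder

variable {R : Type*} [Ring R] [Algebra ℂ R]

theorem mul_prod_ofFn {B k : ℕ} (A : ℤ → R) (C : Fin k → ℤ → R) (g : Fin k → ℕ → ℂ)
    (h : ∀ j (a b : ℤ), a < B → A b * C j a =
      ∑ s : Fin B, g j s • (C j (a - (s : ℕ)) * A (b - (s : ℕ))))
    (a : Fin k → ℤ) (b : ℤ) (ha : ∀ j, a j < B) :
    A b * (List.ofFn fun j => C j (a j)).prod =
      ∑ s : Fin k → Fin B, (∏ j, g j (s j)) •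
        ((List.ofFn fun j => C j (a j - ((s j : ℕ) : ℤ))).prod * A (b - ∑ j, ((s j : ℕ) : ℤ))) := by
  induction k generalizing b with
  | zero => simp
  | succ k ih =>
    rw [List.ofFn_succ, List.prod_cons, ← mul_assoc, h 0 _ _ (ha 0), Finset.sum_mul,
      ← (Fin.consEquiv fun _ => Fin B).sum_comp, Fintype.sum_prod_type]
    refine Finset.sum_congr rfl fun s _ => ?_
    rw [smul_mul_assoc, mul_assoc, ih (fun j => C j.succ) (fun j => g j.succ)
      (fun j => h j.succ) (fun j => a j.succ) _ (fun j => ha j.succ), Finset.mul_sum,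
      Finset.smul_sum]
    refine Finset.sum_congr rfl fun s' _ => ?_
    rw [mul_smul_comm, smul_smul, Fin.prod_univ_succ, Fin.sum_univ_succ, List.ofFn_succ,
      List.prod_cons]
    simp [Fin.consEquiv, mul_assoc, sub_sub]

/-- Moving all factors `A j` to the right of all factors `C j`, when exchanging two of them
produces a convolution with scalar coefficients. -/
theorem prod_ofFn_normalOrder {B k : ℕ} (C A : Fin k → ℤ → R) (g : Fin k → Fin k → ℕ → ℂ)
    (h : ∀ i j, i < j → ∀ a b : ℤ, a < B → A i b * C j a =
      ∑ s : Fin B, g i j s • (C j (a - (s : ℕ)) * A i (b - (s : ℕ))))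
    (a b : Fin k → ℤ) (ha : ∀ j, a j < B) :
    (List.ofFn fun j => C j (a j) * A j (b j)).prod =
      ∑ e : Pairs k → Fin B, (∏ x, g x.1.1 x.1.2 (e x)) •
        ((List.ofFn fun j => C j (a j - inflow (fun x => (e x : ℕ)) j)).prod *
          (List.ofFn fun j => A j (b j - outflow (fun x => (e x : ℕ)) j)).prod) := by
  induction k with
  | zero => simp
  | succ k ih =>
    rw [List.ofFn_succ, List.prod_cons,
      ih (fun j => C j.succ) (fun j => A j.succ) (fun i j => g i.succ j.succ)
        (fun i j hij => h i.succ j.succ (Fin.succ_lt_succ_iff.2 hij))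
        (fun j => a j.succ) (fun j => b j.succ) (fun j => ha j.succ),
      ← ((Equiv.arrowCongr (pairsSucc k) (Equiv.refl (Fin B))).sum_comp),
      ← (Equiv.sumArrowEquivProdArrow _ _ _).symm.sum_comp, Fintype.sum_prod_type_right,
      Finset.mul_sum]
    refine Finset.sum_congr rfl fun e _ => ?_
    have hn : ∀ j : Fin k, a j.succ - inflow (fun x => (e x : ℕ)) j < B := fun j => by
      have h0 : 0 ≤ inflow (fun x => (e x : ℕ)) j :=
        Finset.sum_nonneg fun x _ => by split_ifs <;> positivity
      have := ha j.succ
      omega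
    rw [mul_smul_comm, mul_assoc, ← mul_assoc (A 0 _),
      mul_prod_ofFn (A 0) (fun j => C j.succ) (fun j => g 0 j.succ)
        (fun j => h 0 j.succ (Fin.succ_pos j)) _ _ hn, Finset.sum_mul, Finset.mul_sum,
      Finset.smul_sum]
    refine Finset.sum_congr rfl fun s _ => ?_
    rw [smul_mul_assoc, mul_smul_comm, smul_smul, prod_pairs_succ, List.ofFn_succ, List.prod_cons,
      List.ofFn_succ, List.prod_cons]
    simp only [inflow_zero, inflow_succ, outflow_zero, outflow_succ]
    simp only [Equiv.arrowCongr_apply, Equiv.coe_refl, Function.comp_apply, id_eq,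
      Equiv.symm_apply_apply, Equiv.sumArrowEquivProdArrow_symm_apply_inl,
      Equiv.sumArrowEquivProdArrow_symm_apply_inr, sub_zero]
    rw [mul_comm]
    congr 1
    simp only [mul_assoc, sub_sub, add_comm]

end NormalOrder

/-! ### Creation and annihilation parts -/

variable {N : ℕ} {q t : ℂ}

theorem commute_gen_of_add_ne_zero (i j : Fin (N - 1)) {m n : ℤ} (h : m + n ≠ 0) :
    Commute (gen N q t (.a i m)) (gen N q t (.a j n)) := by
  have := gen_comm (q := q) (t := t) i j m n
  rwa [bracket, if_neg h, map_zero, add_zero] at this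

namespace VertexOp

/-- `∑_j osc m j * a_j[m]`. -/
def oscMode (q t : ℂ) (U : VertexOp N) (m : ℤ) : Heis N q t :=
  ∑ j, U.osc m j • gen N q t (.a j m)

theorem commute_oscMode (U V : VertexOp N) {m n : ℤ} (h : m + n ≠ 0) :
    Commute (U.oscMode q t m) (V.oscMode q t n) :=
  Commute.sum_left _ _ _ fun i _ => Commute.sum_right _ _ _ fun j _ =>
    ((commute_gen_of_add_ne_zero i j h).smul_left _).smul_right _

/-- The scalar commutator of the degree `m` part of `U` and the degree `-m` part of `V`. -/
def contraction (q t : ℂ) (U V : VertexOp N) (m : ℕ) : ℂ :=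
  ∑ i, ∑ j, U.osc m i * V.osc (-m) j * bracket N q t i j m (-m)

theorem oscMode_mul_oscMode (U V : VertexOp N) {m n : ℕ} :
    U.oscMode q t m * V.oscMode q t (-n) = V.oscMode q t (-n) * U.oscMode q t m +
      algebraMap ℂ _ (if n = m then contraction q t U V m else 0) := by
  split_ifs with h
  · subst h
    simp only [oscMode, contraction, Finset.sum_mul_sum, map_sum]
    rw [Finset.sum_comm (s := Finset.univ) (t := Finset.univ) (f := fun i j =>
      V.osc (-(n : ℤ)) i • gen N q t (.a i (-n)) * U.osc n j • gen N q t (.a j n)),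
      ← Finset.sum_add_distrib]
    refine Finset.sum_congr rfl fun i _ => ?_
    rw [← Finset.sum_add_distrib]
    refine Finset.sum_congr rfl fun j _ => ?_
    rw [smul_mul_smul_comm, smul_mul_smul_comm, gen_comm, smul_add, mul_comm (U.osc n i),
      Algebra.smul_def _ (algebraMap ℂ _ _), ← map_mul]
  · rw [map_zero, add_zero]
    exact commute_oscMode U V (by omega)

/-- The coefficients of the creation part, indexed by the integers. -/
def creationZ (q t : ℂ) (U : VertexOp N) (a : ℤ) : Heis N q t :=
  if 0 ≤ a then U.creation q t a.toNat else 0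

/-- The coefficients of the annihilation part, indexed by the integers. -/
def annihilationZ (q t : ℂ) (U : VertexOp N) (b : ℤ) : Heis N q t :=
  if 0 ≤ b then U.annihilation q t b.toNat else 0

theorem creationZ_of_neg (U : VertexOp N) {a : ℤ} (h : a < 0) : U.creationZ q t a = 0 :=
  if_neg (not_le.2 h)

theorem annihilationZ_of_neg (U : VertexOp N) {a : ℤ} (h : a < 0) : U.annihilationZ q t a = 0 :=
  if_neg (not_le.2 h)

@[simp]
theorem creationZ_natCast (U : VertexOp N) (a : ℕ) : U.creationZ q t a = U.creation q t a := by
  simp [creationZ]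

@[simp]
theorem annihilationZ_natCast (U : VertexOp N) (a : ℕ) :
    U.annihilationZ q t a = U.annihilation q t a := by
  simp [annihilationZ]

theorem creation_eq (U : VertexOp N) (a : ℕ) :
    U.creation q t a = expCoeff (fun m => U.oscMode q t (-(m : ℤ))) a := rfl

theorem annihilation_eq (U : VertexOp N) (a : ℕ) :
    U.annihilation q t a = expCoeff (fun m => U.oscMode q t m) a := rfl

theorem annihilationZ_mul_creationZ (U V : VertexOp N) {B : ℕ} {a : ℤ} (b : ℤ) (ha : a < B) :
    U.annihilationZ q t b * V.creationZ q t a =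
      ∑ s : Fin B, expCoeff (contraction q t U V) s •
        (V.creationZ q t (a - (s : ℕ)) * U.annihilationZ q t (b - (s : ℕ))) := by
  rcases lt_or_ge a 0 with h | h
  · rw [V.creationZ_of_neg h, mul_zero, Finset.sum_eq_zero]
    intro s _
    rw [V.creationZ_of_neg (by omega), zero_mul, smul_zero]
  rcases lt_or_ge b 0 with h' | h'
  · rw [U.annihilationZ_of_neg h', zero_mul, Finset.sum_eq_zero]
    intro s _
    rw [U.annihilationZ_of_neg (by omega), mul_zero, smul_zero]
  lift a to ℕ using h
  lift b to ℕ using h'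
  rw [annihilationZ_natCast, creationZ_natCast, annihilation_eq, creation_eq,
    expCoeff_mul_expCoeff (γ := contraction q t U V)
      (fun m n _ _ => commute_oscMode U U (by omega))
      (fun m n _ _ => commute_oscMode V V (by omega))
      (fun m n _ _ => oscMode_mul_oscMode U V),
    Fin.sum_univ_eq_sum_range (fun s => expCoeff (contraction q t U V) s •
      (V.creationZ q t (a - (s : ℕ)) * U.annihilationZ q t (b - (s : ℕ)))) B]
  have hB : Finset.range (min a b + 1) ⊆ Finset.range B := Finset.range_mono (by omega)
  rw [← Finset.sum_subset hB]
  · refine Finset.sum_congr rfl fun s hs => ?_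
    rw [Finset.mem_range] at hs
    rw [← Nat.cast_sub (by omega), ← Nat.cast_sub (by omega), annihilationZ_natCast,
      creationZ_natCast, annihilation_eq, creation_eq]
  · intro s _ hs
    rw [Finset.mem_range] at hs
    rcases lt_or_ge a s with h | h
    · rw [V.creationZ_of_neg (by omega), zero_mul, smul_zero]
    · rw [U.annihilationZ_of_neg (by omega), mul_zero, smul_zero]

theorem oscMode_mul (U V : VertexOp N) (m : ℤ) :
    (U * V).oscMode q t m = U.oscMode q t m + V.oscMode q t m := by
  rw [oscMode, oscMode, oscMode, ← Finset.sum_add_distrib]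
  exact Finset.sum_congr rfl fun j _ => add_smul _ _ _

theorem convolution_extend {f g h : ℕ → Heis N q t} {f' g' h' : ℤ → Heis N q t}
    (hf : ∀ a : ℕ, f' a = f a) (hg : ∀ a : ℕ, g' a = g a) (hg0 : ∀ a, a < 0 → g' a = 0)
    (hh : ∀ a : ℕ, h' a = h a) (hh0 : ∀ a, a < 0 → h' a = 0)
    (H : PowerSeries.mk h = PowerSeries.mk f * PowerSeries.mk g) {a : ℤ} {B : ℕ} (ha : a < B) :
    h' a = ∑ s : Fin B, f' ((s : ℕ) : ℤ) * g' (a - (s : ℕ)) := by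
  rcases lt_or_ge a 0 with h | h
  · rw [hh0 a h, Finset.sum_eq_zero]
    intro s _
    rw [hg0 _ (by omega), mul_zero]
  lift a to ℕ using h
  have H' := congrArg (PowerSeries.coeff a) H
  rw [PowerSeries.coeff_mk, PowerSeries.coeff_mul,
    Finset.Nat.sum_antidiagonal_eq_sum_range_succ_mk] at H'
  rw [hh, H', Fin.sum_univ_eq_sum_range (fun s => f' (s : ℤ) * g' (a - (s : ℕ))) B]
  have hB : Finset.range (a + 1) ⊆ Finset.range B := Finset.range_mono (by omega)
  rw [← Finset.sum_subset hB]
  · refine Finset.sum_congr rfl fun s hs => ?_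
    rw [Finset.mem_range] at hs
    simp only [PowerSeries.coeff_mk]
    rw [hf, ← Nat.cast_sub (by omega), hg]
  · intro s _ hs
    rw [Finset.mem_range] at hs
    rw [hg0 _ (by omega), mul_zero]

theorem creationZ_mul (U V : VertexOp N) {a : ℤ} {B : ℕ} (ha : a < B) :
    (U * V).creationZ q t a =
      ∑ s : Fin B, U.creationZ q t ((s : ℕ) : ℤ) * V.creationZ q t (a - (s : ℕ)) := by
  refine convolution_extend U.creationZ_natCast V.creationZ_natCast
    (fun _ h => V.creationZ_of_neg h) (U * V).creationZ_natCast
    (fun _ h => (U * V).creationZ_of_neg h) ?_ ha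
  have := expSeries_add (u := fun m : ℕ => U.oscMode q t (-(m : ℤ)))
    (v := fun m : ℕ => V.oscMode q t (-(m : ℤ)))
    (fun m n _ _ => commute_oscMode U U (by omega))
    (fun m n _ _ => commute_oscMode V V (by omega))
    (fun m n _ _ => commute_oscMode U V (by omega))
  rw [show _ + _ = fun m : ℕ => (U * V).oscMode q t (-(m : ℤ)) from
    (funext fun m => oscMode_mul U V _).symm] at this
  exact this

theorem annihilationZ_mul (U V : VertexOp N) {a : ℤ} {B : ℕ} (ha : a < B) :
    (U * V).annihilationZ q t a =
      ∑ s : Fin B, U.annihilationZ q t ((s : ℕ) : ℤ) * V.annihilationZ q t (a - (s : ℕ)) := by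
  refine convolution_extend U.annihilationZ_natCast V.annihilationZ_natCast
    (fun _ h => V.annihilationZ_of_neg h) (U * V).annihilationZ_natCast
    (fun _ h => (U * V).annihilationZ_of_neg h) ?_ ha
  have := expSeries_add (u := fun m : ℕ => U.oscMode q t (m : ℤ))
    (v := fun m : ℕ => V.oscMode q t (m : ℤ))
    (fun m n _ _ => commute_oscMode U U (by omega))
    (fun m n _ _ => commute_oscMode V V (by omega))
    (fun m n _ _ => commute_oscMode U V (by omega))
  rw [show _ + _ = fun m : ℕ => (U * V).oscMode q t (m : ℤ) from
    (funext fun m => oscMode_mul U V _).symm] at this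
  exact this

end VertexOp

/-! ### Normally ordered products of several vertex operators -/

theorem prod_ofFn_mul {M : Type*} [Monoid M] {k : ℕ} (f g : Fin k → M)
    (h : ∀ i j, Commute (f i) (g j)) :
    (List.ofFn fun j => f j * g j).prod = (List.ofFn f).prod * (List.ofFn g).prod := by
  induction k with
  | zero => simp
  | succ k ih =>
    have hc : Commute (g 0) (List.ofFn fun j : Fin k => f j.succ).prod := by
      refine Commute.list_prod_right _ _ fun x hx => ?_
      obtain ⟨j, rfl⟩ := (List.mem_ofFn' _ _).1 hx
      exact (h _ _).symm
    simp only [List.ofFn_succ, List.prod_cons]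
    rw [ih _ _ fun i j => h i.succ j.succ, mul_assoc, ← mul_assoc (g 0), hc.eq]
    simp only [mul_assoc]

theorem prod_ofFn_smul {A : Type*} [Ring A] [Algebra ℂ A] {k : ℕ} (c : Fin k → ℂ) (f : Fin k → A) :
    (List.ofFn fun j => c j • f j).prod = (∏ j, c j) • (List.ofFn f).prod := by
  induction k with
  | zero => simp
  | succ k ih =>
    simp only [List.ofFn_succ, List.prod_cons, Fin.prod_univ_succ]
    rw [ih, smul_mul_smul_comm]

theorem zeroUnit_zpow_commute (j : Fin (N - 1)) (n : ℤ) (x : Heis N q t) :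
    Commute ((zeroUnit N q t j ^ n : (Heis N q t)ˣ) : Heis N q t) x := by
  have h : Commute ((zeroUnit N q t j : (Heis N q t)ˣ) : Heis N q t) x :=
    heis_induction (P := fun y => Commute (gen N q t (.K j)) y) (fun x => gen_K_comm j x)
      (fun c => (Algebra.commutes c _).symm) (fun _ _ h h' => h.add_right h')
      (fun _ _ h h' => h.mul_right h') x
  exact h.units_zpow_left n

theorem expCoeff_zero_fun {A : Type*} [Ring A] [Algebra ℂ A] {u : ℕ → A}
    (h : ∀ m, 0 < m → u m = 0) (b : ℕ) : expCoeff u b = if b = 0 then 1 else 0 := by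
  have h0 : posSeries u = 0 := by
    ext m
    rw [coeff_posSeries]
    split_ifs with h'
    · simp
    · rw [h m (Nat.pos_of_ne_zero h')]; simp
  rw [expCoeff_def, h0, Finset.sum_range_succ']
  simp [PowerSeries.coeff_one]

theorem expCoeff_pow_smul {A : Type*} [Ring A] [Algebra ℂ A] (u : ℕ → A) (c : ℂ) (b : ℕ) :
    expCoeff (fun m => c ^ m • u m) b = c ^ b • expCoeff u b := by
  have h : ∀ r b, PowerSeries.coeff b (posSeries (fun m => c ^ m • u m) ^ r) =
      c ^ b • PowerSeries.coeff b (posSeries u ^ r) := by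
    intro r
    induction r with
    | zero =>
      intro b
      rw [pow_zero, pow_zero, PowerSeries.coeff_one]
      split_ifs with h <;> simp [h]
    | succ r ih =>
      intro b
      rw [pow_succ', pow_succ', PowerSeries.coeff_mul, PowerSeries.coeff_mul, Finset.smul_sum]
      refine Finset.sum_congr rfl fun x hx => ?_
      rw [ih, coeff_posSeries, coeff_posSeries,
        ← Finset.HasAntidiagonal.mem_antidiagonal.1 hx, pow_add]
      split_ifs
      · simp
      · rw [smul_mul_smul_comm]
  rw [expCoeff_def, expCoeff_def, Finset.smul_sum]
  refine Finset.sum_congr rfl fun r _ => ?_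
  rw [h, smul_comm]

namespace VertexOp

theorem zeroPart_commute (U : VertexOp N) (x : Heis N q t) : Commute (U.zeroPart q t) x := by
  refine Commute.smul_left (Commute.list_prod_left _ _ fun y hy => ?_) _
  obtain ⟨j, rfl⟩ := (List.mem_ofFn' _ _).1 hy
  exact zeroUnit_zpow_commute j _ x

theorem zeroPart_mul (U V : VertexOp N) :
    (U * V).zeroPart q t = U.zeroPart q t * V.zeroPart q t := by
  rw [zeroPart, zeroPart, zeroPart, smul_mul_smul_comm,
    ← prod_ofFn_mul _ _ fun i j => zeroUnit_zpow_commute i _ _]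
  congr 3
  funext j
  rw [← Units.val_mul, ← zpow_add]
  rfl

theorem zeroPart_one : (1 : VertexOp N).zeroPart q t = 1 := by
  have h : (fun j => ((zeroUnit N q t j ^ (1 : VertexOp N).zero j : (Heis N q t)ˣ) : Heis N q t)) =
      fun _ => 1 := by
    funext j
    change ((zeroUnit N q t j ^ (0 : ℤ) : (Heis N q t)ˣ) : Heis N q t) = 1
    rw [zpow_zero, Units.val_one]
  rw [zeroPart, h]
  change (1 : ℂ) • _ = _
  simp

theorem zeroPart_prod {k : ℕ} (U : Fin k → VertexOp N) :
    (∏ j, U j).zeroPart q t = (List.ofFn fun j => (U j).zeroPart q t).prod := by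
  induction k with
  | zero => simp [zeroPart_one]
  | succ k ih => rw [Fin.prod_univ_succ, zeroPart_mul, ih, List.ofFn_succ, List.prod_cons]

theorem oscMode_one (m : ℤ) : (1 : VertexOp N).oscMode q t m = 0 :=
  Finset.sum_eq_zero fun _ _ => zero_smul ℂ _

theorem creationZ_one (a : ℤ) : (1 : VertexOp N).creationZ q t a = if a = 0 then 1 else 0 := by
  rcases lt_or_ge a 0 with h | h
  · rw [creationZ_of_neg _ h, if_neg h.ne]
  lift a to ℕ using h
  rw [creationZ_natCast, creation_eq, expCoeff_zero_fun fun m _ => oscMode_one _]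
  simp

theorem annihilationZ_one (a : ℤ) :
    (1 : VertexOp N).annihilationZ q t a = if a = 0 then 1 else 0 := by
  rcases lt_or_ge a 0 with h | h
  · rw [annihilationZ_of_neg _ h, if_neg h.ne]
  lift a to ℕ using h
  rw [annihilationZ_natCast, annihilation_eq, expCoeff_zero_fun fun m _ => oscMode_one _]
  simp

/-- The coefficients of the product of the creation parts. -/
def creationProd (q t : ℂ) {k : ℕ} (U : Fin k → VertexOp N) (a : Fin k → ℤ) : Heis N q t :=
  (List.ofFn fun j => (U j).creationZ q t (a j)).prod

/-- The coefficients of the product of the annihilation parts. -/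
def annihilationProd (q t : ℂ) {k : ℕ} (U : Fin k → VertexOp N) (b : Fin k → ℤ) : Heis N q t :=
  (List.ofFn fun j => (U j).annihilationZ q t (b j)).prod

theorem prod_coeff_eq_sum {c : VertexOp N → ℤ → Heis N q t}
    (h1 : ∀ a, c 1 a = if a = 0 then 1 else 0)
    (hmul : ∀ (U V : VertexOp N) {a : ℤ} {B : ℕ}, a < B →
      c (U * V) a = ∑ s : Fin B, c U ((s : ℕ) : ℤ) * c V (a - (s : ℕ)))
    {k : ℕ} (U : Fin k → VertexOp N) {A : ℤ} {B : ℕ} (hA : A < B) :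
    c (∏ j, U j) A = ∑ a : Fin k → Fin B,
      if ∑ j, ((a j : ℕ) : ℤ) = A then (List.ofFn fun j => c (U j) ((a j : ℕ) : ℤ)).prod
      else 0 := by
  induction k generalizing A with
  | zero => simp [h1, eq_comm]
  | succ k ih =>
    rw [Fin.prod_univ_succ, hmul _ _ hA, ← (Fin.consEquiv fun _ => Fin B).sum_comp,
      Fintype.sum_prod_type]
    refine Finset.sum_congr rfl fun s _ => ?_
    rw [ih _ (by omega), Finset.mul_sum]
    refine Finset.sum_congr rfl fun a _ => ?_
    rw [Fin.sum_univ_succ, List.ofFn_succ, List.prod_cons, mul_ite, mul_zero]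
    simp only [Fin.consEquiv_apply, Fin.cons_zero, Fin.cons_succ]
    congr 1
    rw [eq_sub_iff_add_eq, add_comm]

theorem creationProd_eq_zero {k : ℕ} (U : Fin k → VertexOp N) {a : Fin k → ℤ} {j : Fin k}
    (h : a j < 0) : creationProd q t U a = 0 :=
  List.prod_eq_zero ((List.mem_ofFn' _ _).2 ⟨j, creationZ_of_neg _ h⟩)

theorem annihilationProd_eq_zero {k : ℕ} (U : Fin k → VertexOp N) {a : Fin k → ℤ} {j : Fin k}
    (h : a j < 0) : annihilationProd q t U a = 0 :=
  List.prod_eq_zero ((List.mem_ofFn' _ _).2 ⟨j, annihilationZ_of_neg _ h⟩)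

/-- The contribution to the coefficient of `z_1^{-n_1} ⋯ z_k^{-n_k}` in
`:U_1(z_1) ⋯ U_k(z_k):` of the terms whose creation part has degrees `a_1, …, a_k`. -/
def normalTerm (q t : ℂ) {k : ℕ} (U : Fin k → VertexOp N) (n a : Fin k → ℤ) : Heis N q t :=
  (∏ j, U j).zeroPart q t * creationProd q t U a * annihilationProd q t U (a + n)

theorem zeroPart_shift (U : VertexOp N) (c : ℂ) : (U.shift c).zeroPart q t = U.zeroPart q t := rfl

theorem oscMode_shift (U : VertexOp N) (c : ℂ) (m : ℤ) :
    (U.shift c).oscMode q t m = c ^ (-m) • U.oscMode q t m := by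
  rw [oscMode, oscMode, Finset.smul_sum]
  exact Finset.sum_congr rfl fun j _ => mul_smul _ _ _

theorem creationZ_shift (U : VertexOp N) (c : ℂ) (a : ℤ) :
    (U.shift c).creationZ q t a = c ^ a • U.creationZ q t a := by
  rcases lt_or_ge a 0 with h | h
  · rw [creationZ_of_neg _ h, creationZ_of_neg _ h, smul_zero]
  lift a to ℕ using h
  rw [creationZ_natCast, creationZ_natCast, creation_eq, creation_eq, zpow_natCast,
    ← expCoeff_pow_smul]
  congr 1
  funext m
  rw [oscMode_shift, neg_neg, zpow_natCast]

theorem annihilationZ_shift (U : VertexOp N) (c : ℂ) (a : ℤ) :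
    (U.shift c).annihilationZ q t a = c ^ (-a) • U.annihilationZ q t a := by
  rcases lt_or_ge a 0 with h | h
  · rw [annihilationZ_of_neg _ h, annihilationZ_of_neg _ h, smul_zero]
  lift a to ℕ using h
  rw [annihilationZ_natCast, annihilationZ_natCast, annihilation_eq, annihilation_eq,
    zpow_neg, zpow_natCast, ← inv_pow, ← expCoeff_pow_smul]
  congr 1
  funext m
  rw [oscMode_shift, zpow_neg, zpow_natCast, inv_pow]

theorem normalTerm_shift {k : ℕ} (U : Fin k → VertexOp N) {z : Fin k → ℂ} (hz : ∀ j, z j ≠ 0)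
    (n a : Fin k → ℤ) :
    normalTerm q t (fun j => (U j).shift (z j)) n a =
      (∏ j, z j ^ (-n j)) • normalTerm q t U n a := by
  rw [normalTerm, normalTerm, zeroPart_prod, zeroPart_prod]
  simp only [zeroPart_shift, creationProd, annihilationProd, creationZ_shift, annihilationZ_shift]
  rw [prod_ofFn_smul, prod_ofFn_smul, mul_smul_comm _ (List.prod _) (List.prod _),
    smul_mul_smul_comm, ← Finset.prod_mul_distrib]
  congr 1
  refine Finset.prod_congr rfl fun j _ => ?_
  rw [← zpow_add₀ (hz j), Pi.add_apply]
  congr 1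
  ring

/-! ### Degrees of annihilation parts -/

theorem posMonos_mul {a b : ℕ} {x y : Heis N q t}
    (hx : x ∈ Submodule.span ℂ (posMonos N q t a)) (hy : y ∈ Submodule.span ℂ (posMonos N q t b)) :
    x * y ∈ Submodule.span ℂ (posMonos N q t (a + b)) := by
  have h := Submodule.mul_mem_mul hx hy
  rw [Submodule.span_mul_span] at h
  refine Submodule.span_mono ?_ h
  rintro _ ⟨_, ⟨L, hL, hLa, rfl⟩, _, ⟨M, hM, hMb, rfl⟩, rfl⟩
  refine ⟨L ++ M, fun y hy => ?_, ?_, ?_⟩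
  · rcases List.mem_append.1 hy with h | h
    · exact hL y h
    · exact hM y h
  · rw [List.map_append, List.sum_append]; omega
  · simp [mono]

theorem one_mem_span_posMonos : (1 : Heis N q t) ∈ Submodule.span ℂ (posMonos N q t 0) :=
  Submodule.subset_span ⟨[], by simp, by simp, by simp [mono]⟩

theorem annihilation_mem (U : VertexOp N) (b : ℕ) :
    U.annihilation q t b ∈ Submodule.span ℂ (posMonos N q t b) := by
  rw [annihilation_eq, expCoeff_def]
  refine Submodule.sum_mem _ fun r hr => Submodule.smul_mem _ _ ?_
  clear hr
  induction r generalizing b with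
  | zero =>
    rw [pow_zero, PowerSeries.coeff_one]
    split_ifs with h
    · rw [h]; exact one_mem_span_posMonos
    · exact Submodule.zero_mem _
  | succ r ih =>
    rw [pow_succ', PowerSeries.coeff_mul]
    refine Submodule.sum_mem _ fun x hx => ?_
    rw [← Finset.HasAntidiagonal.mem_antidiagonal.1 hx]
    refine posMonos_mul ?_ (ih _)
    rw [coeff_posSeries]
    split_ifs with h
    · exact Submodule.zero_mem _
    · refine Submodule.sum_mem _ fun j _ => Submodule.smul_mem _ _ (Submodule.subset_span ?_)
      exact ⟨[(j, x.1)], by simpa using Nat.pos_of_ne_zero h, by simp, by simp [mono]⟩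

theorem annihilationProd_mem {k : ℕ} (U : Fin k → VertexOp N) (b : Fin k → ℤ) :
    annihilationProd q t U b ∈ Submodule.span ℂ (posMonos N q t (∑ j, b j).toNat) := by
  by_cases hb : ∀ j, 0 ≤ b j
  · lift b to Fin k → ℕ using hb
    rw [← Nat.cast_sum, Int.toNat_natCast]
    simp only [annihilationProd, annihilationZ_natCast]
    induction k with
    | zero => simpa using one_mem_span_posMonos
    | succ k ih =>
      rw [List.ofFn_succ, List.prod_cons, Fin.sum_univ_succ]
      exact posMonos_mul (annihilation_mem _ _) (ih _ _)
  · push Not at hb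
    obtain ⟨j, hj⟩ := hb
    rw [annihilationProd_eq_zero U hj]
    exact Submodule.zero_mem _

theorem normalTerm_mem {k : ℕ} (U : Fin k → VertexOp N) (n a : Fin k → ℤ) {M : ℕ}
    (h : (∀ j, 0 ≤ a j) → (∀ j, 0 ≤ a j + n j) → (M : ℤ) ≤ ∑ j, (a j + n j)) :
    normalTerm q t U n a ∈ posIdeal N q t M := by
  rw [normalTerm]
  by_cases h1 : ∀ j, 0 ≤ a j
  · by_cases h2 : ∀ j, 0 ≤ a j + n j
    · refine Ideal.mul_mem_left _ _ (posIdeal_anti ?_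
        (span_le_posIdeal _ (annihilationProd_mem U (a + n))))
      have := h h1 h2
      simp only [Pi.add_apply]
      omega
    · push Not at h2
      obtain ⟨j, hj⟩ := h2
      rw [annihilationProd_eq_zero U (j := j) (by simpa using hj), mul_zero]
      exact Ideal.zero_mem _
  · push Not at h1
    obtain ⟨j, hj⟩ := h1
    rw [creationProd_eq_zero U hj, mul_zero, zero_mul]
    exact Ideal.zero_mem _

end VertexOp

/-! ### Summability in the completion -/

instance (N : ℕ) (q t : ℂ) : NonarchimedeanRing (Heis N q t) :=
  (posIdeal_basis N q t).nonarchimedean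

theorem hasBasis_nhds_zero_heis (N : ℕ) (q t : ℂ) :
    (𝓝 (0 : Heis N q t)).HasBasis (fun _ => True) fun n => (posIdeal N q t n : Set (Heis N q t)) :=
  (posIdeal_basis N q t).hasBasis_nhds_zero

theorem coe_zero_heis : ((0 : Heis N q t) : CHeis N q t) = 0 := Completion.coe_zero

theorem hasSum_coe {ι : Type*} {f : ι → Heis N q t} {x : Heis N q t} (h : HasSum f x) :
    HasSum (fun i => (f i : CHeis N q t)) (x : CHeis N q t) :=
  h.map (Completion.toCompl : Heis N q t →+ CHeis N q t) Completion.continuous_toCompl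

theorem summable_coe {ι : Type*} {f : ι → Heis N q t}
    (h : ∀ M, {i | f i ∉ posIdeal N q t M}.Finite) : Summable fun i => (f i : CHeis N q t) := by
  refine NonarchimedeanAddGroup.summable_of_tendsto_cofinite_zero ?_
  have h1 : Tendsto f cofinite (𝓝 0) :=
    (hasBasis_nhds_zero_heis N q t).tendsto_right_iff.2 fun M _ => h M
  have h2 := (Completion.continuous_coe (Heis N q t)).tendsto 0
  rw [Completion.coe_zero] at h2
  exact h2.comp h1

theorem hasSum_of_injective {ι κ M : Type*} [Fintype ι] [AddCommMonoid M] [TopologicalSpace M]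
    {φ : ι → κ} (hφ : Function.Injective φ) {f : κ → M} (h : ∀ x, x ∉ Set.range φ → f x = 0) :
    HasSum f (∑ i, f (φ i)) :=
  (hφ.hasSum_iff h).1 (hasSum_fintype _)

theorem hasSum_prod_ofFn {R ι : Type*} [Ring R] [UniformSpace R] [IsUniformAddGroup R]
    [NonarchimedeanRing R] {k : ℕ}
    {f : Fin k → ι → R} {s : Fin k → R} (h : ∀ j, HasSum (f j) (s j)) :
    HasSum (fun a : Fin k → ι => (List.ofFn fun j => f j (a j)).prod) (List.ofFn s).prod := by
  induction k with
  | zero => simp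
  | succ k ih =>
    rw [← (Fin.consEquiv fun _ => ι).hasSum_iff, List.ofFn_succ, List.prod_cons]
    have := (h 0).mul_of_nonarchimedean (ih fun j => h j.succ)
    refine this.congr_fun ?_
    rintro ⟨x, y⟩
    simp [List.ofFn_succ, Fin.consEquiv]

/-- The exponents of `∏_{m < n} (z_n / z_m) ^ {e (m, n)}`. -/
def flow {k : ℕ} (e : Pairs k → ℕ) : Fin k → ℤ := inflow e - outflow e

theorem sum_mul_inflow {k : ℕ} (e : Pairs k → ℕ) (w : Fin k → ℤ) :
    ∑ j, w j * inflow e j = ∑ x, w x.1.2 * e x := by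
  simp only [inflow, Finset.mul_sum]
  rw [Finset.sum_comm]
  refine Finset.sum_congr rfl fun x _ => ?_
  simp

theorem sum_mul_outflow {k : ℕ} (e : Pairs k → ℕ) (w : Fin k → ℤ) :
    ∑ j, w j * outflow e j = ∑ x, w x.1.1 * e x := by
  simp only [outflow, Finset.mul_sum]
  rw [Finset.sum_comm]
  refine Finset.sum_congr rfl fun x _ => ?_
  simp

theorem sum_mul_flow {k : ℕ} (e : Pairs k → ℕ) (w : Fin k → ℤ) :
    ∑ j, w j * flow e j = ∑ x, (w x.1.2 - w x.1.1) * e x := by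
  simp only [flow, Pi.sub_apply, mul_sub, Finset.sum_sub_distrib, sum_mul_inflow, sum_mul_outflow,
    sub_mul]

theorem sum_flow {k : ℕ} (e : Pairs k → ℕ) : ∑ j, flow e j = 0 := by
  have := sum_mul_flow e 1
  simpa using this

theorem flow_add {k : ℕ} (e e' : Pairs k → ℕ) : flow (e + e') = flow e + flow e' := by
  funext j
  simp only [flow, inflow, outflow, Pi.add_apply, Pi.sub_apply, Nat.cast_add]
  have h : ∀ (p : Pairs k → Prop) [DecidablePred p],
      (∑ x, if p x then ((e x : ℤ) + e' x) else 0) =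
        (∑ x, if p x then (e x : ℤ) else 0) + ∑ x, if p x then (e' x : ℤ) else 0 := by
    intro p _
    rw [← Finset.sum_add_distrib]
    exact Finset.sum_congr rfl fun x _ => by split_ifs <;> simp
  rw [h, h]
  ring

theorem finite_flow_lt {k : ℕ} (n : Fin k → ℤ) (M : ℕ) :
    {y : (Pairs k → ℕ) × (Fin k → ℤ) | (∀ j, 0 ≤ y.2 j) ∧ (∀ j, 0 ≤ y.2 j + (n + flow y.1) j) ∧
      ∑ j, (y.2 j + (n + flow y.1) j) < M}.Finite := by
  refine ((Set.finite_Icc (0 : Pairs k → ℕ)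
    fun _ => (k * M - ∑ j : Fin k, (j : ℤ) * n j).toNat).prod
    (Set.finite_Icc (0 : Fin k → ℤ) fun _ => M - ∑ j, n j)).subset ?_
  rintro ⟨e, a⟩ ⟨h1, h2, h3⟩
  dsimp only at h1 h2 h3
  have h4 : ∑ j, a j < M - ∑ j, n j := by
    have : ∑ j, (a j + (n + flow e) j) = ∑ j, a j + ∑ j, n j := by
      simp only [Pi.add_apply, Finset.sum_add_distrib, sum_flow, add_zero]
    omega
  have h5 : ∑ j : Fin k, (j : ℤ) * (a j + (n + flow e) j) ≤ k * M := by
    calc ∑ j : Fin k, (j : ℤ) * (a j + (n + flow e) j)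
        ≤ ∑ j : Fin k, (k : ℤ) * (a j + (n + flow e) j) :=
          Finset.sum_le_sum fun j _ => mul_le_mul_of_nonneg_right (by exact_mod_cast j.2.le) (h2 j)
      _ = k * ∑ j : Fin k, (a j + (n + flow e) j) := by rw [Finset.mul_sum]
      _ ≤ k * M := mul_le_mul_of_nonneg_left h3.le (by positivity)
  have h6 : ∑ j : Fin k, (j : ℤ) * (a j + (n + flow e) j) = ∑ j : Fin k, (j : ℤ) * a j +
      (∑ j : Fin k, (j : ℤ) * n j + ∑ x : Pairs k, ((x.1.2 : ℤ) - (x.1.1 : ℤ)) * e x) := by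
    simp only [Pi.add_apply, mul_add, Finset.sum_add_distrib]
    rw [sum_mul_flow e fun j => (j : ℤ)]
  have h7 : 0 ≤ ∑ j : Fin k, (j : ℤ) * a j :=
    Finset.sum_nonneg fun j _ => mul_nonneg (by positivity) (h1 j)
  refine ⟨⟨fun x => Nat.zero_le _, fun x => ?_⟩, h1, fun j => ?_⟩
  · have hx : ∀ x : Pairs k, (e x : ℤ) ≤ ((x.1.2 : ℤ) - (x.1.1 : ℤ)) * e x := fun x => by
      have h : (x.1.1 : ℕ) < x.1.2 := x.2
      nlinarith [Int.natCast_nonneg (e x)]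
    have : (e x : ℤ) ≤ ∑ x : Pairs k, ((x.1.2 : ℤ) - (x.1.1 : ℤ)) * e x :=
      (hx x).trans (Finset.single_le_sum (f := fun x : Pairs k => ((x.1.2 : ℤ) - (x.1.1 : ℤ)) * e x)
        (fun y _ => (Int.natCast_nonneg (e y)).trans (hx y)) (Finset.mem_univ x))
    dsimp only
    omega
  · have : a j ≤ ∑ j, a j := Finset.single_le_sum (fun i _ => h1 i) (Finset.mem_univ j)
    dsimp only
    omega

theorem finite_degree_lt {k : ℕ} (d : ℤ) (M : ℕ) :
    {y : (Fin k → ℤ) × (Fin k → ℤ) | (∀ j, 0 ≤ y.2 j) ∧ (∀ j, 0 ≤ y.2 j + y.1 j) ∧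
      ∑ j, y.1 j = d ∧ ∑ j, (y.2 j + y.1 j) < M}.Finite := by
  refine ((Set.finite_Icc (fun _ : Fin k => d - M) fun _ => (M : ℤ)).prod
    (Set.finite_Icc (0 : Fin k → ℤ) fun _ => M - d)).subset ?_
  rintro ⟨n, a⟩ ⟨h1, h2, h3, h4⟩
  dsimp only at h1 h2 h3 h4
  have h5 : ∑ j, a j < M - d := by
    rw [Finset.sum_add_distrib] at h4; omega
  have h6 : ∀ j, a j ≤ ∑ j, a j := fun j =>
    Finset.single_le_sum (fun i _ => h1 i) (Finset.mem_univ j)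
  have h7 : ∀ j, a j + n j ≤ ∑ j, (a j + n j) := fun j =>
    Finset.single_le_sum (f := fun j => a j + n j) (fun i _ => h2 i) (Finset.mem_univ j)
  refine ⟨⟨fun j => ?_, fun j => ?_⟩, h1, fun j => ?_⟩ <;>
  · dsimp only
    have := h6 j; have := h7 j; have := h1 j; have := h2 j
    omega

namespace VertexOp

/-- The coefficient of `z_1^{-n_1} ⋯ z_k^{-n_k}` in `:U_1(z_1) ⋯ U_k(z_k):`. -/
def normalMode (q t : ℂ) {k : ℕ} (U : Fin k → VertexOp N) (n : Fin k → ℤ) : CHeis N q t :=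
  ∑' a, (normalTerm q t U n a : CHeis N q t)

theorem finite_normalTerm_notMem {k : ℕ} (U : Fin k → VertexOp N) (n : Fin k → ℤ)
    (c : (Pairs k → ℕ) → ℂ) (M : ℕ) :
    {y : (Pairs k → ℕ) × (Fin k → ℤ) | c y.1 • normalTerm q t U (n + flow y.1) y.2 ∉
      posIdeal N q t M}.Finite := by
  refine (finite_flow_lt n M).subset fun y hy => ?_
  by_contra h
  refine hy ?_
  rw [Algebra.smul_def]
  refine Ideal.mul_mem_left _ _ (normalTerm_mem _ _ _ fun h1 h2 => ?_)
  by_contra h3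
  exact h ⟨h1, h2, not_le.1 h3⟩

theorem hasSum_normalMode {k : ℕ} (U : Fin k → VertexOp N) (n : Fin k → ℤ) :
    HasSum (fun a => (normalTerm q t U n a : CHeis N q t)) (normalMode q t U n) := by
  refine (summable_coe fun M => ?_).hasSum
  refine ((finite_normalTerm_notMem (q := q) (t := t) U n 1 M).preimage
    (f := fun a => ((0 : Pairs k → ℕ), a)) fun a _ b _ h => congrArg Prod.snd h).subset
    fun a ha => ?_
  have : flow (0 : Pairs k → ℕ) = 0 := by
    funext j; simp [flow, inflow, outflow]
  simpa [this] using ha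

theorem hasSum_mode (U : VertexOp N) (n : ℤ) :
    Summable (U.modeTerm q t n) ∧ HasSum (fun a : ℤ =>
      ((U.zeroPart q t * U.creationZ q t a * U.annihilationZ q t (a + n) : Heis N q t) :
        CHeis N q t)) (U.mode q t n) := by
  let φ : {x : ℕ × ℕ // (x.2 : ℤ) - (x.1 : ℤ) = n} → ℤ := fun x => x.1.1
  have hφ : Function.Injective φ := by
    rintro ⟨⟨a, b⟩, h⟩ ⟨⟨a', b'⟩, h'⟩ h''
    simp only [φ] at h h' h''
    exact Subtype.ext (Prod.ext (by simp; omega) (by simp; omega))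
  let f : ℤ → CHeis N q t := fun a =>
    ((U.zeroPart q t * U.creationZ q t a * U.annihilationZ q t (a + n) : Heis N q t) : CHeis N q t)
  have hf0 : ∀ x, x ∉ Set.range φ → f x = 0 := by
    intro x hx
    rcases lt_or_ge x 0 with h | h
    · simp [f, U.creationZ_of_neg h, coe_zero_heis]
    rcases lt_or_ge (x + n) 0 with h' | h'
    · simp [f, U.annihilationZ_of_neg h', coe_zero_heis]
    exact absurd ⟨⟨(x.toNat, (x + n).toNat), by simp; omega⟩, by simp [φ, h]⟩ hx
  have hfφ : f ∘ φ = U.modeTerm q t n := by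
    funext x
    simp only [f, φ, Function.comp_apply, modeTerm]
    rw [show (x.1.1 : ℤ) + n = x.1.2 by have := x.2; omega, creationZ_natCast,
      annihilationZ_natCast]
  have hs : Summable f := by
    have h := (hasSum_normalMode (q := q) (t := t) (fun _ : Fin 1 => U) fun _ => n).summable
    refine ((Equiv.funUnique (Fin 1) ℤ).symm.summable_iff.2 h).congr fun a => ?_
    simp [f, normalTerm, creationProd, annihilationProd]
  have hs' : Summable (U.modeTerm q t n) := by
    rw [← hfφ]; exact hs.comp_injective hφ
  refine ⟨hs', ?_⟩
  have h1 : HasSum (f ∘ φ) (U.mode q t n) := by rw [hfφ]; exact hs'.hasSum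
  exact (hφ.hasSum_iff hf0).1 h1

theorem hasSum_prod_mode {k : ℕ} (U : Fin k → VertexOp N) (n : Fin k → ℤ) :
    HasSum (fun a : Fin k → ℤ => (((∏ j, U j).zeroPart q t *
      (List.ofFn fun j => (U j).creationZ q t (a j) * (U j).annihilationZ q t (a j + n j)).prod :
        Heis N q t) : CHeis N q t)) (List.ofFn fun j => (U j).mode q t (n j)).prod := by
  refine (hasSum_prod_ofFn fun j => ((U j).hasSum_mode (n j)).2).congr_fun fun a => ?_
  rw [zeroPart_prod, ← prod_ofFn_mul _ _ fun i j => zeroPart_commute _ _]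
  simp only [← mul_assoc]
  change (Completion.coeRingHom _ : CHeis N q t) = _
  rw [map_list_prod, List.map_ofFn]
  rfl

theorem hasSum_normalOrder {k : ℕ} (U : Fin k → VertexOp N) (a b : Fin k → ℤ) :
    HasSum (fun e : Pairs k → ℕ => (∏ x, expCoeff (contraction q t (U x.1.1) (U x.1.2)) (e x)) •
      (creationProd q t U (a - inflow e) * annihilationProd q t U (b - outflow e)))
      (List.ofFn fun j => (U j).creationZ q t (a j) * (U j).annihilationZ q t (b j)).prod := by
  obtain ⟨B, hB⟩ : ∃ B : ℕ, ∀ j, a j < B := by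
    refine ⟨(∑ j, |a j|).toNat + 1, fun j => ?_⟩
    have h1 : |a j| ≤ ∑ j, |a j| :=
      Finset.single_le_sum (f := fun j => |a j|) (fun i _ => abs_nonneg _) (Finset.mem_univ j)
    have h2 := le_abs_self (a j)
    omega
  rw [prod_ofFn_normalOrder _ _ (fun i j => expCoeff (contraction q t (U i) (U j)))
    (fun i j _ a b h => annihilationZ_mul_creationZ (U i) (U j) b h) a b hB]
  refine hasSum_of_injective (φ := fun (e : Pairs k → Fin B) x => (e x : ℕ)) ?_ ?_
  · intro e e' h
    funext x
    exact Fin.ext (congrFun h x)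
  · intro e he
    have : ∃ x, B ≤ e x := by
      by_contra h
      push Not at h
      exact he ⟨fun x => ⟨e x, h x⟩, rfl⟩
    obtain ⟨x, hx⟩ := this
    have h1 : (e x : ℤ) ≤ inflow e x.1.2 := by
      have := Finset.single_le_sum (f := fun y : Pairs k => if y.1.2 = x.1.2 then (e y : ℤ) else 0)
        (fun y _ => by split_ifs <;> positivity) (Finset.mem_univ x)
      rw [if_pos rfl] at this
      exact this
    rw [creationProd_eq_zero U (j := x.1.2), zero_mul, smul_zero]
    have := hB x.1.2
    simp only [Pi.sub_apply]
    omega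

/-- Normal ordering of a product of modes. -/
theorem hasSum_prod_mode_normalMode {k : ℕ} (U : Fin k → VertexOp N) (n : Fin k → ℤ) :
    HasSum (fun e : Pairs k → ℕ => (∏ x, expCoeff (contraction q t (U x.1.1) (U x.1.2)) (e x)) •
      normalMode q t U (n + flow e)) (List.ofFn fun j => (U j).mode q t (n j)).prod := by
  let c : (Pairs k → ℕ) → ℂ := fun e =>
    ∏ x, expCoeff (contraction q t (U x.1.1) (U x.1.2)) (e x)
  let f : (Pairs k → ℕ) × (Fin k → ℤ) → CHeis N q t := fun y =>
    ((c y.1 • normalTerm q t U (n + flow y.1) y.2 : Heis N q t) : CHeis N q t)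
  have hs : Summable f := summable_coe (finite_normalTerm_notMem U n c)
  have h1 : HasSum (fun e => c e • normalMode q t U (n + flow e)) (∑' y, f y) := by
    refine hs.hasSum.prod_fiberwise fun e => ?_
    have := (hasSum_normalMode (q := q) (t := t) U (n + flow e)).const_smul (c e)
    refine this.congr_fun fun a => ?_
    exact (Completion.coe_smul _ _)
  let E : (Fin k → ℤ) × (Pairs k → ℕ) ≃ (Pairs k → ℕ) × (Fin k → ℤ) :=
    { toFun := fun y => (y.2, y.1 - inflow y.2)
      invFun := fun y => (y.2 + inflow y.1, y.1)
      left_inv := fun y => by simp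
      right_inv := fun y => by simp }
  have h2 : HasSum (f ∘ E) (∑' y, f y) := E.hasSum_iff.2 hs.hasSum
  have h3 := h2.prod_fiberwise (g := fun a => (((∏ j, U j).zeroPart q t *
      (List.ofFn fun j => (U j).creationZ q t (a j) * (U j).annihilationZ q t (a j + n j)).prod :
        Heis N q t) : CHeis N q t)) fun a => by
    refine (hasSum_coe ((hasSum_normalOrder (q := q) (t := t) U a (a + n)).mul_left
      ((∏ j, U j).zeroPart q t))).congr_fun fun e => ?_
    simp only [f, E, Function.comp_apply, Equiv.coe_fn_mk, normalTerm, c]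
    rw [mul_smul_comm, ← mul_assoc]
    congr 4
    funext j
    simp only [flow, Pi.add_apply, Pi.sub_apply]
    ring
  rwa [h3.unique (hasSum_prod_mode U n)] at h1

theorem hasSum_mode_prod {k : ℕ} (U : Fin k → VertexOp N) (d : ℤ) :
    HasSum (fun n : Fin k → ℤ => if ∑ j, n j = d then normalMode q t U n else 0)
      ((∏ j, U j).mode q t d) := by
  let f : (Fin k → ℤ) × (Fin k → ℤ) → Heis N q t := fun y =>
    if ∑ j, y.1 j = d then normalTerm q t U y.1 y.2 else 0
  have hs : Summable fun y => (f y : CHeis N q t) := by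
    refine summable_coe fun M => ?_
    refine (finite_degree_lt d M).subset fun y hy => ?_
    by_contra h
    refine hy ?_
    simp only [f]
    split_ifs with hd
    · refine normalTerm_mem _ _ _ fun h1 h2 => ?_
      by_contra h3
      exact h ⟨h1, h2, hd, not_le.1 h3⟩
    · exact Ideal.zero_mem _
  have h1 : HasSum (fun n : Fin k → ℤ => if ∑ j, n j = d then normalMode q t U n else 0)
      (∑' y, (f y : CHeis N q t)) := by
    refine hs.hasSum.prod_fiberwise fun n => ?_
    simp only [f]
    split_ifs
    · exact hasSum_normalMode U n
    · simp only [coe_zero_heis]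
      exact hasSum_zero
  let F : ℤ × ((Fin k → ℤ) × (Fin k → ℤ)) → CHeis N q t := fun x =>
    if ∑ j, x.2.2 j = x.1 then (f x.2 : CHeis N q t) else 0
  have h2 : HasSum F (∑' y, (f y : CHeis N q t)) := by
    have hinj : Function.Injective fun y : (Fin k → ℤ) × (Fin k → ℤ) => (∑ j, y.2 j, y) :=
      fun y y' h => congrArg Prod.snd h
    refine (hinj.hasSum_iff ?_).1 ?_
    · rintro ⟨A, y⟩ hx
      refine if_neg fun h => hx ⟨y, ?_⟩
      simpa using h
    · simpa [F, Function.comp_def] using hs.hasSum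
  have hcoef : ∀ (c : VertexOp N → ℤ → Heis N q t) (_ : ∀ a, c 1 a = if a = 0 then 1 else 0)
      (_ : ∀ (U V : VertexOp N) {a : ℤ} {B : ℕ}, a < B →
        c (U * V) a = ∑ s : Fin B, c U ((s : ℕ) : ℤ) * c V (a - (s : ℕ)))
      (_ : ∀ (U : VertexOp N) {a : ℤ}, a < 0 → c U a = 0) (A : ℤ),
      HasSum (fun a : Fin k → ℤ => if ∑ j, a j = A then
        (List.ofFn fun j => c (U j) (a j)).prod else 0) (c (∏ j, U j) A) := by
    intro c hc1 hcm hc0 A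
    rw [prod_coeff_eq_sum hc1 hcm U (A := A) (B := A.toNat + 1) (by omega)]
    refine hasSum_of_injective (φ := fun (a : Fin k → Fin (A.toNat + 1)) j => ((a j : ℕ) : ℤ)) ?_ ?_
    · intro a b h
      funext j
      exact Fin.ext (Int.ofNat.inj (congrFun h j))
    · intro a ha
      by_cases h0 : ∀ j, 0 ≤ a j
      · refine if_neg fun h => ha ⟨fun j => ⟨(a j).toNat, ?_⟩, ?_⟩
        · have : a j ≤ ∑ j, a j := Finset.single_le_sum (fun i _ => h0 i) (Finset.mem_univ j)
          omega
        · funext j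
          simp [h0 j]
      · push Not at h0
        obtain ⟨j, hj⟩ := h0
        rw [List.prod_eq_zero ((List.mem_ofFn' _ _).2 ⟨j, hc0 _ hj⟩), ite_self]
  have h3 := h2.prod_fiberwise (g := fun A => (((∏ j, U j).zeroPart q t *
      (∏ j, U j).creationZ q t A * (∏ j, U j).annihilationZ q t (A + d) : Heis N q t) :
        CHeis N q t)) fun A => by
    have hc := hcoef (creationZ q t) creationZ_one (fun U V {a B} h => creationZ_mul U V h)
      (fun U {a} h => creationZ_of_neg U h) A
    have ha := hcoef (annihilationZ q t) annihilationZ_one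
      (fun U V {a B} h => annihilationZ_mul U V h)
      (fun U {a} h => annihilationZ_of_neg U h) (A + d)
    let E : (Fin k → ℤ) × (Fin k → ℤ) ≃ (Fin k → ℤ) × (Fin k → ℤ) :=
      { toFun := fun y => (y.2 - y.1, y.1)
        invFun := fun y => (y.2, y.2 + y.1)
        left_inv := fun y => by simp
        right_inv := fun y => by simp }
    rw [← E.hasSum_iff]
    refine (hasSum_coe ((hc.mul_left ((∏ j, U j).zeroPart q t)).mul_of_nonarchimedean
      ha)).congr_fun fun y => ?_
    simp only [F, f, E, Function.comp_apply, Equiv.coe_fn_mk, normalTerm, Pi.sub_apply,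
      Finset.sum_sub_distrib]
    by_cases hA : ∑ j, y.1 j = A
    · simp only [hA, if_true, sub_eq_iff_eq_add']
      split_ifs with h
      · rw [add_sub_cancel]; rfl
      · simp
    · simp [hA, coe_zero_heis]
  rwa [h3.unique ((∏ j, U j).hasSum_mode d).2] at h1

theorem normalMode_shift {k : ℕ} (U : Fin k → VertexOp N) {z : Fin k → ℂ} (hz : ∀ j, z j ≠ 0)
    (n : Fin k → ℤ) :
    normalMode q t (fun j => (U j).shift (z j)) n =
      (∏ j, z j ^ (-n j)) • normalMode q t U n := by
  refine HasSum.tsum_eq (((hasSum_normalMode (q := q) (t := t) U n).const_smul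
    (∏ j, z j ^ (-n j))).congr_fun fun a => ?_)
  rw [normalTerm_shift U hz, Completion.coe_smul]

end VertexOp

/-! ### Corrected products -/

/-- Pairs of functions, sorted by their sum. -/
def sigmaLEEquivProd (ι : Type*) [Fintype ι] [DecidableEq ι] :
    (Σ e : ι → ℕ, Fintype.piFinset fun x => Finset.range (e x + 1)) ≃ (ι → ℕ) × (ι → ℕ) where
  toFun y := (y.2.1, y.1 - y.2.1)
  invFun y := ⟨y.1 + y.2, y.1, Fintype.mem_piFinset.2 fun x => by simp⟩
  left_inv := by
    rintro ⟨e, e', h⟩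
    have h1 : e' + (e - e') = e := by
      funext x
      have := Finset.mem_range.1 (Fintype.mem_piFinset.1 h x)
      simp only [Pi.add_apply, Pi.sub_apply]
      omega
    exact Sigma.subtype_ext h1 rfl
  right_inv := by
    rintro ⟨e, e'⟩
    simp

namespace VertexOp

/-- The coefficients of the product of `∑ f s x ^ s` and the contraction of `U` and `V`. -/
def correctedContraction (q t : ℂ) (f : ℕ → ℂ) (U V : VertexOp N) (s : ℕ) : ℂ :=
  ∑ r ∈ Finset.range (s + 1), f r * expCoeff (contraction q t U V) (s - r)

theorem summable_smul_normalMode_add {k : ℕ} (U : Fin k → VertexOp N) (n : Fin k → ℤ)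
    (c : (Pairs k → ℕ) × (Pairs k → ℕ) → ℂ) :
    Summable fun y : (Pairs k → ℕ) × (Pairs k → ℕ) =>
      c y • normalMode q t U (n + flow (y.1 + y.2)) := by
  have hs : Summable fun y : ((Pairs k → ℕ) × (Pairs k → ℕ)) × (Fin k → ℤ) =>
      ((c y.1 • normalTerm q t U (n + flow (y.1.1 + y.1.2)) y.2 : Heis N q t) : CHeis N q t) := by
    refine summable_coe fun M => ?_
    refine (Set.Finite.preimage' (finite_normalTerm_notMem (q := q) (t := t) U n 1 M)
      (f := fun y : ((Pairs k → ℕ) × (Pairs k → ℕ)) × (Fin k → ℤ) => (y.1.1 + y.1.2, y.2))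
      fun b _ => ?_).subset fun y hy => ?_
    · refine (((Set.finite_Icc 0 b.1).prod (Set.finite_Icc 0 b.1)).prod
        (Set.finite_singleton b.2)).subset ?_
      rintro ⟨⟨e, e'⟩, a⟩ rfl
      refine ⟨⟨⟨fun x => Nat.zero_le _, fun x => ?_⟩, fun x => Nat.zero_le _, fun x => ?_⟩, rfl⟩ <;>
      simp
    · intro h
      refine hy ?_
      rw [Algebra.smul_def]
      refine Ideal.mul_mem_left _ _ ?_
      simpa using h
  refine (hs.hasSum.prod_fiberwise (g := fun y => c y • normalMode q t U (n + flow (y.1 + y.2)))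
    fun y => ?_).summable
  refine ((hasSum_normalMode (q := q) (t := t) U (n + flow (y.1 + y.2))).const_smul
    (c y)).congr_fun fun a => ?_
  exact Completion.coe_smul _ _

theorem hasSum_corrected {k : ℕ} (f : ℕ → ℂ) (U : Fin k → VertexOp N) (n : Fin k → ℤ) :
    ∃ S : CHeis N q t,
      HasSum (fun e : Pairs k → ℕ => (∏ x, f (e x)) •
        (List.ofFn fun j => (U j).mode q t ((n + flow e) j)).prod) S ∧
      HasSum (fun e : Pairs k → ℕ =>
        (∏ x, correctedContraction q t f (U x.1.1) (U x.1.2) (e x)) •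
          normalMode q t U (n + flow e)) S := by
  let g : Pairs k → ℕ → ℂ := fun x => expCoeff (contraction q t (U x.1.1) (U x.1.2))
  let F : (Pairs k → ℕ) × (Pairs k → ℕ) → CHeis N q t := fun y =>
    ((∏ x, f (y.1 x)) * ∏ x, g x (y.2 x)) • normalMode q t U (n + flow (y.1 + y.2))
  have hs : Summable F := summable_smul_normalMode_add U n _
  refine ⟨∑' y, F y, hs.hasSum.prod_fiberwise fun e => ?_, ?_⟩
  · refine ((hasSum_prod_mode_normalMode (q := q) (t := t) U (n + flow e)).const_smul
      (∏ x, f (e x))).congr_fun fun e' => ?_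
    simp only [F, g]
    rw [smul_smul, flow_add, add_assoc]
  · have h1 := (sigmaLEEquivProd (Pairs k)).hasSum_iff.2 hs.hasSum
    refine h1.sigma fun e => ?_
    have h2 : (∏ x, correctedContraction q t f (U x.1.1) (U x.1.2) (e x)) •
          normalMode q t U (n + flow e) =
        ∑ e' : Fintype.piFinset fun x => Finset.range (e x + 1),
          (F ∘ sigmaLEEquivProd (Pairs k)) ⟨e, e'⟩ := by
      simp only [correctedContraction]
      rw [Finset.prod_univ_sum, Finset.sum_smul,
        ← Finset.sum_coe_sort (Fintype.piFinset fun x => Finset.range (e x + 1))]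
      refine Finset.sum_congr rfl fun e' _ => ?_
      have h3 : e'.1 + (e - e'.1) = e := by
        funext x
        have := Finset.mem_range.1 (Fintype.mem_piFinset.1 e'.2 x)
        simp only [Pi.add_apply, Pi.sub_apply]
        omega
      simp only [F, g, sigmaLEEquivProd, Function.comp_apply, Equiv.coe_fn_mk, h3,
        Finset.prod_mul_distrib, Pi.sub_apply]
    rw [h2]
    exact hasSum_fintype _

end VertexOp

open VertexOp

/-- The expansion of the corrected product in normally ordered products. -/
theorem hasSum_correctedTerm (i : Fin (N - 1)) {k : ℕ} (n : Fin k → ℤ) :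
    ∃ S : (Fin k → Fin (i.val + 1) → Fin N) → CHeis N q t,
      HasSum (correctedTerm N q t i k n)
        (∑ L ∈ Fintype.piFinset fun _ : Fin k => weights N (i.val + 1), S L) ∧
      ∀ L, HasSum (fun e : Pairs k → ℕ =>
        (∏ x, correctedContraction q t (fCoeff N q t i) (vertexWeight N q t (L x.1.1))
          (vertexWeight N q t (L x.1.2)) (e x)) •
          normalMode q t (fun j => vertexWeight N q t (L j)) (n + flow e)) (S L) := by
  choose S h1 h2 using fun L : Fin k → Fin (i.val + 1) → Fin N =>
    hasSum_corrected (q := q) (t := t) (fCoeff N q t i) (fun j => vertexWeight N q t (L j)) n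
  refine ⟨S, ?_, h2⟩
  refine (hasSum_sum fun L _ => h1 L).congr_fun fun e => ?_
  rw [correctedTerm, ← Finset.smul_sum]
  congr 1
  have := (MultilinearMap.mkPiAlgebraFin ℂ k (CHeis N q t)).map_sum_finset
    (fun j l => (vertexWeight N q t l).mode q t ((n + flow e) j))
    (fun _ => weights N (i.val + 1))
  simp only [MultilinearMap.mkPiAlgebraFin_apply] at this
  rw [← this]
  congr 2
  funext j
  rw [genT]
  congr 1
  funext l
  congr 1
  simp only [flow, inflow, outflow, Pi.add_apply, Pi.sub_apply]
  ring

/-! ### The deformed Cartan matrix -/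

/-- The deformed Cartan matrix as a function of `p = q t⁻¹`. -/
def cartanP (N : ℕ) (P : ℂ) : Matrix (Fin (N - 1)) (Fin (N - 1)) ℂ :=
  Matrix.of fun i j => (if i = j then P + P⁻¹ else 0) - (incidence N i j : ℂ)

theorem defCartan_zpow (N : ℕ) (q t : ℂ) (m : ℤ) :
    defCartan N (q ^ m) (t ^ m) = cartanP N ((q * t⁻¹) ^ m) := by
  ext i j
  simp only [defCartan, cartanP, Matrix.of_apply, mul_zpow, inv_zpow, mul_inv, inv_inv]

theorem cartanP_inv (P : ℂ) : cartanP N P⁻¹ = cartanP N P := by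
  ext i j
  simp only [cartanP, Matrix.of_apply, inv_inv, add_comm]

theorem cartanP_transpose (P : ℂ) : (cartanP N P).transpose = cartanP N P := by
  ext i j
  simp only [cartanP, Matrix.of_apply, Matrix.transpose_apply, incidence, eq_comm (a := j), or_comm]

/-- The `s`-th standard basis vector, counted from `1`; it vanishes for `s = 0` and `s ≥ N`. -/
def stdVec (N : ℕ) (s : ℕ) : Fin (N - 1) → ℂ := fun j => if j.val + 1 = s then 1 else 0

theorem stdVec_succ (i : Fin (N - 1)) : stdVec N (i.val + 1) = Pi.single i 1 := by
  funext j
  simp only [stdVec, Pi.single_apply, add_left_inj, Fin.ext_iff]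

theorem dotProduct_stdVec (u : Fin (N - 1) → ℂ) (i : Fin (N - 1)) :
    dotProduct u (stdVec N (i.val + 1)) = u i := by
  rw [stdVec_succ, dotProduct_single, mul_one]

theorem cartanP_mulVec_stdVec (P : ℂ) (i : Fin (N - 1)) :
    (cartanP N P).mulVec (stdVec N (i.val + 1)) =
      (P + P⁻¹) • stdVec N (i.val + 1) - stdVec N i.val - stdVec N (i.val + 2) := by
  funext j
  rw [stdVec_succ, Matrix.mulVec_single_one]
  simp only [cartanP, Matrix.of_apply, Matrix.col_apply, incidence, stdVec, Pi.sub_apply,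
    Pi.smul_apply, smul_eq_mul, Pi.single_apply]
  by_cases h1 : j = i
  · subst h1; simp
  · by_cases h2 : j.val + 1 = i.val
    · simp [h1, h2]
    · by_cases h3 : i.val + 1 = j.val
      · simp [h1, h2, h3]
      · simp [h1, h2, h3]
        omega

theorem isUnit_det_cartanP {P : ℂ} (hP : P ≠ 0) (hPg : ∀ j : ℕ, j ≠ 0 → P ^ (2 * j) ≠ 1) :
    IsUnit (cartanP N P).det := by
  rw [isUnit_iff_ne_zero, Ne, ← Matrix.exists_mulVec_eq_zero_iff]
  rintro ⟨v, hv, hCv⟩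
  let w : ℕ → ℂ := fun s => dotProduct (stdVec N s) v
  have hw : ∀ i : Fin (N - 1), (P + P⁻¹) * w (i.val + 1) - w i.val - w (i.val + 2) = 0 := by
    intro i
    have h := congrArg (fun x => dotProduct (stdVec N (i.val + 1)) x) hCv
    simp only [dotProduct_zero] at h
    rw [Matrix.dotProduct_mulVec, ← Matrix.mulVec_transpose, cartanP_transpose,
      cartanP_mulVec_stdVec, sub_dotProduct, sub_dotProduct, smul_dotProduct, smul_eq_mul] at h
    exact h
  have hw0 : w 0 = 0 := by simp [w, stdVec, dotProduct]
  have hwN : ∀ s, N ≤ s → w s = 0 := fun s hs => by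
    simp only [w, stdVec, dotProduct]
    refine Finset.sum_eq_zero fun j _ => ?_
    rw [if_neg (by have := j.2; omega), zero_mul]
  have hs : ∀ s, (s < N → (P - P⁻¹) * w s = (P ^ s - (P⁻¹) ^ s) * w 1) ∧
      (s + 1 ≤ N → (P - P⁻¹) * w (s + 1) = (P ^ (s + 1) - (P⁻¹) ^ (s + 1)) * w 1) := by
    intro s
    induction s with
    | zero => simp [hw0]
    | succ s ih =>
      refine ⟨fun h => ih.2 (by omega), fun h => ?_⟩
      have h1 := hw ⟨s, by omega⟩
      have h2 := ih.1 (by omega)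
      have h3 := ih.2 (by omega)
      have h4 : w (s + 2) = (P + P⁻¹) * w (s + 1) - w s := by linear_combination -h1
      have h5 : P * P⁻¹ = 1 := mul_inv_cancel₀ hP
      rw [show s + 1 + 1 = s + 2 from rfl, h4]
      have h6 : (P - P⁻¹) * ((P + P⁻¹) * w (s + 1) - w s) =
          (P + P⁻¹) * ((P - P⁻¹) * w (s + 1)) - (P - P⁻¹) * w s := by ring
      rw [h6, h2, h3]
      have h7 : (P + P⁻¹) * (P ^ (s + 1) - P⁻¹ ^ (s + 1)) - (P ^ s - P⁻¹ ^ s) =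
          P ^ (s + 2) - P⁻¹ ^ (s + 2) := by
        linear_combination (P ^ s - P⁻¹ ^ s) * h5
      linear_combination w 1 * h7
  have hne : ∀ j : ℕ, j ≠ 0 → P ^ j - P⁻¹ ^ j ≠ 0 := fun j hj h => by
    refine hPg j hj ?_
    have h1 : P ^ j = P⁻¹ ^ j := sub_eq_zero.1 h
    rw [two_mul, pow_add]
    nth_rewrite 2 [h1]
    rw [← mul_pow, mul_inv_cancel₀ hP, one_pow]
  rcases Nat.eq_zero_or_pos (N - 1) with h0 | h0
  · refine hv (funext fun j => absurd j.2 (by omega))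
  have hN := (hs (N - 1)).2 (by omega)
  rw [show N - 1 + 1 = N by omega, hwN N le_rfl, mul_zero] at hN
  have hw1 : w 1 = 0 := (mul_eq_zero.1 hN.symm).resolve_left (hne N (by omega))
  refine hv (funext fun j => ?_)
  have hj := (hs (j.val + 1)).1 (by have := j.2; omega)
  rw [hw1, mul_zero] at hj
  have h1 : P - P⁻¹ ≠ 0 := by simpa using hne 1 one_ne_zero
  have h2 := (mul_eq_zero.1 hj).resolve_left h1
  rw [← dotProduct_stdVec v j, dotProduct_comm]
  exact h2

/-! ### Contractions of the fields `Λ_j` and `Y_λ` -/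

theorem osc_prod {ι : Type*} (s : Finset ι) (U : ι → VertexOp N) (m : ℤ) :
    (∏ a ∈ s, U a).osc m = ∑ a ∈ s, (U a).osc m := by
  classical
  induction s using Finset.induction_on with
  | empty => rfl
  | insert a s ha ih =>
    rw [Finset.prod_insert ha, Finset.sum_insert ha, ← ih]
    rfl

theorem osc_vertexLambda_succ {a : ℕ} (h : a < N - 1) (m : ℤ) :
    (vertexLambda N q t (a + 1)).osc m = (vertexLambda N q t a).osc m -
      (((q * t⁻¹) ^ m) ^ (a + 1)) • stdVec N (a + 1) := by
  funext j
  rw [vertexLambda, dif_pos h]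
  change (vertexLambda N q t a).osc m j + -(((q * t⁻¹) ^ (-(a + 1 : ℤ))) ^ (-m) *
    (if j = ⟨a, h⟩ then 1 else 0)) = _
  rw [sub_eq_add_neg, Pi.add_apply, Pi.neg_apply, Pi.smul_apply, smul_eq_mul, stdVec,
    ← zpow_mul, ← zpow_natCast, ← zpow_mul]
  congr 2
  congr 1
  · congr 1; push_cast; ring
  · simp [Fin.ext_iff]

theorem osc_vertexY (m : ℤ) (i : Fin (N - 1)) :
    (vertexY N q t i).osc m = (cartanP N ((q * t⁻¹) ^ m))⁻¹.mulVec (stdVec N (i.val + 1)) := by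
  funext j
  rw [stdVec_succ, Matrix.mulVec_single_one]
  simp only [vertexY, defCartan_zpow]
  rw [← Matrix.transpose_nonsing_inv]
  rfl

/-- The image of the exponent of `Λ_{a+1}` under the deformed Cartan matrix. -/
theorem cartanP_mulVec_osc_vertexLambda (hp : q * t⁻¹ ≠ 0) {m : ℤ}
    (hdet : IsUnit (cartanP N ((q * t⁻¹) ^ m)).det) {a : ℕ} (ha : a < N) (hN : 2 ≤ N) :
    (cartanP N ((q * t⁻¹) ^ m)).mulVec ((vertexLambda N q t a).osc m) =
      ((q * t⁻¹) ^ m) ^ a • stdVec N (a + 1) - ((q * t⁻¹) ^ m) ^ (a + 1) • stdVec N a := by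
  induction a with
  | zero =>
    rw [vertexLambda, dif_pos (by omega), osc_vertexY, Matrix.mulVec_mulVec,
      Matrix.mul_nonsing_inv _ hdet, Matrix.one_mulVec]
    have : stdVec N 0 = 0 := by funext j; simp [stdVec]
    simp [this]
  | succ a ih =>
    rw [osc_vertexLambda_succ (by omega), Matrix.mulVec_sub, ih (by omega), Matrix.mulVec_smul,
      cartanP_mulVec_stdVec _ ⟨a, by omega⟩]
    have hP : (q * t⁻¹) ^ m ≠ 0 := zpow_ne_zero _ hp
    generalize (q * t⁻¹) ^ m = P at hP
    funext j
    simp only [Pi.sub_apply, Pi.smul_apply, smul_eq_mul, pow_succ]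
    field_simp
    ring

/-- The inner products of the exponents of the fields `Λ_{a+1}`. -/
theorem osc_vertexLambda_dotProduct (hp : q * t⁻¹ ≠ 0) {m : ℤ}
    (hdet : IsUnit (cartanP N ((q * t⁻¹) ^ m)).det) (hN : 2 ≤ N) {a b : ℕ} (ha : a < N)
    (hb : b < N) :
    dotProduct ((vertexLambda N q t a).osc m)
      ((cartanP N ((q * t⁻¹) ^ m)).mulVec ((vertexLambda N q t b).osc (-m))) =
      (cartanP N ((q * t⁻¹) ^ m))⁻¹ ⟨0, by omega⟩ ⟨0, by omega⟩ -
        (if a < b then ((q * t⁻¹) ^ m)⁻¹ else 0) - (if b < a then (q * t⁻¹) ^ m else 0) := by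
  have hC : cartanP N ((q * t⁻¹) ^ (-m)) = cartanP N ((q * t⁻¹) ^ m) := by
    rw [zpow_neg, cartanP_inv]
  have hdet' : IsUnit (cartanP N ((q * t⁻¹) ^ (-m))).det := by rwa [hC]
  have hP : (q * t⁻¹) ^ m ≠ 0 := zpow_ne_zero _ hp
  induction a with
  | zero =>
    rw [Matrix.dotProduct_mulVec, ← Matrix.mulVec_transpose, cartanP_transpose,
      cartanP_mulVec_osc_vertexLambda hp hdet ha hN]
    have h0 : stdVec N 0 = 0 := by funext j; simp [stdVec]
    rw [h0, smul_zero, sub_zero, pow_zero, one_smul, dotProduct_comm,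
      dotProduct_stdVec _ ⟨0, by omega⟩]
    induction b with
    | zero =>
      rw [vertexLambda, dif_pos (by omega), osc_vertexY, hC, stdVec_succ,
        Matrix.mulVec_single_one]
      simp
    | succ b ih =>
      rw [osc_vertexLambda_succ (by omega), Pi.sub_apply, ih (by omega), Pi.smul_apply, stdVec,
        zpow_neg, smul_eq_mul]
      rcases Nat.eq_zero_or_pos b with rfl | hb0
      · simp
      · simp [hb0, hb0.ne']
  | succ a ih =>
    have h1 := cartanP_mulVec_osc_vertexLambda hp hdet' hb hN
    rw [hC] at h1
    rw [osc_vertexLambda_succ (by omega), sub_dotProduct, ih (by omega), smul_dotProduct,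
      dotProduct_comm, dotProduct_stdVec _ ⟨a, by omega⟩, h1, zpow_neg]
    generalize (q * t⁻¹) ^ m = P at hP
    simp only [Pi.sub_apply, Pi.smul_apply, smul_eq_mul, stdVec]
    rcases lt_trichotomy a b with h | h | h
    · rcases Nat.lt_or_ge (a + 1) b with h' | h'
      · simp [h, h', h.not_gt, h'.not_gt, h.ne, h'.ne]
      · have : b = a + 1 := by omega
        subst this
        simp
        field_simp
        ring
    · subst h
      simp
      field_simp
      ring
    · have h2 : ¬ a + 1 = b := by omega
      have h3 : ¬ a = b := by omega
      have h4 : ¬ a < b := by omega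
      have h5 : ¬ a + 1 < b := by omega
      have h6 : b < a + 1 := by omega
      simp [h, h2, h3, h4, h5, h6]

/-- The number of values of `m` below `y`. -/
def rankBelow {r : ℕ} (m : Fin r → ℕ) (y : ℕ) : ℤ := ∑ b, if m b < y then 1 else 0

theorem sum_interlacing {P : ℂ} (hP : P ≠ 0) {r : ℕ} (m : Fin r → ℕ) (hm : StrictMono m) (y : ℕ)
    [Decidable (∀ b, m b ≠ y)] :
    ∑ b : Fin r, P ^ (2 * (b.val : ℤ)) *
      ((if y < m b then P⁻¹ else 0) + (if m b < y then P else 0)) =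
      ∑ j : Fin r, P ^ (2 * (j.val : ℤ) - 1) - P⁻¹ +
        if ∀ b, m b ≠ y then P ^ (2 * rankBelow m y - 1) else 0 := by
  classical
  induction r with
  | zero => simp [rankBelow]
  | succ r ih =>
    have hlt : ∀ b : Fin r, m b.castSucc < m (Fin.last r) := fun b => hm (Fin.castSucc_lt_last b)
    rw [Fin.sum_univ_castSucc, Fin.sum_univ_castSucc]
    simp only [Fin.val_castSucc, Fin.val_last]
    rw [ih (fun b => m b.castSucc) fun a b h => hm (Fin.castSucc_lt_castSucc_iff.2 h)]
    have hr : rankBelow m y = rankBelow (fun b => m b.castSucc) y +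
        if m (Fin.last r) < y then 1 else 0 := by
      rw [rankBelow, rankBelow, Fin.sum_univ_castSucc]
    have hall : (∀ b, m b ≠ y) ↔ (∀ b : Fin r, m b.castSucc ≠ y) ∧ m (Fin.last r) ≠ y :=
      Fin.forall_fin_succ'
    have hfull : m (Fin.last r) ≤ y → rankBelow (fun b => m b.castSucc) y = r ∧
        ∀ b : Fin r, m b.castSucc ≠ y := by
      intro h
      refine ⟨?_, fun b => ((hlt b).trans_le h).ne⟩
      rw [rankBelow, Finset.sum_congr rfl fun b _ => if_pos ((hlt b).trans_le h)]
      simp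
    have e1 : P ^ (2 * (r : ℤ)) * P⁻¹ = P ^ (2 * (r : ℤ) - 1) := by
      rw [zpow_sub_one₀ hP]
    have e2 : P ^ (2 * (r : ℤ)) * P = P ^ (2 * ((r : ℤ) + 1) - 1) := by
      rw [← zpow_add_one₀ hP]; congr 1; ring
    rcases lt_trichotomy y (m (Fin.last r)) with h | h | h
    · rw [hr, if_pos h, if_neg h.not_gt, if_neg h.not_gt, add_zero, add_zero, e1]
      simp only [hall, h.ne', ne_eq, not_false_eq_true, and_true]
      ring
    · obtain ⟨h1, h2⟩ := hfull h.ge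
      rw [if_neg h.not_lt, if_neg h.not_gt, if_pos h2, h1, if_neg (fun h3 => (hall.1 h3).2 h.symm)]
      ring
    · obtain ⟨h1, h2⟩ := hfull h.le
      rw [hr, if_neg h.not_gt, if_pos h, if_pos h2, h1, if_pos (hall.2 ⟨h2, h.ne⟩), if_pos h,
        zero_add, e2]
      ring

/-- The positions of the elements of `l` that do not occur in `m`. -/
def newIndices {r : ℕ} (l m : Fin r → Fin N) : Finset (Fin r) :=
  Finset.univ.filter fun a => ∀ b, (m b).val ≠ (l a).val

/-- The exponents of `p` in the corrected contraction of `Y_l` and `Y_m`. -/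
def contractionExponent {r : ℕ} (l m : Fin r → Fin N) (a : Fin r) : ℤ :=
  2 * (rankBelow (fun b => (m b).val) (l a).val - a.val) - 1

theorem strictMono_of_mem_weights {r : ℕ} {l : Fin r → Fin N} (h : l ∈ weights N r) :
    StrictMono fun b => (l b).val := fun a b hab => (Finset.mem_filter.1 h).2 a b hab

theorem osc_vertexWeight {r : ℕ} (l : Fin r → Fin N) (m : ℤ) :
    (vertexWeight N q t l).osc m = ∑ a : Fin r,
      ((q * t⁻¹) ^ m) ^ ((r : ℤ) - 2 * (a.val : ℤ) - 1) • (vertexLambda N q t (l a)).osc m := by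
  rw [vertexWeight, osc_prod]
  refine Finset.sum_congr rfl fun a _ => ?_
  funext j
  change ((q * t⁻¹) ^ _) ^ (-m) * _ = _
  rw [Pi.smul_apply, smul_eq_mul, ← zpow_mul, ← zpow_mul]
  congr 2
  ring

theorem osc_vertexWeight_dotProduct (hp : q * t⁻¹ ≠ 0) {z : ℤ}
    (hdet : IsUnit (cartanP N ((q * t⁻¹) ^ z)).det) (hN : 2 ≤ N) {r : ℕ} {l m : Fin r → Fin N}
    (hm : m ∈ weights N r) :
    dotProduct ((vertexWeight N q t l).osc z)
      ((cartanP N ((q * t⁻¹) ^ z)).mulVec ((vertexWeight N q t m).osc (-z))) =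
      (∑ a : Fin r, ((q * t⁻¹) ^ z) ^ (-2 * (a.val : ℤ)) *
        ((∑ b : Fin r, ((q * t⁻¹) ^ z) ^ (2 * (b.val : ℤ)) *
          (cartanP N ((q * t⁻¹) ^ z))⁻¹ ⟨0, by omega⟩ ⟨0, by omega⟩) -
        (∑ j : Fin r, ((q * t⁻¹) ^ z) ^ (2 * (j.val : ℤ) - 1) - ((q * t⁻¹) ^ z)⁻¹))) -
      ∑ a ∈ newIndices l m, ((q * t⁻¹) ^ z) ^ contractionExponent l m a := by
  have hP : (q * t⁻¹) ^ z ≠ 0 := zpow_ne_zero _ hp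
  rw [osc_vertexWeight, osc_vertexWeight, Matrix.mulVec_sum, sum_dotProduct, newIndices,
    Finset.sum_filter, ← Finset.sum_sub_distrib]
  refine Finset.sum_congr rfl fun a _ => ?_
  rw [dotProduct_sum]
  simp only [Matrix.mulVec_smul, dotProduct_smul, smul_dotProduct, smul_eq_mul,
    osc_vertexLambda_dotProduct hp hdet hN (l a).2 (m _).2]
  have hs := sum_interlacing hP (fun b => (m b).val) (strictMono_of_mem_weights hm) (l a).val
  have e1 : ∀ b : Fin r, ((q * t⁻¹) ^ (-z)) ^ ((r : ℤ) - 2 * (b.val : ℤ) - 1) *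
      ((q * t⁻¹) ^ z) ^ ((r : ℤ) - 2 * (a.val : ℤ) - 1) =
      ((q * t⁻¹) ^ z) ^ (-2 * (a.val : ℤ)) * ((q * t⁻¹) ^ z) ^ (2 * (b.val : ℤ)) := fun b => by
    rw [zpow_neg, inv_zpow', ← zpow_add₀ hP, ← zpow_add₀ hP]
    congr 1
    ring
  have e2 : (if ∀ b, (m b).val ≠ (l a).val then ((q * t⁻¹) ^ z) ^ contractionExponent l m a
      else 0) = ((q * t⁻¹) ^ z) ^ (-2 * (a.val : ℤ)) *
      (if ∀ b, (m b).val ≠ (l a).val then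
        ((q * t⁻¹) ^ z) ^ (2 * rankBelow (fun b => (m b).val) (l a).val - 1) else 0) := by
    rw [mul_ite, mul_zero, ← zpow_add₀ hP, contractionExponent]
    congr 2
    ring
  rw [e2, ← mul_sub, eq_sub_of_add_eq' hs.symm, sub_sub_sub_cancel_right, ← Finset.sum_sub_distrib, Finset.mul_sum]
  refine Finset.sum_congr rfl fun b _ => ?_
  rw [← mul_assoc, e1]
  ring

/-- The highest weight, as a sequence. -/
def topWeight (i : Fin (N - 1)) : Fin (i.val + 1) → Fin N := fun a => ⟨a.val, by omega⟩

theorem topWeight_mem (i : Fin (N - 1)) : topWeight i ∈ weights N (i.val + 1) :=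
  Finset.mem_filter.2 ⟨Finset.mem_univ _, fun _ _ h => h⟩

theorem cartanP_mulVec_osc_topWeight (hp : q * t⁻¹ ≠ 0) {z : ℤ}
    (hdet : IsUnit (cartanP N ((q * t⁻¹) ^ z)).det) (i : Fin (N - 1)) :
    (cartanP N ((q * t⁻¹) ^ z)).mulVec ((vertexWeight N q t (topWeight i)).osc z) =
      stdVec N (i.val + 1) := by
  have hP : (q * t⁻¹) ^ z ≠ 0 := zpow_ne_zero _ hp
  rw [osc_vertexWeight, Matrix.mulVec_sum]
  let F : ℕ → Fin (N - 1) → ℂ := fun s => ((q * t⁻¹) ^ z) ^ ((i.val : ℤ) + 1 - s) • stdVec N s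
  have h1 : ∀ a : Fin (i.val + 1), (cartanP N ((q * t⁻¹) ^ z)).mulVec
      (((q * t⁻¹) ^ z) ^ (((i.val + 1 : ℕ) : ℤ) - 2 * (a.val : ℤ) - 1) •
        (vertexLambda N q t (topWeight i a)).osc z) =
      F (a.val + 1) -
      F a.val := by
    intro a
    rw [Matrix.mulVec_smul, cartanP_mulVec_osc_vertexLambda hp hdet (topWeight i a).2
      (by have := i.2; omega), smul_sub, smul_smul, smul_smul, ← zpow_natCast, ← zpow_natCast,
      ← zpow_add₀ hP, ← zpow_add₀ hP]
    simp only [topWeight, F]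
    congr 2
    · congr 1; push_cast; ring
    · congr 1; push_cast; ring
  rw [Finset.sum_congr rfl fun a _ => h1 a,
    Fin.sum_univ_eq_sum_range (fun a => F (a + 1) - F a) (i.val + 1), Finset.sum_range_sub]
  have h0 : stdVec N 0 = 0 := by funext j; simp [stdVec]
  simp [F, h0]

theorem newIndices_self {r : ℕ} (l : Fin r → Fin N) : newIndices l l = ∅ :=
  Finset.filter_false_of_mem fun a _ h => h a rfl

/-- The difference of the inner products of the exponents of `Y_l` and `Y_m` and of the highest
weight fields. -/
theorem osc_vertexWeight_dotProduct_sub (hp : q * t⁻¹ ≠ 0) {z : ℤ}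
    (hdet : IsUnit (cartanP N ((q * t⁻¹) ^ z)).det) (i : Fin (N - 1))
    {l m : Fin (i.val + 1) → Fin N} (hm : m ∈ weights N (i.val + 1)) :
    dotProduct ((vertexWeight N q t l).osc z)
      ((cartanP N ((q * t⁻¹) ^ z)).mulVec ((vertexWeight N q t m).osc (-z))) -
      (cartanP N ((q * t⁻¹) ^ z))⁻¹ i i =
      -∑ a ∈ newIndices l m, ((q * t⁻¹) ^ z) ^ contractionExponent l m a := by
  have hN : 2 ≤ N := by have := i.2; omega
  have hC : cartanP N ((q * t⁻¹) ^ (-z)) = cartanP N ((q * t⁻¹) ^ z) := by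
    rw [zpow_neg, cartanP_inv]
  have h1 : (cartanP N ((q * t⁻¹) ^ z))⁻¹ i i =
      dotProduct ((vertexWeight N q t (topWeight i)).osc z)
        ((cartanP N ((q * t⁻¹) ^ z)).mulVec ((vertexWeight N q t (topWeight i)).osc (-z))) := by
    have h2 := cartanP_mulVec_osc_topWeight hp (z := -z) (by rwa [hC]) i
    rw [hC] at h2
    rw [h2, dotProduct_stdVec]
    have h3 : (cartanP N ((q * t⁻¹) ^ z))⁻¹.mulVec ((cartanP N ((q * t⁻¹) ^ z)).mulVec
        ((vertexWeight N q t (topWeight i)).osc z)) =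
        (cartanP N ((q * t⁻¹) ^ z))⁻¹.mulVec (stdVec N (i.val + 1)) := by
      rw [cartanP_mulVec_osc_topWeight hp hdet i]
    rw [Matrix.mulVec_mulVec, Matrix.nonsing_inv_mul _ hdet, Matrix.one_mulVec] at h3
    rw [h3, stdVec_succ, Matrix.mulVec_single_one]
    rfl
  rw [h1, osc_vertexWeight_dotProduct hp hdet hN hm,
    osc_vertexWeight_dotProduct hp hdet hN (topWeight_mem i), newIndices_self, Finset.sum_empty]
  ring

theorem contraction_eq (U V : VertexOp N) (m : ℕ) :
    U.contraction q t V m = (m : ℂ)⁻¹ * (q ^ m - (q ^ m)⁻¹) * (t ^ m - (t ^ m)⁻¹) *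
      dotProduct (U.osc m) ((cartanP N ((q * t⁻¹) ^ (m : ℤ))).mulVec (V.osc (-m))) := by
  simp only [VertexOp.contraction, bracket, add_neg_cancel, if_true, defCartan_zpow]
  simp only [dotProduct, Matrix.mulVec, Finset.mul_sum, zpow_neg, zpow_natCast, Int.cast_natCast]
  refine Finset.sum_congr rfl fun i _ => Finset.sum_congr rfl fun j _ => ?_
  ring

theorem expCoeff_congr {A : Type*} [Ring A] [Algebra ℂ A] {u v : ℕ → A}
    (h : ∀ m, 0 < m → u m = v m) : expCoeff u = expCoeff v := by
  funext b
  have : posSeries u = posSeries v := by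
    ext m
    rw [coeff_posSeries, coeff_posSeries]
    split_ifs with h0
    · rfl
    · exact h m (Nat.pos_of_ne_zero h0)
  rw [expCoeff_def, expCoeff_def, this]

/-- The corrected contraction of `Y_l` and `Y_m` in exponential form. -/
theorem correctedContraction_eq (hq : q ≠ 0) (ht : t ≠ 0)
    (hdet : ∀ m : ℕ, 0 < m → IsUnit (cartanP N ((q * t⁻¹) ^ (m : ℤ))).det) (i : Fin (N - 1))
    {l m : Fin (i.val + 1) → Fin N} (hm : m ∈ weights N (i.val + 1)) :
    VertexOp.correctedContraction q t (fCoeff N q t i) (vertexWeight N q t l)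
      (vertexWeight N q t m) =
    expCoeff fun n : ℕ => ∑ a ∈ newIndices l m,
      (((q * t⁻¹) ^ (contractionExponent l m a + 1)) ^ n / n +
        ((q * t⁻¹) ^ (contractionExponent l m a - 1)) ^ n / n +
        (-((q * t * (q * t⁻¹) ^ contractionExponent l m a) ^ n / n) +
        -(((q * t)⁻¹ * (q * t⁻¹) ^ contractionExponent l m a) ^ n / n))) := by
  have hp : q * t⁻¹ ≠ 0 := mul_ne_zero hq (inv_ne_zero ht)
  let u : ℕ → ℂ := fun m => -((q ^ m - (q ^ m)⁻¹) * (t ^ m - (t ^ m)⁻¹) *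
    (defCartan N (q ^ m) (t ^ m))⁻¹ i i / (m : ℂ))
  let v : ℕ → ℂ := (vertexWeight N q t l).contraction q t (vertexWeight N q t m)
  have h1 : VertexOp.correctedContraction q t (fCoeff N q t i) (vertexWeight N q t l)
      (vertexWeight N q t m) = expCoeff (u + v) := by
    funext s
    have h2 := congrArg (PowerSeries.coeff s) (expSeries_add (u := u) (v := v)
      (fun _ _ _ _ => Commute.all _ _) (fun _ _ _ _ => Commute.all _ _)
      (fun _ _ _ _ => Commute.all _ _))
    rw [coeff_expSeries, PowerSeries.coeff_mul,
      Finset.Nat.sum_antidiagonal_eq_sum_range_succ_mk] at h2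
    rw [h2]
    simp only [coeff_expSeries]
    rfl
  rw [h1]
  refine expCoeff_congr fun n hn => ?_
  have hn0 : (n : ℂ) ≠ 0 := by exact_mod_cast hn.ne'
  have h3 := osc_vertexWeight_dotProduct_sub hp (hdet n hn) i (l := l) hm
  have h4 : defCartan N (q ^ n) (t ^ n) = cartanP N ((q * t⁻¹) ^ (n : ℤ)) := by
    rw [← defCartan_zpow, zpow_natCast, zpow_natCast]
  have h5 : (u + v) n = (n : ℂ)⁻¹ * (q ^ n - (q ^ n)⁻¹) * (t ^ n - (t ^ n)⁻¹) *
      -∑ a ∈ newIndices l m, ((q * t⁻¹) ^ (n : ℤ)) ^ contractionExponent l m a := by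
    rw [← h3, Pi.add_apply]
    simp only [u, v, contraction_eq, h4]
    field_simp
    ring
  rw [h5, ← Finset.sum_neg_distrib, Finset.mul_sum]
  refine Finset.sum_congr rfl fun a _ => ?_
  generalize contractionExponent l m a = s
  have e0 : ((q * t⁻¹) ^ (n : ℤ)) ^ s = ((q * t⁻¹) ^ s) ^ n := by
    rw [← zpow_mul, mul_comm (n : ℤ) s, zpow_mul, zpow_natCast]
  rw [e0, zpow_add_one₀ hp, zpow_sub_one₀ hp]
  simp only [mul_pow, inv_pow, mul_inv, inv_inv]
  have hqn : q ^ n ≠ 0 := pow_ne_zero _ hq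
  have htn : t ^ n ≠ 0 := pow_ne_zero _ ht
  generalize ((q * t⁻¹) ^ s) ^ n = X
  field_simp
  ring

/-! ### Convergence of the corrected contractions -/

/-- `∑ c r x ^ r` converges absolutely to `R x` for small `x`. -/
def ConvergesTo (c : ℕ → ℂ) (R : ℂ → ℂ) : Prop :=
  ∃ δ : ℝ, 0 < δ ∧ ∀ x : ℂ, ‖x‖ < δ →
    (Summable fun r => ‖c r * x ^ r‖) ∧ HasSum (fun r => c r * x ^ r) (R x)

theorem ConvergesTo.expCoeff_add {u v : ℕ → ℂ} {R S : ℂ → ℂ} (hu : ConvergesTo (expCoeff u) R)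
    (hv : ConvergesTo (expCoeff v) S) :
    ConvergesTo (expCoeff (u + v)) fun x => R x * S x := by
  obtain ⟨δ, hδ, h⟩ := hu
  obtain ⟨ε, hε, h'⟩ := hv
  refine ⟨min δ ε, lt_min hδ hε, fun x hx => ?_⟩
  obtain ⟨h1, h2⟩ := h x (hx.trans_le (min_le_left _ _))
  obtain ⟨h3, h4⟩ := h' x (hx.trans_le (min_le_right _ _))
  have hc : ∀ r, expCoeff (u + v) r * x ^ r = ∑ y ∈ Finset.HasAntidiagonal.antidiagonal r,
      expCoeff u y.1 * x ^ y.1 * (expCoeff v y.2 * x ^ y.2) := by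
    intro r
    have h5 := congrArg (PowerSeries.coeff r) (expSeries_add (u := u) (v := v)
      (fun _ _ _ _ => Commute.all _ _) (fun _ _ _ _ => Commute.all _ _)
      (fun _ _ _ _ => Commute.all _ _))
    rw [coeff_expSeries, PowerSeries.coeff_mul] at h5
    rw [h5, Finset.sum_mul]
    refine Finset.sum_congr rfl fun y hy => ?_
    rw [← Finset.HasAntidiagonal.mem_antidiagonal.1 hy, pow_add, coeff_expSeries, coeff_expSeries]
    ring
  have h6 := summable_norm_sum_mul_antidiagonal_of_summable_norm h1 h3
  simp only [hc]
  refine ⟨h6, ?_⟩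
  rw [← h2.tsum_eq, ← h4.tsum_eq, tsum_mul_tsum_eq_tsum_sum_antidiagonal_of_summable_norm h1 h3]
  exact h6.of_norm.hasSum

theorem ConvergesTo.expCoeff_zero : ConvergesTo (expCoeff (0 : ℕ → ℂ)) fun _ => 1 := by
  refine ⟨1, one_pos, fun x _ => ?_⟩
  have h : ∀ r, expCoeff (0 : ℕ → ℂ) r * x ^ r = if r = 0 then 1 else 0 := fun r => by
    rw [expCoeff_zero_fun (u := 0) fun _ _ => rfl]
    split_ifs with h <;> simp [h]
  simp only [h]
  have h2 : ∀ r, ‖(if r = 0 then (1 : ℂ) else 0)‖ = if r = 0 then 1 else 0 := fun r => by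
    split_ifs <;> simp
  simp only [h2]
  exact ⟨(hasSum_ite_eq 0 (1 : ℝ)).summable, hasSum_ite_eq 0 (1 : ℂ)⟩

theorem ConvergesTo.expCoeff_sum {ι : Type*} (s : Finset ι) {u : ι → ℕ → ℂ} {R : ι → ℂ → ℂ}
    (h : ∀ a ∈ s, ConvergesTo (expCoeff (u a)) (R a)) :
    ConvergesTo (expCoeff (∑ a ∈ s, u a)) fun x => ∏ a ∈ s, R a x := by
  classical
  induction s using Finset.induction_on with
  | empty => simpa using ConvergesTo.expCoeff_zero
  | insert a s ha ih =>
    simp only [Finset.sum_insert ha, Finset.prod_insert ha]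
    exact (h a (Finset.mem_insert_self a s)).expCoeff_add
      (ih fun b hb => h b (Finset.mem_insert_of_mem hb))

theorem expSeries_geometric (α : ℂ) :
    expSeries (fun n : ℕ => α ^ n / n) = PowerSeries.mk fun n => α ^ n := by
  refine eq_of_euler_eq (w := euler (posSeries fun n : ℕ => α ^ n / n)) (coeff_zero_euler _)
    (euler_expSeries fun _ _ _ _ => Commute.all _ _) ?_ (by simp)
  ext n
  rw [coeff_euler, PowerSeries.coeff_mk, PowerSeries.coeff_mul,
    Finset.Nat.sum_antidiagonal_eq_sum_range_succ_mk, Finset.sum_range_succ']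
  have h : ∀ i ∈ Finset.range n, PowerSeries.coeff (i + 1)
      (euler (posSeries fun n : ℕ => α ^ n / n)) *
        PowerSeries.coeff (n - (i + 1)) (PowerSeries.mk fun n => α ^ n) = α ^ n := by
    intro i hi
    rw [Finset.mem_range] at hi
    rw [coeff_euler, coeff_posSeries, if_neg (Nat.succ_ne_zero i), PowerSeries.coeff_mk,
      mul_div_cancel₀ _ (by exact_mod_cast Nat.succ_ne_zero i), ← pow_add]
    congr 1
    omega
  simp only
  rw [Finset.sum_congr rfl h]
  simp

theorem ConvergesTo.geometric (α : ℂ) :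
    ConvergesTo (expCoeff fun n : ℕ => α ^ n / n) fun x => (1 - α * x)⁻¹ := by
  refine ⟨(‖α‖ + 1)⁻¹, by positivity, fun x hx => ?_⟩
  have h : ∀ r, expCoeff (fun n : ℕ => α ^ n / n) r * x ^ r = (α * x) ^ r := fun r => by
    rw [← coeff_expSeries, expSeries_geometric, PowerSeries.coeff_mk, mul_pow]
  have hlt : ‖α * x‖ < 1 := by
    have h1 : 0 < ‖α‖ + 1 := by positivity
    calc ‖α * x‖ = ‖α‖ * ‖x‖ := norm_mul _ _
      _ ≤ ‖α‖ * (‖α‖ + 1)⁻¹ := mul_le_mul_of_nonneg_left hx.le (norm_nonneg _)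
      _ < (‖α‖ + 1) * (‖α‖ + 1)⁻¹ := mul_lt_mul_of_pos_right (lt_add_one _) (inv_pos.2 h1)
      _ = 1 := mul_inv_cancel₀ h1.ne'
  simp only [h]
  exact ⟨summable_norm_geometric_of_norm_lt_one hlt, hasSum_geometric_of_norm_lt_one hlt⟩

theorem ConvergesTo.linear (α : ℂ) :
    ConvergesTo (expCoeff fun n : ℕ => -(α ^ n / n)) fun x => 1 - α * x := by
  refine ⟨1, one_pos, fun x _ => ?_⟩
  have h1 : expSeries (fun n : ℕ => -(α ^ n / n)) = 1 - PowerSeries.C α * PowerSeries.X := by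
    have h2 := expSeries_add (u := fun n : ℕ => α ^ n / (n : ℂ))
      (v := fun n : ℕ => -(α ^ n / (n : ℂ)))
      (fun _ _ _ _ => Commute.all _ _) (fun _ _ _ _ => Commute.all _ _)
      (fun _ _ _ _ => Commute.all _ _)
    have h3 : expSeries ((fun n : ℕ => α ^ n / (n : ℂ)) + fun n : ℕ => -(α ^ n / (n : ℂ))) = 1 := by
      ext r
      rw [coeff_expSeries, expCoeff_zero_fun fun m _ => by simp, PowerSeries.coeff_one]
    have h4 : (1 - PowerSeries.C α * PowerSeries.X) * PowerSeries.mk (fun n => α ^ n) = 1 := by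
      ext n
      rw [sub_mul, one_mul, map_sub, mul_assoc, PowerSeries.coeff_C_mul, PowerSeries.coeff_mk]
      cases n with
      | zero => simp
      | succ n => rw [PowerSeries.coeff_succ_X_mul, PowerSeries.coeff_mk, PowerSeries.coeff_one,
          if_neg (Nat.succ_ne_zero n)]; ring
    rw [h3, expSeries_geometric] at h2
    calc expSeries (fun n : ℕ => -(α ^ n / (n : ℂ)))
        = ((1 - PowerSeries.C α * PowerSeries.X) * PowerSeries.mk (fun n => α ^ n)) *
          expSeries (fun n : ℕ => -(α ^ n / (n : ℂ))) := by rw [h4, one_mul]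
      _ = 1 - PowerSeries.C α * PowerSeries.X := by rw [mul_assoc, ← h2, mul_one]
  have h5 : ∀ r, r ∉ Finset.range 2 → expCoeff (fun n : ℕ => -(α ^ n / (n : ℂ))) r * x ^ r = 0 := by
    intro r hr
    rw [Finset.mem_range, not_lt] at hr
    rw [← coeff_expSeries, h1, map_sub, PowerSeries.coeff_C_mul, PowerSeries.coeff_X,
      PowerSeries.coeff_one, if_neg (by omega), if_neg (by omega)]
    simp
  have h6 : HasSum _ _ := hasSum_sum_of_ne_finset_zero h5
  have h7 : HasSum (fun r => ‖expCoeff (fun n : ℕ => -(α ^ n / (n : ℂ))) r * x ^ r‖) _ :=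
    hasSum_sum_of_ne_finset_zero (s := Finset.range 2) fun r hr => by rw [h5 r hr, norm_zero]
  refine ⟨h7.summable, ?_⟩
  rw [Finset.sum_range_succ, Finset.sum_range_one, ← coeff_expSeries, ← coeff_expSeries, h1] at h6
  simpa [PowerSeries.coeff_X, PowerSeries.coeff_one, sub_eq_add_neg] using h6

/-- The corrected contraction of `Y_l` and `Y_m` as a rational function. -/
def contractionFun (q t : ℂ) {r : ℕ} (l m : Fin r → Fin N) (x : ℂ) : ℂ :=
  ∏ a ∈ newIndices l m, ((1 - (q * t⁻¹) ^ (contractionExponent l m a + 1) * x)⁻¹ *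
    (1 - (q * t⁻¹) ^ (contractionExponent l m a - 1) * x)⁻¹ *
    ((1 - q * t * (q * t⁻¹) ^ contractionExponent l m a * x) *
      (1 - (q * t)⁻¹ * (q * t⁻¹) ^ contractionExponent l m a * x)))

theorem convergesTo_contractionFun (hq : q ≠ 0) (ht : t ≠ 0)
    (hdet : ∀ m : ℕ, 0 < m → IsUnit (cartanP N ((q * t⁻¹) ^ (m : ℤ))).det) (i : Fin (N - 1))
    {l m : Fin (i.val + 1) → Fin N} (hm : m ∈ weights N (i.val + 1)) :
    ConvergesTo (VertexOp.correctedContraction q t (fCoeff N q t i) (vertexWeight N q t l)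
      (vertexWeight N q t m)) (contractionFun q t l m) := by
  rw [correctedContraction_eq hq ht hdet i hm]
  have h := ConvergesTo.expCoeff_sum (newIndices l m) fun a _ =>
    ((ConvergesTo.geometric ((q * t⁻¹) ^ (contractionExponent l m a + 1))).expCoeff_add
      (ConvergesTo.geometric ((q * t⁻¹) ^ (contractionExponent l m a - 1)))).expCoeff_add
    ((ConvergesTo.linear (q * t * (q * t⁻¹) ^ contractionExponent l m a)).expCoeff_add
      (ConvergesTo.linear ((q * t)⁻¹ * (q * t⁻¹) ^ contractionExponent l m a)))
  convert h using 2
  · funext n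
    simp only [Finset.sum_apply, Pi.add_apply]
  · rfl

theorem hasSum_fin_prod : ∀ {n : ℕ} {f : Fin n → ℕ → ℂ} {S : Fin n → ℂ},
    (∀ x, Summable fun r => ‖f x r‖) → (∀ x, HasSum (f x) (S x)) →
    (Summable fun e : Fin n → ℕ => ‖∏ x, f x (e x)‖) ∧
      HasSum (fun e : Fin n → ℕ => ∏ x, f x (e x)) (∏ x, S x)
  | 0, f, S, _, _ => by
    have h2 : HasSum (fun e : Fin 0 → ℕ => ‖∏ x, f x (e x)‖) _ :=
      hasSum_fintype _
    exact ⟨h2.summable, by simp⟩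
  | n + 1, f, S, hs, h => by
    obtain ⟨h1, h2⟩ := hasSum_fin_prod (fun x : Fin n => hs x.succ) fun x => h x.succ
    have h3 := Summable.mul_norm (hs 0) h1
    have h4 := (h 0).mul h2 h3.of_norm
    have e1 : ∀ y : ℕ × (Fin n → ℕ), ∏ x, f x ((Fin.consEquiv fun _ => ℕ) y x) =
        f 0 y.1 * ∏ x : Fin n, f x.succ (y.2 x) := fun y => by
      rw [Fin.prod_univ_succ]; simp [Fin.consEquiv]
    rw [← (Fin.consEquiv fun _ => ℕ).hasSum_iff, ← (Fin.consEquiv fun _ => ℕ).summable_iff]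
    simp only [Function.comp_def, e1]
    rw [Fin.prod_univ_succ]
    exact ⟨h3, h4⟩

/-- Products of finitely many absolutely convergent series. -/
theorem hasSum_pi_prod {ι : Type*} [Fintype ι] {f : ι → ℕ → ℂ} {S : ι → ℂ}
    (hs : ∀ x, Summable fun r => ‖f x r‖) (h : ∀ x, HasSum (f x) (S x)) :
    (Summable fun e : ι → ℕ => ‖∏ x, f x (e x)‖) ∧
      HasSum (fun e : ι → ℕ => ∏ x, f x (e x)) (∏ x, S x) := by
  obtain ⟨n, ⟨E⟩⟩ : ∃ n, Nonempty (ι ≃ Fin n) := ⟨_, ⟨Fintype.equivFin ι⟩⟩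
  obtain ⟨h1, h2⟩ := hasSum_fin_prod (f := fun j => f (E.symm j)) (S := fun j => S (E.symm j))
    (fun j => hs _) (fun j => h _)
  have e1 : ∀ e : Fin n → ℕ, ∏ x, f x ((Equiv.arrowCongr E.symm (Equiv.refl ℕ)) e x) =
      ∏ j, f (E.symm j) (e j) := fun e => by
    rw [← E.symm.prod_comp]
    simp
  rw [← E.symm.prod_comp S, ← (Equiv.arrowCongr E.symm (Equiv.refl ℕ)).hasSum_iff,
    ← (Equiv.arrowCongr E.symm (Equiv.refl ℕ)).summable_iff]
  exact ⟨h1.congr fun e => congrArg norm (e1 e).symm, h2.congr_fun fun e => e1 e⟩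

/-! ### Rational functions and analytic continuation -/

section Rational

variable {k : ℕ}

/-- The region `|z_1| ≫ ⋯ ≫ |z_k| > 0`. -/
def radialRegion (k : ℕ) (δ : ℝ) : Set (Fin k → ℂ) :=
  {z | (∀ m, z m ≠ 0) ∧ ∀ m n, m < n → ‖z n‖ < δ * ‖z m‖}

theorem radialRegion_mono {δ ε : ℝ} (h : δ ≤ ε) : radialRegion k δ ⊆ radialRegion k ε :=
  fun _ hz => ⟨hz.1, fun m n hmn =>
    (hz.2 m n hmn).trans_le (mul_le_mul_of_nonneg_right h (norm_nonneg _))⟩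

/-- `f` is given by a rational function whose denominator vanishes neither at `w` nor in the region
`|z_1| ≫ ⋯ ≫ |z_k| > 0`. -/
def IsRational (w : Fin k → ℂ) (f : (Fin k → ℂ) → ℂ) : Prop :=
  ∃ P Q : MvPolynomial (Fin k) ℂ, ∃ δ : ℝ, 0 < δ ∧ ∀ z, z ∈ radialRegion k δ ∨ z = w →
    MvPolynomial.eval z Q ≠ 0 ∧ f z = MvPolynomial.eval z P / MvPolynomial.eval z Q

variable {w : Fin k → ℂ}

theorem IsRational.const (c : ℂ) : IsRational w fun _ => c :=
  ⟨MvPolynomial.C c, 1, 1, one_pos, fun z _ => by simp⟩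

theorem IsRational.mul {f g : (Fin k → ℂ) → ℂ} (hf : IsRational w f) (hg : IsRational w g) :
    IsRational w fun z => f z * g z := by
  obtain ⟨P, Q, δ, hδ, h⟩ := hf
  obtain ⟨P', Q', ε, hε, h'⟩ := hg
  refine ⟨P * P', Q * Q', min δ ε, lt_min hδ hε, fun z hz => ?_⟩
  obtain ⟨h1, h2⟩ := h z (hz.imp_left fun h => radialRegion_mono (min_le_left _ _) h)
  obtain ⟨h3, h4⟩ := h' z (hz.imp_left fun h => radialRegion_mono (min_le_right _ _) h)
  dsimp only
  rw [map_mul, map_mul, h2, h4]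
  exact ⟨mul_ne_zero h1 h3, div_mul_div_comm _ _ _ _⟩

theorem IsRational.add {f g : (Fin k → ℂ) → ℂ} (hf : IsRational w f) (hg : IsRational w g) :
    IsRational w fun z => f z + g z := by
  obtain ⟨P, Q, δ, hδ, h⟩ := hf
  obtain ⟨P', Q', ε, hε, h'⟩ := hg
  refine ⟨P * Q' + Q * P', Q * Q', min δ ε, lt_min hδ hε, fun z hz => ?_⟩
  obtain ⟨h1, h2⟩ := h z (hz.imp_left fun h => radialRegion_mono (min_le_left _ _) h)
  obtain ⟨h3, h4⟩ := h' z (hz.imp_left fun h => radialRegion_mono (min_le_right _ _) h)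
  dsimp only
  rw [map_mul, map_add, map_mul, map_mul, h2, h4]
  exact ⟨mul_ne_zero h1 h3, div_add_div _ _ h1 h3⟩

theorem IsRational.sum {ι : Type*} (s : Finset ι) {f : ι → (Fin k → ℂ) → ℂ}
    (h : ∀ a ∈ s, IsRational w (f a)) : IsRational w fun z => ∑ a ∈ s, f a z := by
  classical
  induction s using Finset.induction_on with
  | empty => simpa using IsRational.const 0
  | insert a s ha ih =>
    simp only [Finset.sum_insert ha]
    exact (h a (Finset.mem_insert_self a s)).add (ih fun b hb => h b (Finset.mem_insert_of_mem hb))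

theorem IsRational.prod {ι : Type*} (s : Finset ι) {f : ι → (Fin k → ℂ) → ℂ}
    (h : ∀ a ∈ s, IsRational w (f a)) : IsRational w fun z => ∏ a ∈ s, f a z := by
  classical
  induction s using Finset.induction_on with
  | empty => simpa using IsRational.const 1
  | insert a s ha ih =>
    simp only [Finset.prod_insert ha]
    exact (h a (Finset.mem_insert_self a s)).mul (ih fun b hb => h b (Finset.mem_insert_of_mem hb))

theorem IsRational.coord (j : Fin k) : IsRational w fun z => z j :=
  ⟨MvPolynomial.X j, 1, 1, one_pos, fun z _ => by simp⟩

theorem IsRational.coord_inv (hw : ∀ j, w j ≠ 0) (j : Fin k) : IsRational w fun z => (z j)⁻¹ := by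
  refine ⟨1, MvPolynomial.X j, 1, one_pos, fun z hz => ?_⟩
  have h : z j ≠ 0 := by
    rcases hz with hz | rfl
    · exact hz.1 j
    · exact hw j
  simpa using h

theorem IsRational.pow {f : (Fin k → ℂ) → ℂ} (hf : IsRational w f) (n : ℕ) :
    IsRational w fun z => f z ^ n := by
  induction n with
  | zero => simpa using IsRational.const 1
  | succ n ih =>
    simp only [pow_succ]
    exact ih.mul hf

theorem IsRational.coord_zpow (hw : ∀ j, w j ≠ 0) (j : Fin k) (n : ℤ) :
    IsRational w fun z => z j ^ n := by
  obtain ⟨m, rfl | rfl⟩ := n.eq_nat_or_neg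
  · simpa using (IsRational.coord j).pow m
  · simpa using (IsRational.coord_inv hw j).pow m

theorem IsRational.one_sub_ratio (hw : ∀ j, w j ≠ 0) (α : ℂ) (x : Pairs k) :
    IsRational w fun z => 1 - α * (z x.1.2 / z x.1.1) := by
  have h := (IsRational.const 1).add ((IsRational.const (-α)).mul
    ((IsRational.coord x.1.2).mul (IsRational.coord_inv hw x.1.1)))
  simpa [sub_eq_add_neg, div_eq_mul_inv] using h

theorem IsRational.one_sub_ratio_inv (hw : ∀ j, w j ≠ 0) {α : ℂ} {x : Pairs k}
    (hα : 1 - α * (w x.1.2 / w x.1.1) ≠ 0) :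
    IsRational w fun z => (1 - α * (z x.1.2 / z x.1.1))⁻¹ := by
  refine ⟨MvPolynomial.X x.1.1, MvPolynomial.X x.1.1 - MvPolynomial.C α * MvPolynomial.X x.1.2,
    (‖α‖ + 1)⁻¹, by positivity, fun z hz => ?_⟩
  have h1 : z x.1.1 ≠ 0 := by
    rcases hz with hz | rfl
    · exact hz.1 _
    · exact hw _
  have h2 : z x.1.1 - α * z x.1.2 = z x.1.1 * (1 - α * (z x.1.2 / z x.1.1)) := by
    field_simp
  have h3 : 1 - α * (z x.1.2 / z x.1.1) ≠ 0 := by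
    rcases hz with hz | rfl
    · intro h
      have h4 : z x.1.1 = α * z x.1.2 := by
        rw [← sub_eq_zero, h2, h, mul_zero]
      have h5 := hz.2 _ _ x.2
      have h6 : 0 < ‖α‖ + 1 := by positivity
      have h7 : ‖z x.1.1‖ = ‖α‖ * ‖z x.1.2‖ := by rw [← norm_mul, ← h4]
      have h8 : (‖α‖ + 1) * ‖z x.1.2‖ < ‖z x.1.1‖ := by
        rw [inv_mul_eq_div, lt_div_iff₀ h6] at h5
        linarith
      nlinarith [norm_nonneg (z x.1.2)]
    · exact hα
  simp only [map_sub, map_mul, MvPolynomial.eval_X, MvPolynomial.eval_C]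
  rw [h2]
  refine ⟨mul_ne_zero h1 h3, ?_⟩
  field_simp

theorem IsRational.hasContinuedLimit {f : (Fin k → ℂ) → ℂ} (hf : IsRational w f)
    {g : (Fin k → ℤ) → ℂ} {δ : ℝ} (hδ : 0 < δ)
    (h : ∀ z ∈ radialRegion k δ, HasSum (fun n => g n * ∏ m, z m ^ (-n m)) (f z)) :
    HasContinuedLimit g w (f w) := by
  obtain ⟨P, Q, ε, hε, h'⟩ := hf
  refine ⟨P, Q, ⟨min δ ε, lt_min hδ hε, fun z h1 h2 => ?_⟩, ?_⟩
  · have hz : z ∈ radialRegion k (min δ ε) := ⟨h1, h2⟩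
    obtain ⟨h3, h4⟩ := h' z (Or.inl (radialRegion_mono (min_le_right _ _) hz))
    exact ⟨h3, h4 ▸ h z (radialRegion_mono (min_le_left _ _) hz)⟩
  · obtain ⟨h3, h4⟩ := h' w (Or.inr rfl)
    rw [h4]
    exact (((MvPolynomial.continuous_eval P).tendsto w).div
      ((MvPolynomial.continuous_eval Q).tendsto w) h3).mono_left nhdsWithin_le_nhds

/-- A box inside the region `|z_1| ≫ ⋯ ≫ |z_k| > 0`. -/
theorem exists_pi_subset_radialRegion {δ : ℝ} (hδ : 0 < δ) :
    ∃ s : Fin k → Set ℂ, (∀ j, (s j).Infinite) ∧ Set.pi Set.univ s ⊆ radialRegion k δ := by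
  let η : ℝ := min δ 1 / 4
  have hη : 0 < η := by positivity
  have hη1 : η ≤ 1 / 4 := by
    have : min δ 1 ≤ 1 := min_le_right _ _
    simp only [η]; linarith
  have hηδ : 2 * η < δ := by
    have : min δ 1 ≤ δ := min_le_left _ _
    simp only [η]; linarith
  refine ⟨fun j => (fun x : ℝ => (x : ℂ)) '' Set.Icc (η ^ j.val) (2 * η ^ j.val), fun j => ?_, ?_⟩
  · refine Set.Infinite.image (Complex.ofReal_injective.injOn) (Set.Icc_infinite ?_)
    have : 0 < η ^ j.val := by positivity
    linarith
  · intro z hz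
    have hz' : ∀ j : Fin k, η ^ j.val ≤ ‖z j‖ ∧ ‖z j‖ ≤ 2 * η ^ j.val := fun j => by
      obtain ⟨x, hx, hxz⟩ := hz j (Set.mem_univ j)
      have : 0 < η ^ j.val := by positivity
      rw [← hxz, Complex.norm_real, Real.norm_of_nonneg (this.le.trans hx.1)]
      exact hx
    refine ⟨fun j => ?_, fun m n hmn => ?_⟩
    · have : 0 < η ^ j.val := by positivity
      exact norm_pos_iff.1 (this.trans_le (hz' j).1)
    · have h1 : η ^ n.val ≤ η ^ (m.val + 1) :=
        pow_le_pow_of_le_one hη.le (by linarith) hmn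
      have h2 : 0 < η ^ m.val := by positivity
      rw [pow_succ] at h1
      have h3 := (hz' n).2
      have h4 := (hz' m).1
      calc ‖z n‖ ≤ 2 * (η ^ m.val * η) := by linarith
        _ = (2 * η) * η ^ m.val := by ring
        _ < δ * η ^ m.val := mul_lt_mul_of_pos_right hηδ h2
        _ ≤ δ * ‖z m‖ := mul_le_mul_of_nonneg_left h4 hδ.le

theorem mem_closure_eval_ne_zero {R : MvPolynomial (Fin k) ℂ} (hR : R ≠ 0) (w : Fin k → ℂ) :
    w ∈ closure {z | MvPolynomial.eval z R ≠ 0} := by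
  by_contra h
  rw [mem_closure_iff_nhds] at h
  push Not at h
  obtain ⟨U, hU, hU0⟩ := h
  obtain ⟨ε, hε, hεU⟩ := Metric.mem_nhds_iff.1 hU
  refine hR (MvPolynomial.funext_set (fun j => Metric.ball (w j) ε) (fun j => ?_) fun z hz => ?_)
  · exact infinite_of_mem_nhds (w j) (Metric.ball_mem_nhds _ hε)
  · rw [map_zero]
    by_contra hne
    have : z ∈ U ∩ {z | MvPolynomial.eval z R ≠ 0} := ⟨hεU ?_, hne⟩
    · rw [hU0] at this
      exact this
    · rw [ball_pi _ hε]
      exact hz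

theorem HasContinuedLimit.unique {g : (Fin k → ℤ) → ℂ} {c c' : ℂ}
    (h : HasContinuedLimit g w c) (h' : HasContinuedLimit g w c') : c = c' := by
  obtain ⟨P, Q, ⟨δ, hδ, h1⟩, h2⟩ := h
  obtain ⟨P', Q', ⟨ε, hε, h3⟩, h4⟩ := h'
  obtain ⟨s, hs, hsub⟩ := exists_pi_subset_radialRegion (k := k) (lt_min hδ hε)
  have hreg : ∀ z ∈ Set.pi Set.univ s, MvPolynomial.eval z Q ≠ 0 ∧ MvPolynomial.eval z Q' ≠ 0 ∧
      MvPolynomial.eval z P / MvPolynomial.eval z Q =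
        MvPolynomial.eval z P' / MvPolynomial.eval z Q' := by
    intro z hz
    have hz1 := radialRegion_mono (min_le_left _ _) (hsub hz)
    have hz2 := radialRegion_mono (min_le_right _ _) (hsub hz)
    obtain ⟨h5, h6⟩ := h1 z hz1.1 hz1.2
    obtain ⟨h7, h8⟩ := h3 z hz2.1 hz2.2
    exact ⟨h5, h7, h6.unique h8⟩
  have hPQ : P * Q' = P' * Q := by
    refine MvPolynomial.funext_set s hs fun z hz => ?_
    obtain ⟨h5, h6, h7⟩ := hreg z hz
    rw [map_mul, map_mul]
    exact (div_eq_div_iff h5 h6).1 h7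
  obtain ⟨z, hz⟩ : (Set.pi Set.univ s).Nonempty :=
    Set.univ_pi_nonempty_iff.2 fun j => (hs j).nonempty
  have hne : Q * Q' ≠ 0 := by
    intro h0
    have := congrArg (MvPolynomial.eval z) h0
    rw [map_mul, map_zero] at this
    exact mul_ne_zero (hreg z hz).1 (hreg z hz).2.1 this
  let D := {z | MvPolynomial.eval z (Q * Q') ≠ 0}
  have hD : ∀ z ∈ D, MvPolynomial.eval z Q ≠ 0 ∧ MvPolynomial.eval z Q' ≠ 0 := fun z hz => by
    simp only [D, Set.mem_ofPred_eq, map_mul] at hz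
    exact ⟨left_ne_zero_of_mul hz, right_ne_zero_of_mul hz⟩
  have : (𝓝[D] w).NeBot := mem_closure_iff_nhdsWithin_neBot.1 (mem_closure_eval_ne_zero hne w)
  have h5 := h2.mono_left (nhdsWithin_mono w fun z hz => (hD z hz).1)
  have h6 := h4.mono_left (nhdsWithin_mono w fun z hz => (hD z hz).2)
  refine tendsto_nhds_unique h5 (h6.congr' ?_)
  filter_upwards [self_mem_nhdsWithin] with z hz
  rw [div_eq_div_iff (hD z hz).2 (hD z hz).1, ← map_mul, ← map_mul, hPQ]

theorem hasContinuedLimit_zero : HasContinuedLimit (fun _ : Fin k → ℤ => (0 : ℂ)) w 0 := by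
  have h := (IsRational.const (w := w) 0).hasContinuedLimit (g := fun _ => 0) one_pos
    fun z _ => by simp
  exact h

end Rational

/-! ### Continuous linear functionals -/

theorem exists_posIdeal_le_ker (φ : CHeis N q t →L[ℂ] ℂ) :
    ∃ M, ∀ x ∈ posIdeal N q t M, φ (x : CHeis N q t) = 0 := by
  have h1 : Tendsto (fun x : Heis N q t => φ (x : CHeis N q t)) (𝓝 0) (𝓝 0) := by
    have h := (φ.continuous.comp (Completion.continuous_coe (Heis N q t))).tendsto 0
    rw [Function.comp_apply, coe_zero_heis, map_zero] at h
    exact h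
  obtain ⟨M, -, hM⟩ := (hasBasis_nhds_zero_heis N q t).mem_iff.1
    (h1 (Metric.ball_mem_nhds 0 one_pos))
  refine ⟨M, fun x hx => ?_⟩
  by_contra hne
  have h2 : (φ (x : CHeis N q t))⁻¹ • x ∈ posIdeal N q t M := by
    rw [Algebra.smul_def]; exact Ideal.mul_mem_left _ _ hx
  have h3 : φ (((φ (x : CHeis N q t))⁻¹ • x : Heis N q t) : CHeis N q t) ∈ Metric.ball (0 : ℂ) 1 :=
    hM h2
  rw [Completion.coe_smul, map_smul, smul_eq_mul, inv_mul_cancel₀ hne] at h3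
  simp at h3

/-- The canonical map to the completion as a linear map. -/
def coeLinear (N : ℕ) (q t : ℂ) : Heis N q t →ₗ[ℂ] CHeis N q t where
  toFun x := x
  map_add' x y := Completion.coe_add x y
  map_smul' c x := Completion.coe_smul c x

/-- Continuous linear functionals separate points from closed subspaces. -/
theorem exists_functional {W : Submodule ℂ (CHeis N q t)} (hW : IsClosed (W : Set (CHeis N q t)))
    {x : CHeis N q t} (hx : x ∉ W) :
    ∃ φ : CHeis N q t →L[ℂ] ℂ, (∀ y ∈ W, φ y = 0) ∧ φ x ≠ 0 := by
  have hbasis := (hasBasis_nhds_zero_heis N q t).hasBasis_of_isDenseInducing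
    (Completion.isDenseInducing_coe (α := Heis N q t))
  rw [coe_zero_heis] at hbasis
  have h1 : (fun y => x + y) ⁻¹' (W : Set (CHeis N q t))ᶜ ∈ 𝓝 (0 : CHeis N q t) :=
    (continuous_const.add continuous_id).continuousAt.preimage_mem_nhds
      (by simpa using hW.isOpen_compl.mem_nhds hx)
  obtain ⟨n, -, hn⟩ := hbasis.mem_iff.1 h1
  let J : Submodule ℂ (CHeis N q t) := (Submodule.map (coeLinear N q t)
    ((posIdeal N q t n).restrictScalars ℂ)).topologicalClosure
  have hJ : (J : Set (CHeis N q t)) =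
      closure ((fun x : Heis N q t => (x : CHeis N q t)) '' (posIdeal N q t n)) := rfl
  have hxJ : x ∉ W ⊔ J := by
    intro h
    obtain ⟨y, hy, z, hz, rfl⟩ := Submodule.mem_sup.1 h
    have h2 : -z ∈ (J : Set (CHeis N q t)) := J.neg_mem hz
    rw [hJ] at h2
    have h3 := hn h2
    simp only [Set.mem_preimage, add_neg_cancel_right] at h3
    exact h3 hy
  obtain ⟨f, hf, hf'⟩ := Submodule.exists_dual_map_eq_bot_of_notMem hxJ inferInstance
  have hf0 : ∀ y ∈ W ⊔ J, f y = 0 := fun y hy => by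
    have : f y ∈ (W ⊔ J).map f := Submodule.mem_map_of_mem hy
    rwa [hf', Submodule.mem_bot] at this
  refine ⟨⟨f, ?_⟩, fun y hy => hf0 y (Submodule.mem_sup_left hy), hf⟩
  refine continuous_of_continuousAt_zero f ?_
  have hJn : (J : Set (CHeis N q t)) ∈ 𝓝 (0 : CHeis N q t) := hbasis.mem_of_mem trivial
  have h4 : ∀ᶠ y in 𝓝 (0 : CHeis N q t), f y = f 0 := by
    filter_upwards [hJn] with y hy
    rw [map_zero]
    exact hf0 y (Submodule.mem_sup_right hy)
  exact (continuousAt_const (y := f 0)).congr (h4.mono fun y hy => hy.symm)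

/-- The value of a functional on the component of degree `d` of the coefficients of a normally
ordered product. -/
def normalFunctional (φ : CHeis N q t →L[ℂ] ℂ) {k : ℕ} (U : Fin k → VertexOp N) (d : ℤ)
    (n : Fin k → ℤ) : ℂ :=
  if ∑ j, n j = d then φ (normalMode q t U n) else 0

theorem finite_support_normalFunctional (φ : CHeis N q t →L[ℂ] ℂ) {k : ℕ} (U : Fin k → VertexOp N)
    (d : ℤ) : (Function.support (normalFunctional φ U d)).Finite := by
  obtain ⟨M, hM⟩ := exists_posIdeal_le_ker φ
  refine ((finite_degree_lt (k := k) d M).image Prod.fst).subset fun n hn => ?_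
  by_contra hcon
  refine hn ?_
  rw [normalFunctional]
  split_ifs with hd
  · have h1 := φ.hasSum (hasSum_normalMode (q := q) (t := t) U n)
    refine h1.unique ?_
    have h2 : ∀ a, φ (normalTerm q t U n a : CHeis N q t) = 0 := fun a => by
      refine hM _ (normalTerm_mem _ _ _ fun h3 h4 => ?_)
      by_contra h5
      exact hcon ⟨(n, a), ⟨h3, h4, hd, not_le.1 h5⟩, rfl⟩
    simp only [h2]
    exact hasSum_zero
  · rfl

theorem hasSum_normalFunctional (φ : CHeis N q t →L[ℂ] ℂ) {k : ℕ} (U : Fin k → VertexOp N)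
    (d : ℤ) {y : Fin k → ℂ} (hy : ∀ j, y j ≠ 0) :
    HasSum (fun n => normalFunctional φ U d n * ∏ j, y j ^ (-n j))
      (φ ((∏ j, (U j).shift (y j)).mode q t d)) := by
  refine (φ.hasSum (hasSum_mode_prod (q := q) (t := t) (fun j => (U j).shift (y j)) d)).congr_fun
    fun n => ?_
  rw [normalFunctional]
  split_ifs
  · rw [normalMode_shift U hy, map_smul, smul_eq_mul, mul_comm]
  · simp

theorem zpow_finsetSum {ι : Type*} {y : ℂ} (hy : y ≠ 0) (s : Finset ι) (f : ι → ℤ) :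
    y ^ (∑ x ∈ s, f x) = ∏ x ∈ s, y ^ f x := by
  classical
  induction s using Finset.induction_on with
  | empty => simp
  | insert a s ha ih => rw [Finset.sum_insert ha, Finset.prod_insert ha, zpow_add₀ hy, ih]

theorem prod_zpow_flow {k : ℕ} {y : Fin k → ℂ} (hy : ∀ j, y j ≠ 0) (e : Pairs k → ℕ) :
    ∏ j, y j ^ flow e j = ∏ x : Pairs k, (y x.1.2 / y x.1.1) ^ e x := by
  simp only [flow, Pi.sub_apply, zpow_sub₀ (hy _), inflow, outflow, zpow_finsetSum (hy _),
    Finset.prod_div_distrib, div_pow]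
  rw [Finset.prod_comm, Finset.prod_comm (s := Finset.univ (α := Fin k))]
  congr 1
  · refine Finset.prod_congr rfl fun x _ => ?_
    rw [Finset.prod_eq_single x.1.2]
    · simp
    · intro j _ hj
      rw [if_neg hj.symm, zpow_zero]
    · simp
  · refine Finset.prod_congr rfl fun x _ => ?_
    rw [Finset.prod_eq_single x.1.1]
    · simp
    · intro j _ hj
      rw [if_neg hj.symm, zpow_zero]
    · simp

/-- Summation of the series of matrix elements of a corrected product. -/
theorem hasSum_functional_corrected (φ : CHeis N q t →L[ℂ] ℂ) {k : ℕ} (U : Fin k → VertexOp N)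
    (d : ℤ) {y : Fin k → ℂ} (hy : ∀ j, y j ≠ 0) {c : Pairs k → ℕ → ℂ} {F : Pairs k → ℂ}
    (hc : ∀ x, (Summable fun r => ‖c x r * (y x.1.2 / y x.1.1) ^ r‖) ∧
      HasSum (fun r => c x r * (y x.1.2 / y x.1.1) ^ r) (F x))
    {S : (Fin k → ℤ) → CHeis N q t}
    (hS : ∀ n, HasSum (fun e : Pairs k → ℕ => (∏ x, c x (e x)) • normalMode q t U (n + flow e))
      (S n)) :
    HasSum (fun n : Fin k → ℤ => (if ∑ j, n j = d then φ (S n) else 0) * ∏ j, y j ^ (-n j))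
      ((∏ x, F x) * φ ((∏ j, (U j).shift (y j)).mode q t d)) := by
  obtain ⟨h1, h2⟩ := hasSum_pi_prod (fun x => (hc x).1) fun x => (hc x).2
  have h3 := hasSum_normalFunctional φ U d hy
  have h4 : Summable fun n => ‖normalFunctional φ U d n * ∏ j, y j ^ (-n j)‖ := by
    refine summable_of_hasFiniteSupport ((finite_support_normalFunctional φ U d).subset
      fun n hn => ?_)
    intro h
    exact hn (by simp [h])
  have h5 := h2.mul h3 (Summable.mul_norm h1 h4).of_norm
  let E : (Fin k → ℤ) × (Pairs k → ℕ) ≃ (Pairs k → ℕ) × (Fin k → ℤ) :=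
    { toFun := fun y => (y.2, y.1 + flow y.2)
      invFun := fun y => (y.2 - flow y.1, y.1)
      left_inv := fun y => by simp
      right_inv := fun y => by simp }
  rw [← E.hasSum_iff] at h5
  refine h5.prod_fiberwise fun n => ?_
  have h6 : ∀ e : Pairs k → ℕ, (∏ x, c x (e x) * (y x.1.2 / y x.1.1) ^ e x) *
      (normalFunctional φ U d (n + flow e) * ∏ j, y j ^ (-(n + flow e) j)) =
      (if ∑ j, n j = d then φ ((∏ x, c x (e x)) • normalMode q t U (n + flow e)) else 0) *
        ∏ j, y j ^ (-n j) := by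
    intro e
    have h7 : ∏ j, y j ^ (-(n + flow e) j) = (∏ j, y j ^ (-n j)) * (∏ j, y j ^ flow e j)⁻¹ := by
      rw [← Finset.prod_inv_distrib, ← Finset.prod_mul_distrib]
      refine Finset.prod_congr rfl fun j _ => ?_
      rw [← zpow_neg, ← zpow_add₀ (hy j), Pi.add_apply, neg_add]
    have h8 : ∏ j, y j ^ flow e j ≠ 0 := Finset.prod_ne_zero_iff.2 fun j _ => zpow_ne_zero _ (hy j)
    have h9 : ∑ j, (n + flow e) j = ∑ j, n j := by
      simp only [Pi.add_apply, Finset.sum_add_distrib, sum_flow, add_zero]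
    rw [Finset.prod_mul_distrib, ← prod_zpow_flow hy, h7, normalFunctional, h9]
    split_ifs
    · rw [map_smul, smul_eq_mul]
      field_simp
    · simp
  have h10 : HasSum (fun e : Pairs k → ℕ => (if ∑ j, n j = d then
      φ ((∏ x, c x (e x)) • normalMode q t U (n + flow e)) else 0) * ∏ j, y j ^ (-n j))
      ((if ∑ j, n j = d then φ (S n) else 0) * ∏ j, y j ^ (-n j)) := by
    split_ifs
    · exact (φ.hasSum (hS n)).mul_right _
    · simp only [zero_mul]
      exact hasSum_zero
  exact h10.congr_fun fun e => h6 e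

/-! ### The limit -/

theorem isRational_contractionFun {k : ℕ} {w : Fin k → ℂ} (hw : ∀ j, w j ≠ 0) {r : ℕ}
    (l m : Fin r → Fin N) (x : Pairs k)
    (h : ∀ s : ℤ, 1 - (q * t⁻¹) ^ (2 * s) * (w x.1.2 / w x.1.1) ≠ 0) :
    IsRational w fun z => contractionFun q t l m (z x.1.2 / z x.1.1) := by
  refine IsRational.prod _ fun a _ => ?_
  refine ((IsRational.one_sub_ratio_inv hw ?_).mul (IsRational.one_sub_ratio_inv hw ?_)).mul
    ((IsRational.one_sub_ratio hw _ x).mul (IsRational.one_sub_ratio hw _ x))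
  · rw [contractionExponent, sub_add_cancel]
    exact h _
  · rw [contractionExponent, sub_sub, one_add_one_eq_two, ← mul_sub_one]
    exact h _

theorem contractionFun_self (q t : ℂ) {r : ℕ} (l : Fin r → Fin N) (x : ℂ) :
    contractionFun q t l l x = 1 := by
  rw [contractionFun, newIndices_self, Finset.prod_empty]

theorem contractionFun_eq_zero_of_lt (hq : q ≠ 0) (ht : t ≠ 0) {r : ℕ} {l m : Fin r → Fin N}
    (hl : l ∈ weights N r) (hm : m ∈ weights N r) {b : Fin r} (h : l b < m b) :
    contractionFun q t l m (t ^ 2)⁻¹ = 0 := by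
  classical
  have hlm := strictMono_of_mem_weights hl
  have hmm := strictMono_of_mem_weights hm
  obtain ⟨b, hb, hmin⟩ := WellFounded.has_min (wellFounded_lt (α := Fin r)) {b | l b < m b} ⟨b, h⟩
  have hb' : (l b).val < (m b).val := hb
  have h1 : ∀ b', (m b').val < (l b).val ↔ b' < b := by
    intro b'
    refine ⟨fun h2 => ?_, fun h2 => ?_⟩
    · by_contra h3
      have := hmm.monotone (not_lt.1 h3)
      omega
    · have h3 : ¬ l b' < m b' := fun h3 => hmin b' h3 h2
      have h4 := hlm h2
      rw [Fin.lt_def] at h3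
      dsimp only at h4
      omega
  have h2 : contractionExponent l m b = -1 := by
    have h3 : rankBelow (fun b => (m b).val) (l b).val = b.val := by
      simp only [rankBelow, h1, Finset.sum_boole, Finset.filter_gt_eq_Iio, Fin.card_Iio]
    rw [contractionExponent, h3, sub_self, mul_zero, zero_sub]
  refine Finset.prod_eq_zero (i := b) (Finset.mem_filter.2 ⟨Finset.mem_univ _, fun b' h3 => ?_⟩) ?_
  · rcases lt_or_ge b' b with h4 | h4
    · exact ((h1 b').2 h4).ne h3
    · have := hmm.monotone h4
      omega
  · have h3 : 1 - q * t * (q * t⁻¹) ^ (-1 : ℤ) * (t ^ 2)⁻¹ = 0 := by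
      rw [zpow_neg_one]
      field_simp
      ring
    rw [h2, h3, zero_mul, mul_zero]

theorem contractionFun_eq_zero_of_gt (hq : q ≠ 0) (ht : t ≠ 0) {r : ℕ} {l m : Fin r → Fin N}
    (hl : l ∈ weights N r) (hm : m ∈ weights N r) {b : Fin r} (h : m b < l b) :
    contractionFun q t l m (t ^ 2) = 0 := by
  classical
  have hlm := strictMono_of_mem_weights hl
  have hmm := strictMono_of_mem_weights hm
  obtain ⟨b, hb, hmax⟩ := WellFounded.has_min (wellFounded_gt (α := Fin r)) {b | m b < l b} ⟨b, h⟩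
  have hb' : (m b).val < (l b).val := hb
  have h1 : ∀ b', (m b').val < (l b).val ↔ b' ≤ b := by
    intro b'
    refine ⟨fun h2 => ?_, fun h2 => ?_⟩
    · by_contra h3
      have h4 := hlm (not_le.1 h3)
      have h5 : ¬ m b' < l b' := fun h5 => hmax b' h5 (not_le.1 h3)
      rw [Fin.lt_def] at h5
      dsimp only at h4
      omega
    · have := hmm.monotone h2
      omega
  have h2 : contractionExponent l m b = 1 := by
    have h3 : rankBelow (fun b => (m b).val) (l b).val = b.val + 1 := by
      simp only [rankBelow, h1, Finset.sum_boole, Finset.filter_ge_eq_Iic, Fin.card_Iic]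
      push_cast
      ring
    rw [contractionExponent, h3]
    ring
  refine Finset.prod_eq_zero (i := b) (Finset.mem_filter.2 ⟨Finset.mem_univ _, fun b' h3 => ?_⟩) ?_
  · rcases le_or_gt b' b with h4 | h4
    · exact ((h1 b').2 h4).ne h3
    · have h5 := hlm h4
      have h6 : ¬ m b' < l b' := fun h6 => hmax b' h6 h4
      rw [Fin.lt_def] at h6
      dsimp only at h5
      omega
  · have h3 : 1 - (q * t)⁻¹ * (q * t⁻¹) ^ (1 : ℤ) * t ^ 2 = 0 := by
      rw [zpow_one]
      field_simp
      ring
    rw [h2, h3, mul_zero, mul_zero]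

theorem IsRational.congr {k : ℕ} {w : Fin k → ℂ} (hw : ∀ j, w j ≠ 0) {f g : (Fin k → ℂ) → ℂ}
    (hf : IsRational w f) (h : ∀ z, (∀ j, z j ≠ 0) → g z = f z) : IsRational w g := by
  obtain ⟨P, Q, δ, hδ, h'⟩ := hf
  refine ⟨P, Q, δ, hδ, fun z hz => ?_⟩
  rw [h z]
  · exact h' z hz
  · rcases hz with hz | rfl
    · exact hz.1
    · exact hw

theorem isRational_functional (φ : CHeis N q t →L[ℂ] ℂ) {k : ℕ} {w : Fin k → ℂ}
    (hw : ∀ j, w j ≠ 0) (U : Fin k → VertexOp N) (d : ℤ) :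
    IsRational w fun z => φ ((∏ j, (U j).shift (z j)).mode q t d) := by
  have hfin := finite_support_normalFunctional φ U d
  refine IsRational.congr hw (f := fun z => ∑ n ∈ hfin.toFinset,
    normalFunctional φ U d n * ∏ j, z j ^ (-n j)) ?_ fun z hz => ?_
  · exact IsRational.sum _ fun n _ => (IsRational.const _).mul
      (IsRational.prod _ fun j _ => IsRational.coord_zpow hw j _)
  · refine (hasSum_normalFunctional φ U d hz).unique (hasSum_sum_of_ne_finset_zero fun n hn => ?_)
    rw [Set.Finite.mem_toFinset, Function.mem_support, not_not] at hn
    rw [hn, zero_mul]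

theorem exists_common_radius {ι : Type*} (s : Finset ι) {P : ι → ℝ → Prop}
    (hP : ∀ a ∈ s, ∃ δ, 0 < δ ∧ ∀ ε ≤ δ, P a ε) : ∃ δ, 0 < δ ∧ ∀ a ∈ s, P a δ := by
  have h : ∀ᶠ ε in 𝓝[>] (0 : ℝ), ∀ a ∈ s, P a ε := by
    rw [Filter.eventually_all_finset]
    intro a ha
    obtain ⟨δ, hδ, h⟩ := hP a ha
    filter_upwards [Ioc_mem_nhdsGT hδ] with ε hε using h ε hε.2
  obtain ⟨δ, h1, h2⟩ := (h.and self_mem_nhdsWithin).exists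
  exact ⟨δ, h2, h1⟩

theorem hasContinuedLimit_correctedCoeff (hq : q ≠ 0) (ht : t ≠ 0)
    (hdet : ∀ m : ℕ, 0 < m → IsUnit (cartanP N ((q * t⁻¹) ^ (m : ℤ))).det) (i : Fin (N - 1))
    {k : ℕ} {w : Fin k → ℂ} (hw : ∀ j, w j ≠ 0)
    (hden : ∀ (x : Pairs k) (s : ℤ), 1 - (q * t⁻¹) ^ (2 * s) * (w x.1.2 / w x.1.1) ≠ 0)
    (φ : CHeis N q t →L[ℂ] ℂ) (d : ℤ) :
    HasContinuedLimit
      (fun n : Fin k → ℤ => if ∑ m, n m = d then φ (correctedCoeff N q t i k n) else 0) w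
      (∑ L ∈ Fintype.piFinset fun _ : Fin k => weights N (i.val + 1),
        (∏ x : Pairs k, contractionFun q t (L x.1.1) (L x.1.2) (w x.1.2 / w x.1.1)) *
          φ ((∏ j, (vertexWeight N q t (L j)).shift (w j)).mode q t d)) := by
  choose S hS hS' using hasSum_correctedTerm (N := N) (q := q) (t := t) (k := k) i
  let I := Fintype.piFinset fun _ : Fin k => weights N (i.val + 1)
  have hrat : IsRational w fun z => ∑ L ∈ I,
      (∏ x : Pairs k, contractionFun q t (L x.1.1) (L x.1.2) (z x.1.2 / z x.1.1)) *
        φ ((∏ j, (vertexWeight N q t (L j)).shift (z j)).mode q t d) :=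
    IsRational.sum _ fun L _ => (IsRational.prod _ fun x _ =>
      isRational_contractionFun hw _ _ x (hden x)).mul (isRational_functional φ hw _ d)
  obtain ⟨δ, hδ, h⟩ := exists_common_radius (I ×ˢ (Finset.univ : Finset (Pairs k)))
    (P := fun y δ => ∀ x : ℂ, ‖x‖ < δ →
      (Summable fun r => ‖correctedContraction q t (fCoeff N q t i)
        (vertexWeight N q t (y.1 y.2.1.1)) (vertexWeight N q t (y.1 y.2.1.2)) r * x ^ r‖) ∧
      HasSum (fun r => correctedContraction q t (fCoeff N q t i)
        (vertexWeight N q t (y.1 y.2.1.1)) (vertexWeight N q t (y.1 y.2.1.2)) r * x ^ r)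
        (contractionFun q t (y.1 y.2.1.1) (y.1 y.2.1.2) x)) fun y hy => by
      obtain ⟨δ, hδ, h⟩ := convergesTo_contractionFun hq ht hdet i (l := y.1 y.2.1.1)
        (m := y.1 y.2.1.2) (Fintype.mem_piFinset.1 (Finset.mem_product.1 hy).1 _)
      exact ⟨δ, hδ, fun ε hε x hx => h x (hx.trans_le hε)⟩
  refine hrat.hasContinuedLimit hδ fun z hz => ?_
  have h1 : ∀ L ∈ I, HasSum (fun n : Fin k → ℤ =>
      (if ∑ j, n j = d then φ (S n L) else 0) * ∏ j, z j ^ (-n j)) _ := fun L hL =>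
    hasSum_functional_corrected φ (fun j => vertexWeight N q t (L j)) d hz.1
      (F := fun x => contractionFun q t (L x.1.1) (L x.1.2) (z x.1.2 / z x.1.1))
      (fun x => h (L, x) (Finset.mem_product.2 ⟨hL, Finset.mem_univ _⟩) _ (by
        rw [norm_div, div_lt_iff₀ (norm_pos_iff.2 (hz.1 _))]
        exact hz.2 _ _ x.2)) fun n => hS' n L
  refine (hasSum_sum h1).congr_fun fun n => ?_
  rw [← Finset.sum_mul, correctedCoeff, (hS n).tsum_eq]
  split_ifs
  · rw [map_sum]
  · simp

/-! ### The specialization -/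

theorem ratio_zpow_ne_one {k : ℕ} (hk : 0 < k) (hq' : ∀ j : ℤ, j ≠ 0 → q ^ (2 * j) ≠ 1)
    (ht : IsPrimitiveRoot (t ^ 2) k) {s : ℤ} (hs : s ≠ 0) (j : ℤ) :
    (q * t⁻¹) ^ (2 * s) * (t ^ 2) ^ j ≠ 1 := by
  intro h
  refine hq' (s * k) (mul_ne_zero hs (by exact_mod_cast hk.ne')) ?_
  have h1 : (t ^ 2) ^ (k : ℤ) = 1 := by rw [zpow_natCast]; exact ht.pow_eq_one
  have h2 : ((q * t⁻¹) ^ (2 * s) * (t ^ 2) ^ j) ^ (k : ℤ) = 1 := by rw [h, one_zpow]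
  have h3 : (t ^ (2 * s)) ^ (k : ℤ) = 1 := by
    rw [zpow_mul, ← zpow_mul _ s, mul_comm s, zpow_mul _ (k : ℤ)]
    have h4 : (t ^ (2 : ℤ)) ^ (k : ℤ) = 1 := by exact_mod_cast h1
    rw [h4, one_zpow]
  rw [mul_zpow, ← zpow_mul (t ^ 2), mul_comm j, zpow_mul (t ^ 2), h1, one_zpow, mul_one, mul_zpow,
    mul_zpow, inv_zpow, inv_zpow, h3, inv_one, mul_one, ← zpow_mul] at h2
  rwa [← mul_assoc]

theorem isUnit_det_of_generic {k : ℕ} (hk : 0 < k) (hq : q ≠ 0)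
    (hq' : ∀ j : ℤ, j ≠ 0 → q ^ (2 * j) ≠ 1) (ht : IsPrimitiveRoot (t ^ 2) k) (m : ℕ)
    (hm : 0 < m) : IsUnit (cartanP N ((q * t⁻¹) ^ (m : ℤ))).det := by
  have ht0 : t ≠ 0 := fun h0 => ht.ne_zero hk.ne' (by rw [h0]; simp)
  refine isUnit_det_cartanP (zpow_ne_zero _ (mul_ne_zero hq (inv_ne_zero ht0))) fun j hj h => ?_
  refine ratio_zpow_ne_one hk hq' ht (s := m * j) (by positivity) 0 ?_
  rw [zpow_zero, mul_one, ← h, ← zpow_natCast, ← zpow_mul]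
  congr 1
  push_cast
  ring

theorem one_sub_ratio_ne_zero {k : ℕ} (hk : 0 < k) (hq' : ∀ j : ℤ, j ≠ 0 → q ^ (2 * j) ≠ 1)
    (ht : IsPrimitiveRoot (t ^ 2) k) {m n : ℕ} (hmn : m < n) (hn : n < k) (s : ℤ) :
    1 - (q * t⁻¹) ^ (2 * s) * (t ^ 2) ^ ((m : ℤ) - n) ≠ 0 := by
  rw [sub_ne_zero]
  intro h
  rcases eq_or_ne s 0 with rfl | hs
  · rw [mul_zero, zpow_zero, one_mul] at h
    have h1 := (ht.zpow_eq_one_iff_dvd _).1 h.symm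
    have h2 := Int.le_of_dvd (by omega) ((dvd_neg).2 h1)
    omega
  · exact ratio_zpow_ne_one hk hq' ht hs _ h.symm

theorem specialization_ratio {k : ℕ} {z : ℂ} (hz : z ≠ 0) (ht : t ≠ 0) (m n : Fin k) :
    z * t ^ (2 * (k - (n.val + 1))) / (z * t ^ (2 * (k - (m.val + 1)))) =
      (t ^ 2) ^ ((m.val : ℤ) - n.val) := by
  rw [mul_div_mul_left _ _ hz, pow_mul, pow_mul, ← zpow_natCast (t ^ 2), ← zpow_natCast (t ^ 2),
    ← zpow_sub₀ (pow_ne_zero 2 ht)]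
  congr 1
  have := m.2
  have := n.2
  omega

/-- At the specialization, only the constant sequences of weights contribute. -/
theorem prod_contractionFun_eq_zero {k : ℕ} (hk : 0 < k) (hq : q ≠ 0)
    (ht : IsPrimitiveRoot (t ^ 2) k) {r : ℕ} {L : Fin k → Fin r → Fin N}
    (hL : ∀ j, L j ∈ weights N r) (hne : ¬ ∀ m n, L m = L n) :
    ∏ x : Pairs k, contractionFun q t (L x.1.1) (L x.1.2)
      ((t ^ 2) ^ ((x.1.1.val : ℤ) - x.1.2.val)) = 0 := by
  have ht0 : t ≠ 0 := fun h0 => ht.ne_zero hk.ne' (by rw [h0]; simp)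
  by_cases h : ∃ (m n : Fin k) (b : Fin r), m.val + 1 = n.val ∧ L m b < L n b
  · obtain ⟨m, n, b, hmn, hb⟩ := h
    refine Finset.prod_eq_zero (i := ⟨(m, n), Fin.lt_def.2 (by dsimp only; omega)⟩) (Finset.mem_univ _) ?_
    have h1 : (m.val : ℤ) - n.val = -1 := by omega
    dsimp only
    rw [h1, zpow_neg_one]
    exact contractionFun_eq_zero_of_lt hq ht0 (hL m) (hL n) hb
  · push Not at h
    obtain ⟨k, rfl⟩ : ∃ k', k = k' + 1 := ⟨k - 1, by omega⟩
    have hanti : Antitone L := Fin.antitone_iff_succ_le.2 fun j b => h _ _ b (by simp)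
    have h0 : ∃ b, L (Fin.last k) b < L 0 b := by
      by_contra! hcon
      refine hne ?_
      have h1 : ∀ m, L m = L 0 := fun m => le_antisymm (hanti (Fin.zero_le m))
        (le_trans (fun b => hcon b) (hanti (Fin.le_last m)))
      exact fun m n => (h1 m).trans (h1 n).symm
    obtain ⟨b, hb⟩ := h0
    have hlt : (0 : Fin (k + 1)) < Fin.last k := by
      refine lt_of_le_of_ne (Fin.zero_le _) fun h1 => ?_
      rw [← h1] at hb
      exact lt_irrefl _ hb
    refine Finset.prod_eq_zero (i := ⟨(0, Fin.last k), hlt⟩) (Finset.mem_univ _) ?_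
    have h1 : (t ^ 2) ^ (((0 : Fin (k + 1)).val : ℤ) - (Fin.last k).val) = t ^ 2 := by
      have h2 := ht.pow_eq_one
      rw [pow_succ] at h2
      rw [Fin.val_zero, Fin.val_last, Nat.cast_zero, zero_sub, zpow_neg, zpow_natCast]
      exact (eq_inv_of_mul_eq_one_right h2).symm
    dsimp only
    rw [h1]
    exact contractionFun_eq_zero_of_gt hq ht0 (hL _) (hL _) hb

theorem mode_prod_shift {k : ℕ} (U : Fin k → VertexOp N) {z : ℂ} (hz : z ≠ 0) {c : Fin k → ℂ}
    (hc : ∀ j, c j ≠ 0) (φ : CHeis N q t →L[ℂ] ℂ) (d : ℤ) :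
    φ ((∏ j, (U j).shift (z * c j)).mode q t d) =
      φ ((∏ j, (U j).shift (c j)).mode q t d) * z ^ (-d) := by
  refine (hasSum_normalFunctional φ U d fun j => mul_ne_zero hz (hc j)).unique
    (((hasSum_normalFunctional φ U d hc).mul_right _).congr_fun fun n => ?_)
  rw [normalFunctional]
  split_ifs with hd
  · have h : ∏ j, (z * c j) ^ (-n j) = (∏ j, c j ^ (-n j)) * z ^ (-d) := by
      simp only [mul_zpow, Finset.prod_mul_distrib]
      rw [← zpow_finsetSum hz, Finset.sum_neg_distrib, hd, mul_comm]
    rw [h, mul_assoc]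
  · simp

theorem isRegularizedLimit_vertexPower {k : ℕ} (hk : 0 < k) (hq : q ≠ 0)
    (hq' : ∀ j : ℤ, j ≠ 0 → q ^ (2 * j) ≠ 1) (ht : IsPrimitiveRoot (t ^ 2) k)
    (i : Fin (N - 1)) :
    IsRegularizedLimit N q t i k fun d => ∑ l ∈ weights N (i.val + 1),
      (vertexPower N q t k l).mode q t d := by
  intro φ d z hz
  have ht0 : t ≠ 0 := fun h0 => ht.ne_zero hk.ne' (by rw [h0]; simp)
  have hc : ∀ m : Fin k, t ^ (2 * (k - (m.val + 1))) ≠ 0 := fun m => pow_ne_zero _ ht0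
  have h := hasContinuedLimit_correctedCoeff hq ht0 (isUnit_det_of_generic hk hq hq' ht) i
    (w := fun m : Fin k => z * t ^ (2 * (k - (m.val + 1)))) (fun m => mul_ne_zero hz (hc m))
    (fun x s => by
      rw [specialization_ratio hz ht0]
      exact one_sub_ratio_ne_zero hk hq' ht x.2 x.1.2.2 s) φ d
  convert h using 1
  simp only [specialization_ratio hz ht0]
  have hinj : Function.Injective fun (l : Fin (i.val + 1) → Fin N) (_ : Fin k) => l :=
    fun l l' hl => congrFun hl ⟨0, hk⟩
  rw [map_sum, Finset.sum_mul, ← Finset.sum_subset (s₁ := (weights N (i.val + 1)).map ⟨_, hinj⟩),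
    Finset.sum_map]
  · refine Finset.sum_congr rfl fun l _ => ?_
    simp only [Function.Embedding.coeFn_mk, contractionFun_self, Finset.prod_const_one, one_mul]
    rw [mode_prod_shift (fun _ => vertexWeight N q t l) hz hc, vertexPower]
  · intro L hL
    obtain ⟨l, hl, rfl⟩ := Finset.mem_map.1 hL
    exact Fintype.mem_piFinset.2 fun _ => hl
  · intro L hL hL'
    rw [prod_contractionFun_eq_zero hk hq ht (fun j => Fintype.mem_piFinset.1 hL j), zero_mul]
    intro hcon
    refine hL' (Finset.mem_map.2 ⟨L ⟨0, hk⟩, Fintype.mem_piFinset.1 hL _, ?_⟩)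
    funext j
    exact hcon _ _

theorem IsRegularizedLimit.unique {i : Fin (N - 1)} {k : ℕ} {Ψ Ψ' : ℤ → CHeis N q t}
    (h : IsRegularizedLimit N q t i k Ψ) (h' : IsRegularizedLimit N q t i k Ψ') : Ψ = Ψ' := by
  funext d
  by_contra hne
  obtain ⟨φ, -, hφ⟩ := exists_functional (W := (⊥ : Submodule ℂ (CHeis N q t)))
    (x := Ψ d - Ψ' d) (by rw [Submodule.bot_coe]; exact isClosed_singleton)
    (by rwa [Submodule.mem_bot, sub_eq_zero])
  have h1 := (h φ d 1 one_ne_zero).unique (h' φ d 1 one_ne_zero)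
  rw [one_zpow, mul_one, mul_one] at h1
  exact hφ (by rw [map_sub, h1, sub_self])

theorem isClosed_WAlg (N : ℕ) (q t : ℂ) : IsClosed (WAlg N q t : Set (CHeis N q t)) :=
  Subalgebra.isClosed_topologicalClosure _

theorem genT_mem_WAlg (i : Fin (N - 1)) (n : ℤ) : genT N q t i n ∈ WAlg N q t :=
  Subalgebra.le_topologicalClosure _ (Algebra.subset_adjoin ⟨i, n, rfl⟩)

theorem correctedCoeff_mem_WAlg (i : Fin (N - 1)) {k : ℕ} (n : Fin k → ℤ) :
    correctedCoeff N q t i k n ∈ WAlg N q t := by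
  refine (isClosed_WAlg N q t).mem_of_tendsto (hasSum_correctedTerm i n).choose_spec.1.summable.hasSum
    (Eventually.of_forall fun s => ?_)
  refine sum_mem fun e _ => Subalgebra.smul_mem _ (list_prod_mem fun x hx => ?_) _
  obtain ⟨j, rfl⟩ := (List.mem_ofFn' _ _).1 hx
  exact genT_mem_WAlg i _

theorem IsRegularizedLimit.mem_WAlg {i : Fin (N - 1)} {k : ℕ} {Ψ : ℤ → CHeis N q t}
    (h : IsRegularizedLimit N q t i k Ψ) (d : ℤ) : Ψ d ∈ WAlg N q t := by
  by_contra hne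
  obtain ⟨φ, hφ, hφ'⟩ := exists_functional (W := Subalgebra.toSubmodule (WAlg N q t))
    (isClosed_WAlg N q t) hne
  have h1 := h φ d 1 one_ne_zero
  have h2 : (fun n : Fin k → ℤ => if ∑ m, n m = d then φ (correctedCoeff N q t i k n) else 0) =
      fun _ => 0 := by
    funext n
    rw [hφ _ (correctedCoeff_mem_WAlg i n), ite_self]
  rw [h2, one_zpow, mul_one] at h1
  exact hφ' (h1.unique hasContinuedLimit_zero)

/-! ### Centrality -/

theorem gen_a_central {m : ℤ} (h : (t ^ 2) ^ m = 1) (ht : t ≠ 0) (j : Fin (N - 1)) (x : Heis N q t) :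
    Commute (gen N q t (.a j m)) x := by
  have hm : t ^ m = t ^ (-m) := by
    rw [zpow_neg, ← mul_eq_one_iff_eq_inv₀ (zpow_ne_zero _ ht), ← zpow_add₀ ht, ← two_mul, zpow_mul]
    exact_mod_cast h
  refine heis_induction (P := fun x => Commute (gen N q t (.a j m)) x) ?_
    (fun c => (Algebra.commutes c _).symm) (fun _ _ h h' => h.add_right h')
    (fun _ _ h h' => h.mul_right h') x
  rintro (⟨b, n⟩ | b | b)
  · have h1 := gen_comm (q := q) (t := t) j b m n
    have h2 : bracket N q t j b m n = 0 := by
      rw [bracket]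
      split_ifs
      · rw [hm, sub_self, mul_zero, zero_mul]
      · rfl
    rw [h2, map_zero, add_zero] at h1
    exact h1
  · exact (gen_K_comm b _).symm
  · exact gen_Kinv_comm b _

theorem osc_vertexPower {k : ℕ} {r : ℕ} (l : Fin r → Fin N)
    (ht : IsPrimitiveRoot (t ^ 2) k) {m : ℤ} (hm : (t ^ 2) ^ m ≠ 1) :
    (vertexPower N q t k l).osc m = 0 := by
  rw [vertexPower, osc_prod]
  funext j
  rw [Finset.sum_apply]
  simp only [VertexOp.shift]
  rw [← Finset.sum_mul]
  have h1 : ∀ s : Fin k, (t ^ (2 * (k - (s.val + 1)))) ^ (-m) =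
      ((t ^ 2) ^ (-m)) ^ (k - 1 - s.val) := fun s => by
    rw [pow_mul, ← zpow_natCast (t ^ 2), ← zpow_natCast ((t ^ 2) ^ (-m)), ← zpow_mul, ← zpow_mul,
      mul_comm, Nat.sub_sub, add_comm 1]
  simp only [h1]
  rw [Fin.sum_univ_eq_sum_range (fun s => ((t ^ 2) ^ (-m)) ^ (k - 1 - s)) k,
    Finset.sum_range_reflect (fun s => ((t ^ 2) ^ (-m)) ^ s)]
  have h2 := geom_sum_mul ((t ^ 2) ^ (-m)) k
  have h3 : ((t ^ 2) ^ (-m)) ^ k = 1 := by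
    rw [← zpow_natCast, ← zpow_mul, mul_comm, zpow_mul, zpow_natCast, ht.pow_eq_one, one_zpow]
  rw [h3, sub_self, mul_eq_zero, sub_eq_zero] at h2
  rcases h2 with h2 | h2
  · rw [h2, zero_mul, Pi.zero_apply]
  · rw [zpow_neg, inv_eq_one] at h2
    exact absurd h2 hm

theorem mode_central {U : VertexOp N}
    (hU : ∀ (m : ℤ) (x : Heis N q t), Commute (∑ j, U.osc m j • gen N q t (.a j m)) x) (d : ℤ)
    (x : CHeis N q t) : U.mode q t d * x = x * U.mode q t d := by
  have hcr : ∀ a (x : Heis N q t), Commute (U.creationZ q t a) x := fun a x => by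
    rw [creationZ]
    split_ifs
    · exact (commute_expCoeff (fun m _ => (hU _ x).symm) _).symm
    · exact Commute.zero_left x
  have han : ∀ a (x : Heis N q t), Commute (U.annihilationZ q t a) x := fun a x => by
    rw [annihilationZ]
    split_ifs
    · exact (commute_expCoeff (fun m _ => (hU _ x).symm) _).symm
    · exact Commute.zero_left x
  induction x using Completion.induction_on with
  | hp => exact isClosed_eq (continuous_const.mul continuous_id) (continuous_id.mul continuous_const)
  | ih x =>
    have h := (U.hasSum_mode (q := q) (t := t) d).2
    refine (h.mul_right (x : CHeis N q t)).unique ((h.mul_left (x : CHeis N q t)).congr_fun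
      fun a => ?_)
    rw [← Completion.coe_mul, ← Completion.coe_mul,
      (((zeroPart_commute U x).mul_left (hcr a x)).mul_left (han _ x)).eq]

theorem mode_vertexPower_central {k : ℕ} (hk : 0 < k) (ht : IsPrimitiveRoot (t ^ 2) k) {r : ℕ}
    (l : Fin r → Fin N) (d : ℤ) (x : CHeis N q t) :
    (vertexPower N q t k l).mode q t d * x = x * (vertexPower N q t k l).mode q t d := by
  have ht0 : t ≠ 0 := fun h0 => ht.ne_zero hk.ne' (by rw [h0]; simp)
  refine mode_central (fun m x => Commute.sum_left _ _ _ fun j _ => ?_) d x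
  by_cases hm : (t ^ 2) ^ m = 1
  · exact (gen_a_central hm ht0 j x).smul_left _
  · rw [osc_vertexPower l ht hm, Pi.zero_apply, zero_smul]
    exact Commute.zero_left x

end DeformedW

theorem theorem5p1 (N k : ℕ) (hk : 0 < k) (q t : ℂ) (hq : q ≠ 0)
    (hq' : ∀ j : ℤ, j ≠ 0 → q ^ (2 * j) ≠ 1) (ht : IsPrimitiveRoot (t ^ 2) k)
    (i : Fin (N - 1)) :
    (∀ (U : DeformedW.VertexOp N) (n : ℤ), Summable (U.modeTerm q t n)) ∧
    (∀ n : Fin k → ℤ, Summable (DeformedW.correctedTerm N q t i k n)) ∧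
    ∃ Ψ : ℤ → DeformedW.CHeis N q t,
      DeformedW.IsRegularizedLimit N q t i k Ψ ∧
      (∀ Ψ' : ℤ → DeformedW.CHeis N q t,
        DeformedW.IsRegularizedLimit N q t i k Ψ' → Ψ' = Ψ) ∧
      (∀ d : ℤ, Ψ d = ∑ l ∈ DeformedW.weights N (i.val + 1),
        (DeformedW.vertexPower N q t k l).mode q t d) ∧
      (∀ d : ℤ, ∃ h : Ψ d ∈ DeformedW.WAlg N q t,
        (⟨Ψ d, h⟩ : DeformedW.WAlg N q t) ∈ Subalgebra.center ℂ (DeformedW.WAlg N q t)) ∧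
      (∀ (d : ℤ) (x : DeformedW.CHeis N q t), Ψ d * x = x * Ψ d) := by
  have hlim := DeformedW.isRegularizedLimit_vertexPower hk hq hq' ht i
  have hcomm : ∀ (d : ℤ) (x : DeformedW.CHeis N q t),
      (∑ l ∈ DeformedW.weights N (i.val + 1), (DeformedW.vertexPower N q t k l).mode q t d) * x =
        x * ∑ l ∈ DeformedW.weights N (i.val + 1),
          (DeformedW.vertexPower N q t k l).mode q t d := fun d x => by
    rw [Finset.sum_mul, Finset.mul_sum]
    exact Finset.sum_congr rfl fun l _ => DeformedW.mode_vertexPower_central hk ht l d x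
  refine ⟨fun U n => (U.hasSum_mode n).1, fun n =>
    (DeformedW.hasSum_correctedTerm i n).choose_spec.1.summable, _, hlim, fun Ψ' h => h.unique hlim,
    fun d => rfl, fun d => ⟨hlim.mem_WAlg d, ?_⟩, hcomm⟩
  rw [Subalgebra.mem_center_iff]
  exact fun x => Subtype.ext (hcomm d x).symm

end
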